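/- \textbf{Definitions.} The germ at $z_0$ of a (possibly multivalued) function $f$ is \emph{resurgent} if there is a countable set $S\subset\mathbb C\setminus\{z_0\}$ without accumulation points such that $f$ continues analytically along every path from $z_0$ in $\mathbb C\setminus S$, and every branch satisfies $|f(z)|\le Ce^{A|z|}$ as $z\to\infty$ along any half-line avoiding $S$ ($C,A$ may depend on the branch and on the half-line). A function $f$ satisfies (A1) if its germ at $0$ is resurgent with no singularities in the closed strip $0\le\Re u\le 1$, so that $f$ is there a single holomorphic branch, and $f(u)=o(e^{2\pi|\Im u|})$ as $|\Im u|\to\infty$ in the strip, uniformly in $\Re u$. Let $U\subset\mathbb C$ be open, let $a$ be a function on $U$ and $\log a$ a holomorphic branch of its logarithm on $U$. Call a real number $x$ \emph{admissible} if $xu\in U$ whenever $0\le\Re u\le1$ and $s\mapsto\log a(sx)$ satisfies (A1). Consider the difference equation $$y(x+\epsilon,\epsilon)=a(x)\,y(x,\epsilon)\qquad(\epsilon>0).\tag{1}$$ Its formal (WKB) solution is $\exp\bigl(\frac1\epsilon\sum_{k\ge0}F_k(x)\epsilon^k\bigr)$, where the $F_k$ are analytic near the segment $[0,x]$, $F_k(0)=0$,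 $F_0'(0)=\log a(0)$, and (1) holds as an identity of formal power series in $\epsilon$ at every point of the segment when $F_k(x+\epsilon)$ is expanded in its Taylor series. Put $$G(q,x)=\frac1{4\pi^2}\sum_{n=1}^\infty\frac1{n^2}\left(\frac{a'}{a}\Bigl(x+\frac q{2\pi in}\Bigr)+\frac{a'}{a}\Bigl(x-\frac q{2\pi in}\Bigr)-\frac{a'}{a}\Bigl(\frac q{2\pi in}\Bigr)-\frac{a'}{a}\Bigl(-\frac q{2\pi in}\Bigr)\right).$$ Integrals $\int_0^\infty e^{-q/\epsilon}G(q,x)\,dq$ are improper integrals $\lim_{R\to\infty}\int_0^R$. \textbf{Theorem.} (a) Let $x$ be admissible. A formal solution as above exists. The series $G(q,x)$ converges absolutely for all $q\ge0$, and $\int_0^\infty e^{-q/\epsilon}G(q,x)\,dq$ converges for $0<\epsilon\le|x|$ (for all $\epsilon>0$ if $x=0$). For every formal solution as above, $$\frac1\epsilon\sum_{k=0}^\infty F_k(x)\epsilon^k\sim\frac1\epsilon\int_0^x\log a(q)\,dq-\frac12\log a(x)+\frac12\log a(0)+\int_0^\infty e^{-q/\epsilon}G(q,x)\,dq\qquad(\epsilon\to0^+),$$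 that is, for every $K\ge0$ the right-hand side minus $\frac1\epsilon\sum_{k<K}F_k(x)\epsilon^k$ is $O(\epsilon^{K-1})$. Moreover, if $r>0$ is such that the closed discs of radius $r$ about $0$ and $x$ lie in $U$, and $\gamma_0$ is the circle $|s|=r$ oriented counterclockwise, then for all complex $q$ with $|q|<2\pi r$ the series for $G(q,x)$ converges absolutely and $$G(q,x)=\frac1{(2\pi i)^3}\int_0^\infty\!\!\int_{\gamma_0}\frac u{e^u-1}\,\frac{\log a(s)-\log a(x+s)}{s^2}\left(e^{\frac{qu}{2\pi is}}+e^{-\frac{qu}{2\pi is}}\right)ds\,du,$$ the outer integral being absolutely convergent. (b) For $\epsilon>0$ the function $$y(x,\epsilon)=\sqrt{\frac{a(0)}{a(x)}}\,\exp\left(\frac1\epsilon\int_0^x\log a(q)\,dq+\int_0^\infty e^{-q/\epsilon}G(q,x)\,dq\right),\qquad \sqrt{\frac{a(0)}{a(x)}}:=e^{\frac12(\log a(0)-\log a(x))},$$ solves (1): if $x$ and $x+\epsilon$ are admissible and $x\ge0$ or $x+\epsilon\le0$, then the integrals defining $y(x,\epsilon)$ and $y(x+\epsilon,\epsilon)$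 converge and $y(x+\epsilon,\epsilon)=a(x)y(x,\epsilon)$. -/

import Mathlib

open Filter Topology MeasureTheory

noncomputable section

/-- `g t` is, for every `t ≥ 0`, the germ at `γ t` obtained from the germ of `f` at `γ 0` by
analytic continuation along the path `γ : [0, ∞) → ℂ`. -/
structure ContinuationAlong (f : ℂ → ℂ) (γ : ℝ → ℂ) (g : ℝ → ℂ → ℂ) : Prop where
  start : g 0 =ᶠ[𝓝 (γ 0)] f
  analytic : ∀ t : ℝ, 0 ≤ t → AnalyticAt ℂ (g t) (γ t)
  coherent : ∀ t : ℝ, 0 ≤ t → ∀ᶠ s in 𝓝[Set.Ici 0] t, g s =ᶠ[𝓝 (γ s)] g t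

/-- From some time on, the path `γ` runs along a half-line to infinity. -/
def EventuallyStraight (γ : ℝ → ℂ) : Prop :=
  ∃ (T : ℝ) (w d : ℂ), d ≠ 0 ∧ ∀ t : ℝ, T ≤ t → γ t = w + (t : ℂ) * d

/-- The germ of `f` at `z₀` is resurgent with singularities in `S`: the set `S` is countable and
has no accumulation point, `f` has an analytic continuation along every path from `z₀` that
avoids `S`, and every branch is exponentially bounded, `|f(z)| ≤ C exp(A |z|)` for large `z`.
The functions considered are multivalued in general (for instance logarithms), so `C` and `A` may
depend on the branch and on the direction in which `z` goes to infinity. -/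
def IsResurgentAt (f : ℂ → ℂ) (z₀ : ℂ) (S : Set ℂ) : Prop :=
  S.Countable ∧ (∀ z : ℂ, ¬ AccPt z (𝓟 S)) ∧ z₀ ∉ S ∧
  ∀ γ : ℝ → ℂ, ContinuousOn γ (Set.Ici 0) → γ 0 = z₀ → (∀ t : ℝ, 0 ≤ t → γ t ∉ S) →
    ∃ g : ℝ → ℂ → ℂ, ContinuationAlong f γ g ∧
      (EventuallyStraight γ →
        ∃ C A : ℝ, ∀ᶠ t in atTop, ‖g t (γ t)‖ ≤ C * Real.exp (A * ‖γ t‖))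

/-- The closed vertical strip `0 ≤ Re u ≤ 1`. -/
def unitStrip : Set ℂ := {u : ℂ | 0 ≤ u.re ∧ u.re ≤ 1}

/-- `f` is resurgent without singularities in the closed strip `0 ≤ Re u ≤ 1` (where the values of
`f` are those of a single holomorphic branch), and `f(u) = o(exp(2π |Im u|))` as `|Im u| → ∞` in
the strip, uniformly in `Re u`. -/
def ConditionA1 (f : ℂ → ℂ) : Prop :=
  (∃ S : Set ℂ, IsResurgentAt f 0 S ∧ Disjoint S unitStrip) ∧
  AnalyticOnNhd ℂ f unitStrip ∧
  ∀ η : ℝ, 0 < η → ∃ R : ℝ, ∀ u ∈ unitStrip, R ≤ |u.im| →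
    ‖f u‖ ≤ η * Real.exp (2 * Real.pi * |u.im|)

/-- `s ↦ log a(s x)` satisfies the condition above, where `L` is the branch of `log a` on `U`. -/
def Admissible (L : ℂ → ℂ) (U : Set ℂ) (x : ℝ) : Prop :=
  (∀ u ∈ unitStrip, u * (x : ℂ) ∈ U) ∧ ConditionA1 (fun s : ℂ => L (s * (x : ℂ)))

/-- The exponential of a formal power series `E = E₀ + E₁ ε + ⋯`, that is
`exp(E₀) · ∑ (E - E₀)^n / n!`. -/
def formalExp (E : PowerSeries ℂ) : PowerSeries ℂ :=
  PowerSeries.C (Complex.exp (PowerSeries.constantCoeff E)) *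
    (PowerSeries.exp ℂ).subst (E - PowerSeries.C (PowerSeries.constantCoeff E))

/-- The formal power series in `ε` given by `ε⁻¹ ∑ₖ (Fₖ(z + ε) - Fₖ(z)) εᵏ`, where `Fₖ(z + ε)` is
expanded in its Taylor series at `z`. -/
def formalIncrement (F : ℕ → ℂ → ℂ) (z : ℂ) : PowerSeries ℂ :=
  PowerSeries.mk fun m =>
    ∑ j ∈ Finset.range (m + 1), iteratedDeriv (j + 1) (F (m - j)) z / ((j + 1).factorial : ℂ)

/-- `y(z, ε) = exp(ε⁻¹ ∑ₖ Fₖ(z) εᵏ)` is the formal (WKB) solution of `y(z + ε) = a(z) y(z)` on the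
segment from `0` to `x`, normalized by `Fₖ(0) = 0`; the branch of `F₀' = log a` is the one of `L`.
The equation is written as `y(z + ε) / y(z) = a(z)`. -/
structure IsWKBExponent (a L : ℂ → ℂ) (x : ℝ) (F : ℕ → ℂ → ℂ) : Prop where
  analytic : ∀ k : ℕ, AnalyticOnNhd ℂ (F k) (segment ℝ (0 : ℂ) (x : ℂ))
  map_zero : ∀ k : ℕ, F k 0 = 0
  branch : deriv (F 0) 0 = L 0
  equation : ∀ z ∈ segment ℝ (0 : ℂ) (x : ℂ),
    formalExp (formalIncrement F z) = PowerSeries.C (a z)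

/-- The logarithmic derivative `a'/a`. -/
def dlog (a : ℂ → ℂ) (z : ℂ) : ℂ := deriv a z / a z

/-- The point `q / (2πi n)` for `n = m + 1`. -/
def borelPoint (q : ℂ) (m : ℕ) : ℂ := q / (2 * (Real.pi : ℂ) * Complex.I * ((m : ℂ) + 1))

/-- The term with index `n = m + 1` of the series that defines `G(q, x)`. -/
def borelTerm (a : ℂ → ℂ) (q x : ℂ) (m : ℕ) : ℂ :=
  1 / ((m : ℂ) + 1) ^ 2 *
    (dlog a (x + borelPoint q m) + dlog a (x - borelPoint q m)
      - dlog a (borelPoint q m) - dlog a (-borelPoint q m))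

/-- The function `G(q, x)`. -/
def borelG (a : ℂ → ℂ) (q x : ℂ) : ℂ :=
  1 / (4 * (Real.pi : ℂ) ^ 2) * ∑' m : ℕ, borelTerm a q x m

/-- The inner (contour) integral, over the positively oriented circle of radius `r` around `0`,
of the double integral for `G(q, x)`. -/
def contourInner (L : ℂ → ℂ) (r : ℝ) (q x : ℂ) (u : ℝ) : ℂ :=
  ∮ s in C(0, r), (u : ℂ) / (Complex.exp (u : ℂ) - 1) *
    ((L s - L (x + s)) / s ^ 2 *
      (Complex.exp (q * (u : ℂ) / (2 * (Real.pi : ℂ) * Complex.I * s))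
        + Complex.exp (-(q * (u : ℂ) / (2 * (Real.pi : ℂ) * Complex.I * s)))))

/-- The integrand of the Laplace integral `∫₀^∞ exp(-q/ε) G(q, x) dq`. -/
def laplaceIntegrand (a : ℂ → ℂ) (x ε : ℝ) (q : ℝ) : ℂ :=
  Complex.exp (-((q : ℂ) / (ε : ℂ))) * borelG a (q : ℂ) (x : ℂ)

/-- `∫₀^∞ exp(-q/ε) G(q, x) dq` converges as an improper integral. -/
def LaplaceConverges (a : ℂ → ℂ) (x ε : ℝ) : Prop :=
  (∀ R : ℝ, 0 ≤ R → IntervalIntegrable (laplaceIntegrand a x ε) volume 0 R) ∧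
  ∃ J : ℂ, Tendsto (fun R : ℝ => ∫ q in (0 : ℝ)..R, laplaceIntegrand a x ε q) atTop (𝓝 J)

/-- The value of the improper integral `∫₀^∞ exp(-q/ε) G(q, x) dq`. -/
def laplaceG (a : ℂ → ℂ) (x ε : ℝ) : ℂ :=
  limUnder atTop (fun R : ℝ => ∫ q in (0 : ℝ)..R, laplaceIntegrand a x ε q)

/-- `ε⁻¹ ∫₀ˣ log a - ½ log a(x) + ½ log a(0) + ∫₀^∞ exp(-q/ε) G(q, x) dq`. -/
def exactExponent (a L : ℂ → ℂ) (x ε : ℝ) : ℂ :=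
  1 / (ε : ℂ) * (∫ t in (0 : ℝ)..x, L (t : ℂ)) - 1 / 2 * L (x : ℂ) + 1 / 2 * L 0
    + laplaceG a x ε

/-- `√(a(0)/a(x)) exp(ε⁻¹ ∫₀ˣ log a + ∫₀^∞ exp(-q/ε) G(q, x) dq)`, where the square root is
`exp(½ (log a(0) - log a(x)))`: the branch that is continuous in `x` and equal to `1` at
`x = 0`. -/
def exactSolution (a L : ℂ → ℂ) (x ε : ℝ) : ℂ :=
  Complex.exp ((L 0 - L (x : ℂ)) / 2) *
    Complex.exp (1 / (ε : ℂ) * (∫ t in (0 : ℝ)..x, L (t : ℂ)) + laplaceG a x ε)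

end

/-! Write `L = log a` and `D = d/dz`. After taking logarithms, the formal equation says that
`(e^{εD} - 1)/ε` maps `∑ F_k ε^k` to the constant series `L`. The generating function of the
Bernoulli numbers inverts this operator and gives `F_k' = B_k/k! · L^{(k)}`
(`IsWKBExponent.iteratedDeriv_succ`). Hence `F_0` is the integral of `L`, and for `k ≥ 1` the value
`F_k(x)` is `B_k/k!` times the increment of `L^{(k-1)}` from `0` to `x`.

On the analytic side, let `W(t)` be the increment from `z = 0` to `z = x` of `L(z + t/2πi) - L(z -
t/2πi)` (`planaNumerator`). The series for `G` is `i/2π · ∑ W'(t/n)/n²`. Integrating by parts,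
rescaling `t` by `n` and summing `∑ e^{-nt/ε} = 1/(e^{t/ε} - 1)` turns the Laplace integral of `G`
into `i/(2πε) ∫ W(t)/(e^{t/ε} - 1) dt` (`tendsto_integral_exp_mul_tsum`,
`laplaceG_eq_of_hasPlanaLimit`), which is an Abel–Plana integral.

Two conclusions follow from this representation. Replacing `x` by `x + ε` changes the integral by
the Abel–Plana formula for a strip of width `ε`, that is, by the error of the trapezoidal rule for
`L` on `[x, x + ε]`; together with the explicit terms of the exponent this leaves exactly `L(x)`,
which is the difference equation (`exactSolution_add`). And Watson's lemma expands the integral as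
`ε → 0`: the Taylor coefficients of `W` are odd derivatives of `L`, the moments of the kernel are
values of zeta at even integers, and Euler's formula turns these into the Bernoulli numbers of the
formal solution (`isBigO_exactExponent_sub`).

The contour formula is independent of this: expand `u/(e^u - 1) = ∑ u e^{-nu}`, integrate in `u`
first, and apply Cauchy's formula for the derivative (`hasSum_contour`).

The delicate point is the borderline `ε = |x|`, where the integrals need not converge absolutely.
Only the term `n = 1` is affected; the little-o in (A1) removes its boundary term, and Abel–Plana
supplies the limit. -/

/-! ### Formal exponentials and the Bernoulli recursion -/

theorem PowerSeries.eq_zero_of_exp_subst_eq_one {N : PowerSeries ℂ}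
    (h0 : PowerSeries.constantCoeff N = 0) (h : (PowerSeries.exp ℂ).subst N = 1) : N = 0 := by
  have hs : PowerSeries.HasSubst N := PowerSeries.HasSubst.of_constantCoeff_zero' h0
  have hd := PowerSeries.derivative_subst (f := PowerSeries.exp ℂ) hs
  -- As `exp` is its own derivative, the chain rule becomes `1' = 1 · N'`, so `N` is constant.
  rw [PowerSeries.derivative_exp, h, one_mul] at hd
  apply PowerSeries.derivative.ext
  · rw [← hd]; simp
  · simp [h0]

theorem PowerSeries.constantCoeff_exp_subst {N : PowerSeries ℂ}
    (h0 : PowerSeries.constantCoeff N = 0) :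
    PowerSeries.constantCoeff ((PowerSeries.exp ℂ).subst N) = 1 := by
  have hs : PowerSeries.HasSubst N := PowerSeries.HasSubst.of_constantCoeff_zero' h0
  refine (PowerSeries.constantCoeff_subst hs _).trans ?_
  rw [finsum_eq_single _ 0]
  · simp
  · intro n hn
    have : MvPowerSeries.constantCoeff N = 0 := h0
    simp [hn, this]

theorem formalExp_C (c : ℂ) : formalExp (PowerSeries.C c) = PowerSeries.C (Complex.exp c) := by
  have hs : PowerSeries.HasSubst (0 : PowerSeries ℂ) :=
    PowerSeries.HasSubst.of_constantCoeff_zero' (by simp)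
  have : (PowerSeries.exp ℂ).subst (0 : PowerSeries ℂ) = 1 := by
    apply PowerSeries.derivative.ext
    · rw [PowerSeries.derivative_subst hs]; simp
    · rw [PowerSeries.constantCoeff_exp_subst (by simp)]; simp
  simp [formalExp, this]

/-- The formal exponential has trivial kernel on series without constant term. This linearizes the
WKB equation: the increment must be a constant series whose constant is a logarithm of `a`. -/
theorem formalExp_eq_C_iff (E : PowerSeries ℂ) (w : ℂ) :
    formalExp E = PowerSeries.C w ↔
      Complex.exp (PowerSeries.constantCoeff E) = w ∧
        E = PowerSeries.C (PowerSeries.constantCoeff E) := by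
  constructor
  · intro h
    set e := PowerSeries.constantCoeff E with he
    set N := E - PowerSeries.C e with hN
    have h0 : PowerSeries.constantCoeff N = 0 := by simp [hN, he]
    have hc := PowerSeries.constantCoeff_exp_subst h0
    have hw : Complex.exp e = w := by
      have := congrArg PowerSeries.constantCoeff h
      simpa [formalExp, ← he, ← hN, hc] using this
    refine ⟨hw, ?_⟩
    have h1 : (PowerSeries.exp ℂ).subst N = 1 := by
      have hu : PowerSeries.C (Complex.exp e) * (PowerSeries.exp ℂ).subst N
          = PowerSeries.C (Complex.exp e) * 1 := by
        rw [mul_one]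
        nth_rewrite 2 [hw]
        rw [← h, formalExp, ← he, ← hN]
      refine mul_left_cancel₀ ?_ hu
      simp [Complex.exp_ne_zero]
    exact sub_eq_zero.mp (PowerSeries.eq_zero_of_exp_subst_eq_one h0 h1)
  · rintro ⟨h1, h2⟩
    rw [h2, formalExp_C, h1]

/-- This is `t/(e^t - 1) · (e^t - 1)/t = 1` read off coefficientwise, obtained from the recursion
for the Bernoulli numbers on division by `(m + 1)!`. The convention is `B_1 = -1/2`, the source of
the term `-½ log a(x)`. -/
theorem sum_bernoulli_div_factorial (m : ℕ) :
    ∑ j ∈ Finset.range (m + 1),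
      ((bernoulli (m - j) : ℚ) : ℂ) / ((m - j).factorial : ℂ) / ((j + 1).factorial : ℂ)
      = if m = 0 then 1 else 0 := by
  have h := sum_bernoulli (m + 1)
  rw [← Finset.sum_range_reflect] at h
  have h2 : ∑ j ∈ Finset.range (m + 1),
      (bernoulli (m - j) : ℚ) / ((m - j).factorial : ℚ) / ((j + 1).factorial : ℚ)
      = if m = 0 then 1 else 0 := by
    have : ∑ j ∈ Finset.range (m + 1),
        (bernoulli (m - j) : ℚ) / ((m - j).factorial : ℚ) / ((j + 1).factorial : ℚ) =
        (∑ j ∈ Finset.range (m + 1),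
          ((m + 1).choose (m + 1 - 1 - j) : ℚ) * bernoulli (m + 1 - 1 - j)) /
            ((m + 1).factorial : ℚ) := by
      rw [Finset.sum_div]
      refine Finset.sum_congr rfl fun j hj => ?_
      have hj' : j ≤ m := by simpa [Nat.lt_succ_iff] using hj
      rw [Nat.add_sub_cancel, Nat.cast_choose ℚ (by omega : m - j ≤ m + 1),
        show m + 1 - (m - j) = j + 1 by omega]
      have := Nat.factorial_ne_zero (m + 1)
      field_simp
    rw [this, h]
    rcases m with _ | m <;> simp
  have h3 := congrArg (fun r : ℚ => (r : ℂ)) h2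
  push_cast at h3
  rw [h3]
  split_ifs <;> simp

theorem formalIncrement_eq_C_iff (F : ℕ → ℂ → ℂ) (z c : ℂ) :
    formalIncrement F z = PowerSeries.C c ↔ ∀ m : ℕ,
      ∑ j ∈ Finset.range (m + 1), iteratedDeriv (j + 1) (F (m - j)) z / ((j + 1).factorial : ℂ)
        = if m = 0 then c else 0 := by
  rw [PowerSeries.ext_iff]
  simp [formalIncrement, PowerSeries.coeff_C]

/-- Under the hypothesis every summand in the coefficient of `ε^m` is a multiple of the same
derivative `L^{(m)}`, and the multiples add up to `1` for `m = 0` and to `0` otherwise. -/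
theorem formalIncrement_eq_of_iteratedDeriv {F : ℕ → ℂ → ℂ} {L : ℂ → ℂ} {z : ℂ}
    (h : ∀ k j : ℕ, iteratedDeriv (j + 1) (F k) z =
      ((bernoulli k : ℚ) : ℂ) / (k.factorial : ℂ) * iteratedDeriv (k + j) L z) :
    formalIncrement F z = PowerSeries.C (L z) := by
  rw [formalIncrement_eq_C_iff]
  intro m
  have : ∀ j ∈ Finset.range (m + 1),
      iteratedDeriv (j + 1) (F (m - j)) z / ((j + 1).factorial : ℂ) =
      ((bernoulli (m - j) : ℚ) : ℂ) / ((m - j).factorial : ℂ) / ((j + 1).factorial : ℂ)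
        * iteratedDeriv m L z := by
    intro j hj
    have hj' : j ≤ m := by simpa [Nat.lt_succ_iff] using hj
    rw [h, Nat.sub_add_cancel hj']; ring
  rw [Finset.sum_congr rfl this, ← Finset.sum_mul, sum_bernoulli_div_factorial]
  rcases m with _ | m <;> simp

/-! ### Analytic functions near the segment and the coefficients of formal solutions -/

theorem analyticAt_iteratedDeriv {f : ℂ → ℂ} {z : ℂ} (hf : AnalyticAt ℂ f z) (n : ℕ) :
    AnalyticAt ℂ (iteratedDeriv n f) z := by
  induction n with
  | zero => simpa using hf
  | succ n ih => rw [iteratedDeriv_succ]; exact ih.deriv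

theorem ofReal_mem_segment {x t : ℝ} (ht : t ∈ Set.uIcc 0 x) :
    (t : ℂ) ∈ segment ℝ (0 : ℂ) (x : ℂ) := by
  rw [← segment_eq_uIcc] at ht
  obtain ⟨p, q, hp, hq, hpq, rfl⟩ := ht
  exact ⟨p, q, hp, hq, hpq, by simp⟩

theorem exists_ofReal_of_mem_segment {x : ℝ} {z : ℂ} (hz : z ∈ segment ℝ (0 : ℂ) (x : ℂ)) :
    ∃ t ∈ Set.uIcc 0 x, (t : ℂ) = z := by
  obtain ⟨p, q, hp, hq, hpq, rfl⟩ := hz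
  refine ⟨q * x, ?_, by simp⟩
  rw [← segment_eq_uIcc]
  exact ⟨p, q, hp, hq, hpq, by simp⟩

/-- A nondegenerate segment accumulates at each of its points, so the identity theorem applies.
Identities known only on the segment may thus be differentiated as complex identities. -/
theorem eventuallyEq_of_eqOn_segment {x : ℝ} (hx : x ≠ 0) {f g : ℂ → ℂ}
    (hf : AnalyticOnNhd ℂ f (segment ℝ (0 : ℂ) (x : ℂ)))
    (hg : AnalyticOnNhd ℂ g (segment ℝ (0 : ℂ) (x : ℂ)))
    (h : Set.EqOn f g (segment ℝ (0 : ℂ) (x : ℂ))) {z : ℂ}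
    (hz : z ∈ segment ℝ (0 : ℂ) (x : ℂ)) : f =ᶠ[𝓝 z] g := by
  have hnt : (segment ℝ (0 : ℂ) (x : ℂ)).Nontrivial :=
    ⟨0, left_mem_segment ℝ _ _, x, right_mem_segment ℝ _ _, by exact_mod_cast hx.symm⟩
  have hp := (convex_segment (𝕜 := ℝ) (0 : ℂ) (x : ℂ)).isPreconnected.preperfect_of_nontrivial hnt
  have hacc := accPt_iff_frequently_nhdsNE.mp (hp z hz)
  refine ((hf z hz).frequently_eq_iff_eventually_eq (hg z hz)).mp ?_
  exact hacc.mono fun w hw => h hw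

theorem sub_eq_integral_of_deriv_eq {x : ℝ} {f g : ℂ → ℂ}
    (hf : AnalyticOnNhd ℂ f (segment ℝ (0 : ℂ) (x : ℂ)))
    (h : Set.EqOn (deriv f) g (segment ℝ (0 : ℂ) (x : ℂ))) {t : ℝ} (ht : t ∈ Set.uIcc 0 x) :
    f (t : ℂ) - f 0 = ∫ s in (0 : ℝ)..t, g (s : ℂ) := by
  have hsub : ∀ s ∈ Set.uIcc 0 t, (s : ℂ) ∈ segment ℝ (0 : ℂ) (x : ℂ) := fun s hs =>
    ofReal_mem_segment (Set.uIcc_subset_uIcc Set.left_mem_uIcc ht hs)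
  have hc : ContinuousOn (fun s : ℝ => deriv f (s : ℂ)) (Set.uIcc 0 t) := fun s hs =>
    ((hf s (hsub s hs)).deriv.continuousAt.comp
      Complex.continuous_ofReal.continuousAt).continuousWithinAt
  have := intervalIntegral.integral_eq_sub_of_hasDerivAt (a := 0) (b := t)
    (f := fun s : ℝ => f (s : ℂ)) (f' := fun s : ℝ => deriv f (s : ℂ))
    (fun s hs => (hf s (hsub s hs)).differentiableAt.hasDerivAt.comp_ofReal)
    hc.intervalIntegrable
  rw [← intervalIntegral.integral_congr (fun s hs => h (hsub s hs)), this]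
  simp

theorem eqOn_of_deriv_eq_zero {x : ℝ} {f : ℂ → ℂ}
    (hf : AnalyticOnNhd ℂ f (segment ℝ (0 : ℂ) (x : ℂ)))
    (h : ∀ z ∈ segment ℝ (0 : ℂ) (x : ℂ), deriv f z = 0) {z : ℂ}
    (hz : z ∈ segment ℝ (0 : ℂ) (x : ℂ)) : f z = f 0 := by
  obtain ⟨t, ht, rfl⟩ := exists_ofReal_of_mem_segment hz
  have := sub_eq_integral_of_deriv_eq (g := fun _ => 0) hf (fun z hz => h z hz) ht
  simpa [sub_eq_zero] using this

/-- Since `exp(f - g) = 1` holds near the segment, differentiation gives `(f - g)' = 0`, and the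
value at `0` fixes the constant. This selects the branch `F_0' = L` from `exp F_0' = a`. -/
theorem eqOn_of_exp_eq {x : ℝ} (hx : x ≠ 0) {f g : ℂ → ℂ}
    (hf : AnalyticOnNhd ℂ f (segment ℝ (0 : ℂ) (x : ℂ)))
    (hg : AnalyticOnNhd ℂ g (segment ℝ (0 : ℂ) (x : ℂ)))
    (h : ∀ z ∈ segment ℝ (0 : ℂ) (x : ℂ), Complex.exp (f z) = Complex.exp (g z))
    (h0 : f 0 = g 0) : Set.EqOn f g (segment ℝ (0 : ℂ) (x : ℂ)) := by
  intro z hz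
  have key : ∀ w ∈ segment ℝ (0 : ℂ) (x : ℂ), deriv (f - g) w = 0 := by
    intro w hw
    have he := eventuallyEq_of_eqOn_segment hx (f := fun z => Complex.exp ((f - g) z))
      (g := fun _ => 1) (fun z hz => ((hf z hz).sub (hg z hz)).cexp)
      (fun z _ => analyticAt_const)
      (fun z hz => by
        simp only [Pi.sub_apply]; rw [Complex.exp_sub, h z hz, div_self (Complex.exp_ne_zero _)]) hw
    have hd := he.deriv_eq
    rw [deriv_const] at hd
    have := (((hf w hw).sub (hg w hw)).differentiableAt.hasDerivAt.cexp).deriv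
    rw [this] at hd
    simpa [Complex.exp_ne_zero] using hd
  have := eqOn_of_deriv_eq_zero (hf.sub hg) key hz
  simpa [h0, sub_eq_zero] using this

/-- The derivatives of the exponents of a formal solution. -/
theorem IsWKBExponent.iteratedDeriv_succ {a L : ℂ → ℂ} {U : Set ℂ}
    (hL : AnalyticOnNhd ℂ L U) (hexp : ∀ z ∈ U, Complex.exp (L z) = a z)
    {x : ℝ} (hx : x ≠ 0) (hseg : segment ℝ (0 : ℂ) (x : ℂ) ⊆ U)
    {F : ℕ → ℂ → ℂ} (hF : IsWKBExponent a L x F) (k : ℕ) :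
    ∀ z ∈ segment ℝ (0 : ℂ) (x : ℂ), ∀ j : ℕ, iteratedDeriv (j + 1) (F k) z =
      ((bernoulli k : ℚ) : ℂ) / (k.factorial : ℂ) * iteratedDeriv (k + j) L z := by
  have hLs := hL.mono hseg
  have heq := fun z hz => (formalExp_eq_C_iff _ _).mp (hF.equation z hz)
  have hconst : ∀ z, PowerSeries.constantCoeff (formalIncrement F z) = deriv (F 0) z := by
    intro z
    rw [← PowerSeries.coeff_zero_eq_constantCoeff_apply]
    simp [formalIncrement]
  simp only [hconst] at heq
  have h0 : Set.EqOn (deriv (F 0)) L (segment ℝ (0 : ℂ) (x : ℂ)) :=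
    eqOn_of_exp_eq hx (hF.analytic 0).deriv hLs
      (fun z hz => by rw [(heq z hz).1, hexp z (hseg hz)]) hF.branch
  induction k using Nat.strong_induction_on with
  | _ k ih =>
    set c : ℂ := ((bernoulli k : ℚ) : ℂ) / (k.factorial : ℂ) with hc
    have hcoef : Set.EqOn (deriv (F k)) (fun z => c * iteratedDeriv k L z)
        (segment ℝ (0 : ℂ) (x : ℂ)) := by
      intro z hz
      have h1 := (formalIncrement_eq_C_iff F z _).mp (heq z hz).2 k
      have hb := congrArg (· * iteratedDeriv k L z) (sum_bernoulli_div_factorial k)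
      simp only [Finset.sum_mul] at hb
      -- The term `j = 0` is split off, the only one that contains `F_k`. By induction all the
      -- others agree with those of the Bernoulli identity multiplied by `L^{(k)}`, so the terms `j
      -- = 0` agree too.
      rw [Finset.sum_range_succ'] at h1 hb
      have hsum : ∀ j ∈ Finset.range k,
          iteratedDeriv (j + 1 + 1) (F (k - (j + 1))) z / ((j + 1 + 1).factorial : ℂ) =
          ((bernoulli (k - (j + 1)) : ℚ) : ℂ) / ((k - (j + 1)).factorial : ℂ) /
            ((j + 1 + 1).factorial : ℂ) * iteratedDeriv k L z := by
        intro j hj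
        have hj' : j < k := Finset.mem_range.mp hj
        rw [ih (k - (j + 1)) (by omega) z hz (j + 1), show k - (j + 1) + (j + 1) = k by omega]
        ring
      rw [Finset.sum_congr rfl hsum] at h1
      have h2 : (if k = 0 then deriv (F 0) z else 0)
          = (if k = 0 then 1 else 0) * iteratedDeriv k L z := by
        rcases k with _ | k
        · simp [h0 hz]
        · simp
      rw [h2] at h1
      have h3 := h1.trans hb.symm
      have h4 := add_left_cancel h3
      simpa [hc] using h4
    intro z hz j
    have hev := eventuallyEq_of_eqOn_segment hx (hF.analytic k).deriv
      (analyticOnNhd_const.mul fun w hw => analyticAt_iteratedDeriv (hLs w hw) k) hcoef hz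
    have h5 : iteratedDeriv (j + 1) (F k) z = iteratedDeriv j (deriv (F k)) z := by
      rw [iteratedDeriv_succ']
    have h6 : iteratedDeriv j (iteratedDeriv k L) z = iteratedDeriv (k + j) L z := by
      rw [iteratedDeriv_eq_iterate, iteratedDeriv_eq_iterate, iteratedDeriv_eq_iterate,
        ← Function.iterate_add_apply, add_comm]
    rw [h5, hev.iteratedDeriv_eq j, ← h6]
    exact iteratedDeriv_const_mul_field _ _

theorem IsWKBExponent.apply_zero {a L : ℂ → ℂ} {U : Set ℂ}
    (hL : AnalyticOnNhd ℂ L U) (hexp : ∀ z ∈ U, Complex.exp (L z) = a z)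
    {x : ℝ} (hseg : segment ℝ (0 : ℂ) (x : ℂ) ⊆ U)
    {F : ℕ → ℂ → ℂ} (hF : IsWKBExponent a L x F) :
    F 0 (x : ℂ) = ∫ t in (0 : ℝ)..x, L (t : ℂ) := by
  rcases eq_or_ne x 0 with rfl | hx
  · simp [hF.map_zero]
  · have h := sub_eq_integral_of_deriv_eq (g := L) (hF.analytic 0)
      (fun z hz => by simpa using hF.iteratedDeriv_succ hL hexp hx hseg 0 z hz 0)
      (Set.right_mem_uIcc)
    simpa [hF.map_zero] using h

/-- The derivative of `F_{k+1}` has the explicit primitive `B_{k+1}/(k+1)! · L^{(k)}`, and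
`F_{k+1}(0) = 0` fixes the constant. For `x = 0` the segment is a point and both sides vanish. -/
theorem IsWKBExponent.apply_succ {a L : ℂ → ℂ} {U : Set ℂ}
    (hL : AnalyticOnNhd ℂ L U) (hexp : ∀ z ∈ U, Complex.exp (L z) = a z)
    {x : ℝ} (hseg : segment ℝ (0 : ℂ) (x : ℂ) ⊆ U)
    {F : ℕ → ℂ → ℂ} (hF : IsWKBExponent a L x F) (k : ℕ) :
    F (k + 1) (x : ℂ) = ((bernoulli (k + 1) : ℚ) : ℂ) / ((k + 1).factorial : ℂ) *
      (iteratedDeriv k L (x : ℂ) - iteratedDeriv k L 0) := by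
  rcases eq_or_ne x 0 with rfl | hx
  · simp [hF.map_zero]
  · have hLs := hL.mono hseg
    set c : ℂ := ((bernoulli (k + 1) : ℚ) : ℂ) / ((k + 1).factorial : ℂ) with hc
    have hG : AnalyticOnNhd ℂ (fun z => c * iteratedDeriv k L z) (segment ℝ (0 : ℂ) (x : ℂ)) :=
      analyticOnNhd_const.mul fun w hw => analyticAt_iteratedDeriv (hLs w hw) k
    have h := eqOn_of_deriv_eq_zero (f := fun z => F (k + 1) z - c * iteratedDeriv k L z)
      ((hF.analytic (k + 1)).sub hG)
      (fun z hz => by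
        rw [deriv_fun_sub (hF.analytic (k + 1) z hz).differentiableAt (hG z hz).differentiableAt,
          deriv_const_mul_field, ← _root_.iteratedDeriv_succ]
        have := hF.iteratedDeriv_succ hL hexp hx hseg (k + 1) z hz 0
        simp only [zero_add, iteratedDeriv_one, add_zero] at this
        rw [this, sub_self]) (right_mem_segment ℝ _ _)
    rw [hF.map_zero, zero_sub] at h
    linear_combination h

theorem exists_isWKBExponent {a L : ℂ → ℂ} {U : Set ℂ} (hU : IsOpen U)
    (hL : AnalyticOnNhd ℂ L U) (hexp : ∀ z ∈ U, Complex.exp (L z) = a z)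
    {x : ℝ} (hseg : segment ℝ (0 : ℂ) (x : ℂ) ⊆ U) : ∃ F, IsWKBExponent a L x F := by
  have hcomp : IsCompact (segment ℝ (0 : ℂ) (x : ℂ)) := by
    rw [segment_eq_image]
    exact isCompact_Icc.image (by fun_prop)
  -- The set `U` need not be simply connected. A thickening of the segment is convex, so `L` has a
  -- primitive there, which provides `F_0`; the higher `F_k` are explicit.
  obtain ⟨δ, hδ, hV⟩ := hcomp.exists_thickening_subset_open hU hseg
  set V := Metric.thickening δ (segment ℝ (0 : ℂ) (x : ℂ)) with hVdef
  have hVo : IsOpen V := Metric.isOpen_thickening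
  have hsV : segment ℝ (0 : ℂ) (x : ℂ) ⊆ V := Metric.self_subset_thickening hδ _
  have hLV := hL.mono hV
  obtain ⟨P, hP⟩ := ((convex_segment (𝕜 := ℝ) (0 : ℂ) (x : ℂ)).thickening δ)
    |>.exists_forall_hasDerivWithinAt (𝕜 := ℂ) hLV.differentiableOn
  have hP' : ∀ z ∈ V, HasDerivAt P (L z) z := fun z hz => (hP z hz).hasDerivAt (hVo.mem_nhds hz)
  have hPan : AnalyticOnNhd ℂ P V :=
    DifferentiableOn.analyticOnNhd
      (fun z hz => (hP' z hz).differentiableAt.differentiableWithinAt) hVo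
  have hLk : ∀ k, ∀ z ∈ V, AnalyticAt ℂ (iteratedDeriv k L) z := fun k z hz =>
    analyticAt_iteratedDeriv (hLV z hz) k
  let F : ℕ → ℂ → ℂ := fun k z => match k with
    | 0 => P z - P 0
    | k + 1 => ((bernoulli (k + 1) : ℚ) : ℂ) / ((k + 1).factorial : ℂ) *
      (iteratedDeriv k L z - iteratedDeriv k L 0)
  have hder : ∀ k, ∀ z ∈ V, deriv (F k) z =
      ((bernoulli k : ℚ) : ℂ) / (k.factorial : ℂ) * iteratedDeriv k L z := by
    intro k z hz
    rcases k with _ | k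
    · have : deriv (fun z => P z - P 0) z = L z := by rw [deriv_sub_const, (hP' z hz).deriv]
      simpa [F] using this
    · have : deriv (fun z => ((bernoulli (k + 1) : ℚ) : ℂ) / ((k + 1).factorial : ℂ) *
          (iteratedDeriv k L z - iteratedDeriv k L 0)) z =
          ((bernoulli (k + 1) : ℚ) : ℂ) / ((k + 1).factorial : ℂ) * iteratedDeriv (k + 1) L z := by
        rw [deriv_const_mul_field, deriv_sub_const, ← _root_.iteratedDeriv_succ]
      exact this
  have h0 : (0 : ℂ) ∈ V := hsV (left_mem_segment ℝ _ _)
  refine ⟨F, ⟨?_, ?_, ?_, ?_⟩⟩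
  · intro k z hz
    rcases k with _ | k
    · exact (hPan z (hsV hz)).sub analyticAt_const
    · exact analyticAt_const.mul ((hLk k z (hsV hz)).sub analyticAt_const)
  · intro k
    rcases k with _ | k <;> simp [F]
  · simpa using hder 0 0 h0
  · intro z hz
    have hinc : formalIncrement F z = PowerSeries.C (L z) := by
      refine formalIncrement_eq_of_iteratedDeriv fun k j => ?_
      have hev : deriv (F k) =ᶠ[𝓝 z] fun z =>
          ((bernoulli k : ℚ) : ℂ) / (k.factorial : ℂ) * iteratedDeriv k L z :=
        Filter.eventuallyEq_of_mem (hVo.mem_nhds (hsV hz)) (hder k)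
      have h6 : iteratedDeriv j (iteratedDeriv k L) z = iteratedDeriv (k + j) L z := by
        rw [iteratedDeriv_eq_iterate, iteratedDeriv_eq_iterate, iteratedDeriv_eq_iterate,
          ← Function.iterate_add_apply, add_comm]
      rw [_root_.iteratedDeriv_succ', hev.iteratedDeriv_eq j, ← h6]
      exact iteratedDeriv_const_mul_field _ _
    rw [hinc, formalExp_C, hexp z (hseg hz)]

/-! ### The Abel–Plana formula on a strip -/

/-- The zero of `W` at `0` cancels the simple zero of the denominator: away from `t = 0` the
integrand is the quotient of the two difference quotients `dslope`, which is continuous. -/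
theorem intervalIntegrable_div_exp_sub_one {W : ℝ → ℂ} (hW : Continuous W)
    (hd : DifferentiableAt ℝ W 0) (h0 : W 0 = 0) {c : ℝ} (hc : 0 < c) (p q : ℝ) :
    IntervalIntegrable (fun t : ℝ => W t / ((Real.exp (c * t) - 1 : ℝ) : ℂ)) volume p q := by
  set E : ℝ → ℝ := fun t => Real.exp (c * t) - 1 with hE
  have hEd : ∀ t, HasDerivAt E (Real.exp (c * t) * c) t := fun t => by
    simpa [hE] using ((hasDerivAt_id t).const_mul c).exp.sub_const 1
  have hcont : Continuous (fun t : ℝ => (dslope E 0 t)⁻¹ • dslope W 0 t) := by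
    have h1 : Continuous (dslope E 0) := by
      rw [← continuousOn_univ, continuousOn_dslope univ_mem]
      exact ⟨fun t _ => (hEd t).continuousAt.continuousWithinAt, (hEd 0).differentiableAt⟩
    have h2 : Continuous (dslope W 0) := by
      rw [← continuousOn_univ, continuousOn_dslope univ_mem]
      exact ⟨hW.continuousOn, hd⟩
    refine (h1.inv₀ fun t => ?_).smul h2
    rcases eq_or_ne t 0 with rfl | ht
    · rw [dslope_same, (hEd 0).deriv]; simp [hc.ne']
    · rw [dslope_of_ne _ ht, slope_def_field]
      simp [hE, ht, sub_eq_zero, hc.ne']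
  refine (hcont.intervalIntegrable p q).congr_ae ?_
  refine ae_restrict_of_ae ?_
  have : ∀ᵐ t : ℝ, t ≠ 0 := by simp [ae_iff]
  filter_upwards [this] with t ht
  rw [dslope_of_ne _ ht, dslope_of_ne _ ht, slope_def_field, slope_def_module]
  simp only [hE, h0, sub_zero, mul_zero, Real.exp_zero, sub_self, inv_div, Complex.real_smul]
  have : (t : ℂ) ≠ 0 := by exact_mod_cast ht
  push_cast
  field_simp

theorem exists_forall_linear_le_exp (A B : ℝ) {c η : ℝ} (hc : 0 < c) (hη : 0 < η) :
    ∃ R : ℝ, ∀ y : ℝ, R ≤ y → A + B * y ≤ η * Real.exp (c * y) := by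
  have h1 := (Real.tendsto_pow_mul_exp_neg_atTop_nhds_zero 0).comp
    (tendsto_id.const_mul_atTop hc)
  have h2 := (Real.tendsto_pow_mul_exp_neg_atTop_nhds_zero 1).comp
    (tendsto_id.const_mul_atTop hc)
  have h3 := (h1.const_mul A).add (h2.const_mul (B / c))
  simp only [mul_zero, add_zero] at h3
  obtain ⟨R, hR⟩ := eventually_atTop.mp (h3.eventually (gt_mem_nhds hη))
  refine ⟨R, fun y hy => ?_⟩
  have h4 := (hR y hy).le
  simp only [Function.comp, id, pow_zero, pow_one, Real.exp_neg] at h4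
  have h5 := Real.exp_pos (c * y)
  have h6 : A * (1 * (Real.exp (c * y))⁻¹) + B / c * (c * y * (Real.exp (c * y))⁻¹)
    = (A + B * y) / Real.exp (c * y) := by field_simp
  rw [h6, div_le_iff₀ h5] at h4
  exact h4

theorem exp_neg_two_pi_I_mul_eq_one_iff (z : ℂ) :
    Complex.exp (-(2 * Real.pi * Complex.I * z)) = 1 ↔ ∃ n : ℤ, z = n := by
  rw [Complex.exp_eq_one_iff]
  have h : (2 * Real.pi * Complex.I : ℂ) ≠ 0 := by simp [Real.pi_ne_zero]
  constructor
  · rintro ⟨n, hn⟩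
    refine ⟨-n, mul_left_cancel₀ h ?_⟩
    push_cast
    linear_combination -hn
  · rintro ⟨n, rfl⟩
    exact ⟨-n, by push_cast; ring⟩

/-- The integral of `f(z) / (exp(-2πiz) - 1)` along the boundary of the upper half of the unit
strip vanishes. -/
theorem tendsto_integral_upper_strip {f : ℂ → ℂ} (hf : AnalyticOnNhd ℂ f unitStrip)
    (hgrow : ∀ η : ℝ, 0 < η → ∃ R : ℝ, ∀ u ∈ unitStrip, R ≤ |u.im| →
      ‖f u‖ ≤ η * Real.exp (2 * Real.pi * |u.im|)) (h0 : f 0 = 0) (h1 : f 1 = 0) :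
    IntervalIntegrable (fun s : ℝ => f s /
      (Complex.exp (-(2 * Real.pi * Complex.I * (s : ℂ))) - 1)) volume 0 1 ∧
    Tendsto (fun R : ℝ => ∫ y in (0 : ℝ)..R, (f (1 + y * Complex.I) - f (y * Complex.I)) /
      ((Real.exp (2 * Real.pi * y) - 1 : ℝ) : ℂ)) atTop
      (𝓝 (Complex.I * ∫ s in (0 : ℝ)..1, f s /
        (Complex.exp (-(2 * Real.pi * Complex.I * (s : ℂ))) - 1))) := by
  set K : ℂ → ℂ := fun z => Complex.exp (-(2 * Real.pi * Complex.I * z)) - 1 with hK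
  have hKd : ∀ z, HasDerivAt K
      (Complex.exp (-(2 * Real.pi * Complex.I * z)) * -(2 * Real.pi * Complex.I)) z := fun z => by
    simpa [hK] using (((hasDerivAt_id z).const_mul (2 * Real.pi * Complex.I : ℂ)).neg.cexp).sub_const 1
  have hK0 : ∀ z : ℂ, K z = 0 ↔ ∃ n : ℤ, z = n := fun z => by
    rw [← exp_neg_two_pi_I_mul_eq_one_iff]; simp [hK, sub_eq_zero]
  have hKint : ∀ n : ℤ, deriv K n ≠ 0 := fun n => by
    rw [(hKd n).deriv, (exp_neg_two_pi_I_mul_eq_one_iff n).mpr ⟨n, rfl⟩]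
    simp [Real.pi_ne_zero]
  have hint : ∀ z ∈ unitStrip, K z = 0 → z = 0 ∨ z = 1 := by
    rintro z ⟨hz1, hz2⟩ hz
    obtain ⟨n, rfl⟩ := (hK0 z).mp hz
    simp only [Complex.intCast_re] at hz1 hz2
    have a1 : 0 ≤ n := by exact_mod_cast hz1
    have a2 : n ≤ 1 := by exact_mod_cast hz2
    have : n = 0 ∨ n = 1 := by omega
    rcases this with rfl | rfl <;> simp
  have hfz : ∀ z ∈ unitStrip, K z = 0 → f z = 0 := by
    intro z hz hz'
    rcases hint z hz hz' with rfl | rfl <;> assumption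
  classical
  -- The quotient `f/K` has removable singularities at `0` and `1`, the only zeros of `K` in the
  -- strip; they are filled in by l'Hôpital's rule.
  set h : ℂ → ℂ := fun z => if K z = 0 then deriv f z / deriv K z else f z / K z with hh
  have hcont : ∀ z ∈ unitStrip, ContinuousAt h z := by
    intro z hz
    by_cases hz0 : K z = 0
    · obtain ⟨n, hn⟩ := (hK0 z).mp hz0
      have hdz : deriv K z ≠ 0 := hn ▸ hKint n
      have hev : ∀ᶠ w in 𝓝[≠] z, K w ≠ 0 := by
        have := (hKd z).differentiableAt.hasDerivAt.eventually_ne hdz (c := 0)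
        exact this
      have hs := (hasDerivAt_iff_tendsto_slope.mp (hf z hz).differentiableAt.hasDerivAt).div
        (hasDerivAt_iff_tendsto_slope.mp (hKd z).differentiableAt.hasDerivAt) hdz
      have hval : h z = deriv f z / deriv K z := by simp [hh, hz0]
      rw [continuousAt_iff_punctured_nhds, hval]
      refine hs.congr' ?_
      filter_upwards [hev, self_mem_nhdsWithin] with w hw hwz
      have hwz' : w - z ≠ 0 := sub_ne_zero.mpr hwz
      simp only [Pi.div_apply, slope_def_field, hh, hw, if_false, hfz z hz hz0, hz0, sub_zero]
      field_simp
    · have : h =ᶠ[𝓝 z] fun w => f w / K w := by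
        filter_upwards [(hKd z).continuousAt.eventually_ne hz0] with w hw
        simp [hh, hw]
      refine ContinuousAt.congr ?_ this.symm
      exact (hf z hz).continuousAt.div (hKd z).continuousAt hz0
  have hline : ∀ s ∈ Set.uIcc (0 : ℝ) 1, ∀ y : ℝ, (s : ℂ) + y * Complex.I ∈ unitStrip := by
    intro s hs y
    rw [Set.uIcc_of_le zero_le_one] at hs
    simpa [unitStrip] using hs
  -- Cauchy's theorem on the rectangle with corners `0` and `1 + iR`. Continuity suffices on the
  -- boundary, where the two exceptional points lie.
  have hrect : ∀ R : ℝ, 0 < R →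
      (∫ s in (0 : ℝ)..1, h (s + (0 : ℝ) * Complex.I)) - (∫ s in (0 : ℝ)..1, h (s + R * Complex.I))
      + Complex.I • (∫ y in (0 : ℝ)..R, h ((1 : ℝ) + y * Complex.I))
      - Complex.I • (∫ y in (0 : ℝ)..R, h ((0 : ℝ) + y * Complex.I)) = 0 := by
    intro R hR
    have := Complex.integral_boundary_rect_eq_zero_of_continuousOn_of_differentiableOn h 0
      ⟨1, R⟩ ?_ ?_
    · simpa using this
    · intro z hz
      refine (hcont z ?_).continuousWithinAt
      have := hz.1
      simpa [Set.uIcc_of_le, unitStrip] using this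
    · intro z hz
      obtain ⟨hz1, hz2⟩ := hz
      simp only [Complex.zero_re, Complex.zero_im, min_eq_left zero_le_one,
        max_eq_right zero_le_one, min_eq_left hR.le, max_eq_right hR.le, Set.mem_preimage,
        Set.mem_Ioo] at hz1 hz2
      have hzs : z ∈ unitStrip := ⟨hz1.1.le, hz1.2.le⟩
      have hz0 : K z ≠ 0 := by
        intro hz0
        rcases hint z hzs hz0 with rfl | rfl
        · simp at hz1
        · simp at hz1
      have : h =ᶠ[𝓝 z] fun w => f w / K w := by
        filter_upwards [(hKd z).continuousAt.eventually_ne hz0] with w hw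
        simp [hh, hw]
      exact (((hf z hzs).differentiableAt.div (hKd z).differentiableAt hz0).congr_of_eventuallyEq
        this).differentiableWithinAt
  -- the integrands are `f / K` almost everywhere
  have hbot : ∀ᵐ s : ℝ, s ∈ Set.uIoc (0 : ℝ) 1 → h s = f s / K s := by
    have : ∀ᵐ s : ℝ, s ≠ 1 := by simp [ae_iff]
    filter_upwards [this] with s hs hs'
    rw [Set.uIoc_of_le zero_le_one] at hs'
    have : K s ≠ 0 := by
      intro hs0
      rcases hint s ⟨by simpa using hs'.1.le, by simpa using hs'.2⟩ hs0 with h2 | h2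
      · exact hs'.1.ne' (by exact_mod_cast h2)
      · exact hs (by exact_mod_cast h2)
    simp [hh, this]
  have hKleft : ∀ y : ℝ, K (y * Complex.I) = ((Real.exp (2 * Real.pi * y) - 1 : ℝ) : ℂ) := by
    intro y
    simp only [hK]
    push_cast
    congr 2
    linear_combination (-(2 * Real.pi * y : ℂ)) * Complex.I_mul_I
  -- `K` has period `1`, so both vertical sides carry the same real kernel.
  have hKright : ∀ y : ℝ, K (1 + y * Complex.I) = ((Real.exp (2 * Real.pi * y) - 1 : ℝ) : ℂ) := by
    intro y
    rw [← hKleft]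
    simp only [hK]
    congr 1
    rw [show -(2 * Real.pi * Complex.I * (1 + y * Complex.I)) =
      -(2 * Real.pi * Complex.I * (y * Complex.I)) - 2 * Real.pi * Complex.I by ring,
      Complex.exp_sub, Complex.exp_two_pi_mul_I, div_one]
  have hpos : ∀ y : ℝ, 0 < y → 0 < Real.exp (2 * Real.pi * y) - 1 := fun y hy => by
    have := Real.add_one_lt_exp (x := 2 * Real.pi * y) (by positivity)
    have : 0 < 2 * Real.pi * y := by positivity
    linarith
  have hcl : Continuous fun y : ℝ => h (y * Complex.I) := by
    rw [continuous_iff_continuousAt]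
    intro y
    refine ContinuousAt.comp (f := fun y : ℝ => (y * Complex.I : ℂ)) (g := h)
      (hcont _ ?_) (by fun_prop)
    simpa using hline 0 Set.left_mem_uIcc y
  have hcr : Continuous fun y : ℝ => h (1 + y * Complex.I) := by
    rw [continuous_iff_continuousAt]
    intro y
    refine ContinuousAt.comp (f := fun y : ℝ => (1 + y * Complex.I : ℂ)) (g := h)
      (hcont _ ?_) (by fun_prop)
    simpa using hline 1 Set.right_mem_uIcc y
  have hvert : ∀ R : ℝ, 0 < R →
      (∫ y in (0 : ℝ)..R, (f (1 + y * Complex.I) - f (y * Complex.I)) /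
        ((Real.exp (2 * Real.pi * y) - 1 : ℝ) : ℂ)) =
      (∫ y in (0 : ℝ)..R, h (1 + y * Complex.I)) - ∫ y in (0 : ℝ)..R, h (y * Complex.I) := by
    intro R hR
    rw [← intervalIntegral.integral_sub (hcr.intervalIntegrable _ _) (hcl.intervalIntegrable _ _)]
    refine intervalIntegral.integral_congr_ae (Eventually.of_forall fun y hy => ?_)
    rw [Set.uIoc_of_le hR.le] at hy
    have hne : ((Real.exp (2 * Real.pi * y) - 1 : ℝ) : ℂ) ≠ 0 := by
      exact_mod_cast (hpos y hy.1).ne'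
    have e1 : h (1 + y * Complex.I) = f (1 + y * Complex.I) /
        ((Real.exp (2 * Real.pi * y) - 1 : ℝ) : ℂ) := by
      simp only [hh]; rw [hKright, if_neg hne]
    have e2 : h (y * Complex.I) = f (y * Complex.I) /
        ((Real.exp (2 * Real.pi * y) - 1 : ℝ) : ℂ) := by
      simp only [hh]; rw [hKleft, if_neg hne]
    rw [e1, e2, sub_div]
  -- On the top side `|f| ≤ (η/4) e^{2πR}` while `|K| ≥ e^{2πR}/2`. This is where the little-o in
  -- the growth condition is needed.
  have htop : Tendsto (fun R : ℝ => ∫ s in (0 : ℝ)..1, h (s + R * Complex.I)) atTop (𝓝 0) := by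
    rw [Metric.tendsto_atTop]
    intro η hη
    obtain ⟨R₀, hR₀⟩ := hgrow (η / 4) (by positivity)
    refine ⟨max R₀ 1, fun R hR => ?_⟩
    have hR1 : 1 ≤ R := (le_max_right _ _).trans hR
    have hR2 : R₀ ≤ R := (le_max_left _ _).trans hR
    have hbd : ∀ s ∈ Set.uIoc (0 : ℝ) 1, ‖h (s + R * Complex.I)‖ ≤ η / 2 := by
      intro s hs
      have hs' := Set.uIoc_subset_uIcc hs
      have hmem := hline s hs' R
      have hexpR : 2 ≤ Real.exp (2 * Real.pi * R) := by
        have := Real.add_one_le_exp (2 * Real.pi * R)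
        have h3 := Real.pi_gt_three
        nlinarith
      have hKn : Real.exp (2 * Real.pi * R) / 2 ≤ ‖K (s + R * Complex.I)‖ := by
        have : ‖Complex.exp (-(2 * Real.pi * Complex.I * (s + R * Complex.I)))‖ =
            Real.exp (2 * Real.pi * R) := by
          rw [Complex.norm_exp]; congr 1; simp
        have h4 := norm_sub_norm_le
          (Complex.exp (-(2 * Real.pi * Complex.I * (s + R * Complex.I)))) 1
        rw [this, norm_one] at h4
        linarith
      have hKne : K (s + R * Complex.I) ≠ 0 := by
        rw [← norm_pos_iff]; linarith
      have hfn := hR₀ _ hmem (by simpa using hR2.trans (le_abs_self R))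
      have him : |((s : ℂ) + R * Complex.I).im| = R := by
        simpa using abs_of_pos (by linarith : (0 : ℝ) < R)
      rw [him] at hfn
      simp only [hh, hKne, if_false, norm_div]
      rw [div_le_iff₀ (by linarith)]
      nlinarith
    have := intervalIntegral.norm_integral_le_of_norm_le_const hbd
    rw [dist_zero_right]
    simp only [sub_zero, abs_one, mul_one] at this
    linarith
  have hbi : (∫ s in (0 : ℝ)..1, h s) = ∫ s in (0 : ℝ)..1, f s / K s :=
    intervalIntegral.integral_congr_ae hbot
  refine ⟨?_, ?_⟩
  · have : ContinuousOn (fun s : ℝ => h s) (Set.uIcc 0 1) := by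
      intro s hs
      refine (ContinuousAt.comp (f := fun s : ℝ => (s : ℂ)) (g := h)
        (hcont _ ?_) (by fun_prop)).continuousWithinAt
      simpa using hline s hs 0
    exact this.intervalIntegrable.congr_ae ((ae_restrict_iff' measurableSet_uIoc).mpr hbot)
  · have hlim : Tendsto (fun R : ℝ => Complex.I * ((∫ s in (0 : ℝ)..1, f s / K s) -
        ∫ s in (0 : ℝ)..1, h (s + R * Complex.I))) atTop
        (𝓝 (Complex.I * ((∫ s in (0 : ℝ)..1, f s / K s) - 0))) :=
      (tendsto_const_nhds.sub htop).const_mul _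
    rw [sub_zero] at hlim
    refine hlim.congr' ?_
    filter_upwards [eventually_gt_atTop 0] with R hR
    have hr := hrect R hR
    simp only [Complex.ofReal_zero, zero_mul, add_zero, Complex.ofReal_one, zero_add,
      smul_eq_mul] at hr
    rw [hvert R hR, ← hbi]
    linear_combination Complex.I * hr - ((∫ y in (0 : ℝ)..R, h (1 + y * Complex.I)) -
      ∫ y in (0 : ℝ)..R, h (y * Complex.I)) * Complex.I_mul_I

/-- The reflection `z ↦ 1 - z` carries the lower half of the strip to the upper half, so the result
for the upper half is applied to `f(z)` and to `f(1 - z)`, and the two limits are added. -/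
theorem tendsto_integral_strip_of_eq_zero {f : ℂ → ℂ} (hf : AnalyticOnNhd ℂ f unitStrip)
    (hgrow : ∀ η : ℝ, 0 < η → ∃ R : ℝ, ∀ u ∈ unitStrip, R ≤ |u.im| →
      ‖f u‖ ≤ η * Real.exp (2 * Real.pi * |u.im|)) (h0 : f 0 = 0) (h1 : f 1 = 0) :
    Tendsto (fun R : ℝ => ∫ y in (0 : ℝ)..R,
      (f (1 - y * Complex.I) - f (1 + y * Complex.I) - f (-(y * Complex.I)) + f (y * Complex.I)) /
      ((Real.exp (2 * Real.pi * y) - 1 : ℝ) : ℂ)) atTop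
      (𝓝 (Complex.I * ∫ s in (0 : ℝ)..1, f s)) := by
  have hmaps : ∀ z ∈ unitStrip, 1 - z ∈ unitStrip := fun z hz => by
    obtain ⟨h1, h2⟩ := hz
    constructor <;> simp <;> assumption
  have hfan : AnalyticOnNhd ℂ (fun z => f (1 - z)) unitStrip := fun z hz =>
    (hf (1 - z) (hmaps z hz)).comp_of_eq (analyticAt_const.sub analyticAt_id) rfl
  have hfgrow : ∀ η : ℝ, 0 < η → ∃ R : ℝ, ∀ u ∈ unitStrip, R ≤ |u.im| →
      ‖f (1 - u)‖ ≤ η * Real.exp (2 * Real.pi * |u.im|) := fun η hη => by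
    obtain ⟨R, hR⟩ := hgrow η hη
    refine ⟨R, fun u hu hu' => ?_⟩
    simpa using hR (1 - u) (hmaps u hu) (by simpa using hu')
  obtain ⟨i1, t1⟩ := tendsto_integral_upper_strip hf hgrow h0 h1
  obtain ⟨i2, t2⟩ := tendsto_integral_upper_strip (f := fun z => f (1 - z)) hfan hfgrow
    (by simpa using h1) (by simpa using h0)
  have hsym : ∀ s : ℝ, Complex.exp (-(2 * Real.pi * Complex.I * ((1 - s : ℝ) : ℂ))) =
      Complex.exp (2 * Real.pi * Complex.I * s) := fun s => by
    rw [show -(2 * Real.pi * Complex.I * ((1 - s : ℝ) : ℂ)) =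
      2 * Real.pi * Complex.I * s - 2 * Real.pi * Complex.I by push_cast; ring,
      Complex.exp_sub, Complex.exp_two_pi_mul_I, div_one]
  have hfun : (fun s : ℝ => f (1 - ((1 - s : ℝ) : ℂ)) /
      (Complex.exp (-(2 * Real.pi * Complex.I * ((1 - s : ℝ) : ℂ))) - 1)) =
      fun s : ℝ => f s / (Complex.exp (2 * Real.pi * Complex.I * s) - 1) := by
    funext s
    rw [hsym]
    congr 2
    push_cast; ring
  have hlow : (∫ s in (0 : ℝ)..1, f (1 - s) /
      (Complex.exp (-(2 * Real.pi * Complex.I * (s : ℂ))) - 1)) =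
      ∫ s in (0 : ℝ)..1, f s / (Complex.exp (2 * Real.pi * Complex.I * s) - 1) := by
    have := intervalIntegral.integral_comp_sub_left (a := 0) (b := 1) (fun s : ℝ => f (1 - s) /
      (Complex.exp (-(2 * Real.pi * Complex.I * (s : ℂ))) - 1)) 1
    rw [hfun] at this
    simpa using this.symm
  have i2' : IntervalIntegrable
      (fun s : ℝ => f s / (Complex.exp (2 * Real.pi * Complex.I * s) - 1)) volume 0 1 := by
    have := (i2.comp_sub_left 1)
    rw [hfun] at this
    simpa using this.symm
  -- With `w = e^{2πis}` this is `1/(w⁻¹ - 1) + 1/(w - 1) = -1`.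
  have hsum : (∫ s in (0 : ℝ)..1, f s / (Complex.exp (-(2 * Real.pi * Complex.I * (s : ℂ))) - 1)) +
      (∫ s in (0 : ℝ)..1, f s / (Complex.exp (2 * Real.pi * Complex.I * s) - 1)) =
      -∫ s in (0 : ℝ)..1, f s := by
    rw [← intervalIntegral.integral_add i1 i2', ← intervalIntegral.integral_neg]
    have hae : ∀ᵐ s : ℝ, s ≠ 1 := by simp [ae_iff]
    refine intervalIntegral.integral_congr_ae ?_
    filter_upwards [hae] with s hs1 hs
    rw [Set.uIoc_of_le zero_le_one] at hs
    have hne : Complex.exp (-(2 * Real.pi * Complex.I * (s : ℂ))) - 1 ≠ 0 := by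
      rw [sub_ne_zero]
      intro h
      obtain ⟨n, hn⟩ := (exp_neg_two_pi_I_mul_eq_one_iff _).mp h
      have hn' : s = n := by exact_mod_cast hn
      have hlt : s < 1 := lt_of_le_of_ne hs.2 hs1
      have h1 := hs.1
      rw [hn'] at hlt h1
      have : 0 < n := by exact_mod_cast h1
      have : n < 1 := by exact_mod_cast hlt
      omega
    rw [Complex.exp_neg] at hne ⊢
    have he := Complex.exp_ne_zero (2 * Real.pi * Complex.I * (s : ℂ))
    set w := Complex.exp (2 * Real.pi * Complex.I * (s : ℂ)) with hw
    have hw1 : w - 1 ≠ 0 := by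
      intro h
      apply hne
      rw [sub_eq_zero.mp h]; simp
    have hw2 : 1 - w ≠ 0 := by
      rw [← neg_sub]; exact neg_ne_zero.mpr hw1
    have e1 : w⁻¹ - 1 = (1 - w) / w := by field_simp
    rw [e1]
    have e2 : w - 1 = -(1 - w) := by ring
    rw [e2]
    field_simp
    ring
  have hline : ∀ s : ℝ, s ∈ Set.Icc (0 : ℝ) 1 → ∀ y : ℝ, (s : ℂ) + y * Complex.I ∈ unitStrip := by
    intro s hs y
    simpa [unitStrip] using hs
  have hl0 : ∀ y : ℝ, (y * Complex.I : ℂ) ∈ unitStrip := fun y => by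
    simpa using hline 0 (by simp) y
  have hl1 : ∀ y : ℝ, (1 + y * Complex.I : ℂ) ∈ unitStrip := fun y => by
    simpa using hline 1 (by simp) y
  have hint : ∀ g : ℂ → ℂ, AnalyticOnNhd ℂ g unitStrip → g 0 = 0 → g 1 = 0 → ∀ R : ℝ,
      IntervalIntegrable (fun y : ℝ => (g (1 + y * Complex.I) - g (y * Complex.I)) /
        ((Real.exp (2 * Real.pi * y) - 1 : ℝ) : ℂ)) volume 0 R := by
    intro g hg g0 g1 R
    have hd : Differentiable ℝ (fun y : ℝ => g (1 + y * Complex.I) - g (y * Complex.I)) := by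
      intro y
      refine DifferentiableAt.sub ?_ ?_
      · exact (((hg _ (hl1 y)).differentiableAt).restrictScalars ℝ).comp y
          (f := fun y : ℝ => (1 + y * Complex.I : ℂ)) (by fun_prop)
      · exact (((hg _ (hl0 y)).differentiableAt).restrictScalars ℝ).comp y
          (f := fun y : ℝ => (y * Complex.I : ℂ)) (by fun_prop)
    exact intervalIntegrable_div_exp_sub_one hd.continuous (hd 0) (by simp [g0, g1])
      (by positivity) 0 R
  have hlim := (t1.add t2).neg
  rw [hlow, ← mul_add, hsum, mul_neg, neg_neg] at hlim
  refine hlim.congr fun R => ?_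
  rw [← intervalIntegral.integral_add (hint f hf h0 h1 R)
    (hint (fun z => f (1 - z)) hfan (by simpa using h1) (by simpa using h0) R),
    ← intervalIntegral.integral_neg]
  refine intervalIntegral.integral_congr fun y _ => ?_
  rw [← add_div, ← neg_div]
  congr 1
  rw [show (1 : ℂ) - (1 + y * Complex.I) = -(y * Complex.I) by ring]
  ring

/-- The Abel–Plana formula on the unit strip. -/
theorem tendsto_integral_abelPlana {f : ℂ → ℂ} (hf : AnalyticOnNhd ℂ f unitStrip)
    (hgrow : ∀ η : ℝ, 0 < η → ∃ R : ℝ, ∀ u ∈ unitStrip, R ≤ |u.im| →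
      ‖f u‖ ≤ η * Real.exp (2 * Real.pi * |u.im|)) :
    Tendsto (fun R : ℝ => ∫ y in (0 : ℝ)..R,
      (f (1 - y * Complex.I) - f (1 + y * Complex.I) - f (-(y * Complex.I)) + f (y * Complex.I)) /
      ((Real.exp (2 * Real.pi * y) - 1 : ℝ) : ℂ)) atTop
      (𝓝 (-Complex.I * ((f 0 + f 1) / 2 - ∫ s in (0 : ℝ)..1, f s))) := by
  -- Subtracting the linear interpolation of `f` at `0` and `1` produces the required zeros. The
  -- linear part does not contribute to the second difference on the left, and its integral is the
  -- trapezoidal value `(f 0 + f 1)/2`.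
  set p : ℂ → ℂ := fun z => f 0 + z * (f 1 - f 0) with hp
  have hpan : AnalyticOnNhd ℂ p unitStrip := fun z _ =>
    analyticAt_const.add (analyticAt_id.mul analyticAt_const)
  have hg : ∀ η : ℝ, 0 < η → ∃ R : ℝ, ∀ u ∈ unitStrip, R ≤ |u.im| →
      ‖f u - p u‖ ≤ η * Real.exp (2 * Real.pi * |u.im|) := by
    intro η hη
    obtain ⟨R₁, hR₁⟩ := hgrow (η / 2) (by positivity)
    obtain ⟨R₂, hR₂⟩ := exists_forall_linear_le_exp (‖f 0‖ + ‖f 1 - f 0‖) ‖f 1 - f 0‖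
      (c := 2 * Real.pi) (η := η / 2) (by positivity) (by positivity)
    refine ⟨max R₁ R₂, fun u hu hR => ?_⟩
    have a1 := hR₁ u hu ((le_max_left _ _).trans hR)
    have a2 := hR₂ |u.im| ((le_max_right _ _).trans hR)
    have a3 : ‖u‖ ≤ 1 + |u.im| := by
      refine (Complex.norm_le_abs_re_add_abs_im u).trans ?_
      have : |u.re| ≤ 1 := by rw [abs_of_nonneg hu.1]; exact hu.2
      linarith
    have a4 : ‖p u‖ ≤ ‖f 0‖ + ‖u‖ * ‖f 1 - f 0‖ := by
      simp only [hp]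
      refine (norm_add_le _ _).trans ?_
      rw [norm_mul]
    have a5 := norm_sub_le (f u) (p u)
    have a6 := mul_le_mul_of_nonneg_right a3 (norm_nonneg (f 1 - f 0))
    linarith
  have hmain := tendsto_integral_strip_of_eq_zero (f := fun z => f z - p z)
    (hf.sub hpan) hg (by simp [hp]) (by simp [hp])
  have hfc : IntervalIntegrable (fun s : ℝ => f s) volume 0 1 := by
    refine ContinuousOn.intervalIntegrable fun s hs => ?_
    rw [Set.uIcc_of_le zero_le_one] at hs
    exact (ContinuousAt.comp (f := fun s : ℝ => (s : ℂ)) (g := f)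
      (hf _ ⟨by simpa using hs.1, by simpa using hs.2⟩).continuousAt
      (by fun_prop)).continuousWithinAt
  have hpc : IntervalIntegrable (fun s : ℝ => p s) volume 0 1 := by
    refine Continuous.intervalIntegrable ?_ _ _
    simp only [hp]; fun_prop
  have hpi : (∫ s in (0 : ℝ)..1, p s) = (f 0 + f 1) / 2 := by
    simp only [hp]
    rw [intervalIntegral.integral_add (by simp) (by
      refine Continuous.intervalIntegrable ?_ _ _; fun_prop),
      intervalIntegral.integral_mul_const, intervalIntegral.integral_ofReal, integral_id]
    simp
    ring
  rw [intervalIntegral.integral_sub hfc hpc, hpi] at hmain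
  convert hmain using 2
  · refine intervalIntegral.integral_congr fun y _ => ?_
    simp only [hp]
    congr 1
    ring
  · ring

/-- The difference of `L` across the vertical line through `z`. -/
noncomputable def verticalDiff (L : ℂ → ℂ) (z : ℂ) (t : ℝ) : ℂ :=
  L (z + t / (2 * Real.pi * Complex.I)) - L (z - t / (2 * Real.pi * Complex.I))

/-- The Abel–Plana formula on a vertical strip of width `ε`. -/
theorem tendsto_integral_verticalDiff {L : ℂ → ℂ} {c ε : ℝ} (hε : 0 < ε)
    (hL : AnalyticOnNhd ℂ L {z : ℂ | c ≤ z.re ∧ z.re ≤ c + ε})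
    (hgrow : ∀ η : ℝ, 0 < η → ∃ R : ℝ, ∀ z : ℂ, c ≤ z.re → z.re ≤ c + ε → R ≤ |z.im| →
      ‖L z‖ ≤ η * Real.exp (2 * Real.pi * |z.im| / ε)) :
    Tendsto (fun R : ℝ => ∫ t in (0 : ℝ)..R,
      (verticalDiff L ((c + ε : ℝ) : ℂ) t - verticalDiff L c t) /
        ((Real.exp (ε⁻¹ * t) - 1 : ℝ) : ℂ)) atTop
      (𝓝 (-(2 * Real.pi * ε * Complex.I) * ((L c + L ((c + ε : ℝ) : ℂ)) / 2 -
        1 / ε * ∫ s in c..(c + ε), L s))) := by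
  have hεc : (ε : ℂ) ≠ 0 := by exact_mod_cast hε.ne'
  have hmaps : ∀ u ∈ unitStrip, c ≤ ((c : ℂ) + ε * u).re ∧ ((c : ℂ) + ε * u).re ≤ c + ε := by
    rintro u ⟨h1, h2⟩
    simp only [Complex.add_re, Complex.ofReal_re, Complex.re_ofReal_mul]
    constructor <;> nlinarith
  have key := tendsto_integral_abelPlana (f := fun u => L (c + ε * u))
    (fun u hu => (hL _ (hmaps u hu)).comp_of_eq
      (analyticAt_const.add (analyticAt_const.mul analyticAt_id)) rfl)
    (by
      intro η hη
      obtain ⟨R, hR⟩ := hgrow η hη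
      refine ⟨R / ε, fun u hu hu' => ?_⟩
      have him : |((c : ℂ) + ε * u).im| = ε * |u.im| := by
        simp [abs_mul, abs_of_pos hε]
      have := hR _ (hmaps u hu).1 (hmaps u hu).2 (by
        rw [him, mul_comm]; exact (div_le_iff₀ hε).mp hu')
      rw [him] at this
      convert this using 3
      field_simp)
  have hint : (∫ s in (0 : ℝ)..1, L (c + ε * s)) = 1 / ε * ∫ s in c..(c + ε), L s := by
    have := intervalIntegral.integral_comp_add_mul (a := 0) (b := 1) (fun s : ℝ => L s) hε.ne' c
    simp only [Complex.ofReal_add, Complex.ofReal_mul, mul_zero, add_zero, mul_one] at this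
    rw [this]
    simp
  -- The substitution `t = 2πεy` turns `e^{2πy}` into `e^{t/ε}` and `-iεy` into `t/(2πi)`, which
  -- explains the rescaled upper limit.
  have h2 := (key.comp (tendsto_id.atTop_div_const
    (show 0 < 2 * Real.pi * ε by positivity))).const_mul (2 * Real.pi * ε : ℂ)
  have hlim : (2 * Real.pi * ε : ℂ) * (-Complex.I * ((L (c + ε * 0) + L (c + ε * 1)) / 2 -
      ∫ s in (0 : ℝ)..1, L (c + ε * s))) = -(2 * Real.pi * ε * Complex.I) *
      ((L c + L ((c + ε : ℝ) : ℂ)) / 2 - 1 / ε * ∫ s in c..(c + ε), L s) := by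
    rw [hint]
    push_cast
    simp only [mul_zero, add_zero, mul_one]
    ring
  rw [hlim] at h2
  refine h2.congr fun R => ?_
  have h3 := intervalIntegral.smul_integral_comp_mul_left
    (a := 0) (b := R / (2 * Real.pi * ε)) (f := fun t : ℝ =>
      (verticalDiff L ((c + ε : ℝ) : ℂ) t - verticalDiff L c t) /
        ((Real.exp (ε⁻¹ * t) - 1 : ℝ) : ℂ)) (2 * Real.pi * ε)
  rw [mul_zero, mul_div_cancel₀ _ (by positivity : 2 * Real.pi * ε ≠ 0)] at h3
  rw [← h3]
  simp only [Function.comp, id, Complex.real_smul, Complex.ofReal_mul, Complex.ofReal_ofNat]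
  congr 1
  refine intervalIntegral.integral_congr fun y _ => ?_
  have hd : (2 * Real.pi * ε * y : ℂ) / (2 * Real.pi * Complex.I) = -(ε * (y * Complex.I)) := by
    have : (Real.pi : ℂ) ≠ 0 := by exact_mod_cast Real.pi_ne_zero
    field_simp
    rw [Complex.I_sq]; ring
  simp only [verticalDiff, Complex.ofReal_mul, Complex.ofReal_ofNat, Complex.ofReal_add, hd]
  congr 1
  · ring_nf
  · congr 3
    field_simp

/-! ### Laplace integrals, dilations and the kernel `1/(e^{ct} - 1)` -/

theorem integrableOn_pow_mul_exp_neg_mul (k : ℕ) {b : ℝ} (hb : 0 < b) :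
    IntegrableOn (fun t : ℝ => t ^ k * Real.exp (-(b * t))) (Set.Ioi 0) := by
  have := integrableOn_rpow_mul_exp_neg_mul_rpow (p := 1) (s := k) (b := b)
    (by have := Nat.cast_nonneg (α := ℝ) k; linarith) one_pos hb
  simpa using this

theorem integral_pow_mul_exp_neg_mul (k : ℕ) {b : ℝ} (hb : 0 < b) :
    ∫ t in Set.Ioi (0 : ℝ), t ^ k * Real.exp (-(b * t)) = k.factorial / b ^ (k + 1) := by
  have := Real.integral_rpow_mul_exp_neg_mul_Ioi (a := k + 1) (r := b) (by positivity) hb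
  rw [Real.Gamma_nat_eq_factorial, add_sub_cancel_right] at this
  simp only [Real.rpow_natCast] at this
  rw [this, ← Nat.cast_add_one, Real.rpow_natCast]
  rw [one_div, inv_pow]; ring

/-- Here `e^s - 1 = 2 e^{s/2} sinh(s/2)` and `sinh y ≥ y` for `y ≥ 0`. -/
theorem mul_exp_half_le_exp_sub_one {s : ℝ} (hs : 0 ≤ s) :
    s * Real.exp (s / 2) ≤ Real.exp s - 1 := by
  have h := Real.self_le_sinh_iff.mpr (by positivity : 0 ≤ s / 2)
  rw [Real.sinh_eq, le_div_iff₀ two_pos] at h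
  have h2 := mul_le_mul_of_nonneg_right h (Real.exp_pos (s / 2)).le
  rw [sub_mul, ← Real.exp_add, ← Real.exp_add] at h2
  ring_nf at h2 ⊢
  rw [Real.exp_zero] at h2
  linarith

/-- The mean value inequality yields the factor `t` on a bounded interval, and beyond `R' ≥ 1` the
factor costs nothing. It later absorbs the pole of `1/(e^{ct} - 1)` at `0`. -/
theorem exists_norm_le_mul_exp {W W' : ℝ → ℂ} (hW : ∀ t, HasDerivAt W (W' t) t)
    (hW' : Continuous W') (h0 : W 0 = 0) {c : ℝ}
    (hgrow : ∃ B R : ℝ, ∀ t, R ≤ t → ‖W t‖ ≤ B * Real.exp (c * t)) :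
    ∃ C : ℝ, 0 ≤ C ∧ ∀ t : ℝ, 0 ≤ t → ‖W t‖ ≤ C * t * Real.exp (c * t) := by
  obtain ⟨B, R, hR⟩ := hgrow
  have hWc : Continuous W := continuous_iff_continuousAt.mpr fun t => (hW t).continuousAt
  set R' := max R 1 with hR'
  obtain ⟨M, hM⟩ := (isCompact_Icc (a := (0 : ℝ)) (b := R')).exists_bound_of_continuousOn
    hW'.continuousOn
  have hcont : Continuous fun t : ℝ => Real.exp (-(c * t)) := by fun_prop
  obtain ⟨E, hE⟩ := (isCompact_Icc (a := (0 : ℝ)) (b := R')).exists_bound_of_continuousOn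
    hcont.continuousOn
  have hR'1 : 1 ≤ R' := le_max_right _ _
  have h00 : (0 : ℝ) ∈ Set.Icc 0 R' := ⟨le_rfl, by linarith⟩
  have hM0 : 0 ≤ M := (norm_nonneg _).trans (hM 0 h00)
  have hE0 : 0 ≤ E := (norm_nonneg _).trans (hE 0 h00)
  refine ⟨max (M * E) |B|, le_max_of_le_right (abs_nonneg _), fun t ht => ?_⟩
  have hpos := Real.exp_pos (c * t)
  rcases le_total t R' with htR | htR
  · have h1 := (convex_Icc (0 : ℝ) R').norm_image_sub_le_of_norm_hasDerivWithin_le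
      (fun s _ => (hW s).hasDerivWithinAt) hM h00 ⟨ht, htR⟩
    rw [h0, sub_zero, sub_zero, Real.norm_of_nonneg ht] at h1
    have h2 := hE t ⟨ht, htR⟩
    rw [Real.norm_of_nonneg (Real.exp_pos _).le, Real.exp_neg, inv_le_comm₀ hpos] at h2
    · have hEp : 0 < E := by
        refine lt_of_lt_of_le (Real.exp_pos (-(c * t))) ?_
        simpa using hE t ⟨ht, htR⟩
      have h3 : 1 ≤ E * Real.exp (c * t) := by
        rwa [inv_le_iff_one_le_mul₀' hEp] at h2
      calc ‖W t‖ ≤ M * t := h1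
        _ ≤ M * t * (E * Real.exp (c * t)) := le_mul_of_one_le_right (by positivity) h3
        _ = (M * E) * t * Real.exp (c * t) := by ring
        _ ≤ _ := by gcongr; exact le_max_left _ _
    · refine lt_of_lt_of_le (Real.exp_pos (-(c * t))) ?_
      simpa using hE t ⟨ht, htR⟩
  · have h1 := hR t ((le_max_left _ _).trans htR)
    have h2 : 1 ≤ t := hR'1.trans htR
    calc ‖W t‖ ≤ B * Real.exp (c * t) := h1
      _ ≤ |B| * Real.exp (c * t) := by gcongr; exact le_abs_self _
      _ ≤ |B| * t * Real.exp (c * t) := by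
        gcongr; exact le_mul_of_one_le_right (abs_nonneg _) h2
      _ ≤ _ := by gcongr; exact le_max_right _ _

theorem norm_div_exp_sub_one_le {c A : ℝ} (hc : 0 < c) {t : ℝ} (ht : 0 < t) {w : ℂ}
    (hw : ‖w‖ ≤ A * t) :
    ‖w / ((Real.exp (c * t) - 1 : ℝ) : ℂ)‖ ≤ A * c⁻¹ * Real.exp (-(c / 2 * t)) := by
  have h1 := mul_exp_half_le_exp_sub_one (s := c * t) (by positivity)
  have h2 : 0 < c * t * Real.exp (c * t / 2) := by positivity
  have hA : 0 ≤ A := by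
    by_contra h
    have := norm_nonneg w
    nlinarith
  rw [norm_div, Complex.norm_real, Real.norm_of_nonneg (by linarith)]
  calc ‖w‖ / (Real.exp (c * t) - 1) ≤ A * t / (c * t * Real.exp (c * t / 2)) := by gcongr
    _ = A * c⁻¹ * Real.exp (-(c / 2 * t)) := by
      rw [Real.exp_neg, show c / 2 * t = c * t / 2 by ring]
      field_simp

theorem integrableOn_div_exp_sub_one {W : ℝ → ℂ} (hW : Continuous W) {c b A : ℝ}
    (hc : 0 < c) (hb : b < c)
    (hbd : ∀ t : ℝ, 0 ≤ t → ‖W t‖ ≤ A * t * Real.exp (b * t)) :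
    IntegrableOn (fun t : ℝ => W t / ((Real.exp (c * t) - 1 : ℝ) : ℂ)) (Set.Ioi 0) := by
  have h1 := ((integrableOn_pow_mul_exp_neg_mul 0 (b := c - b) (by linarith)).const_mul
    (A * c⁻¹)).add ((integrableOn_pow_mul_exp_neg_mul 1 (b := c - b) (by linarith)).const_mul A)
  refine Integrable.mono' h1 ?_ ?_
  · exact (Measurable.div hW.measurable (by fun_prop)).aestronglyMeasurable
  · refine (ae_restrict_iff' measurableSet_Ioi).mpr (Eventually.of_forall fun t ht => ?_)
    have ht' : 0 < t := ht
    have h2 := Real.add_one_le_exp (c * t)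
    have hct : 0 < c * t := by positivity
    have h3 : 0 < Real.exp (c * t) - 1 := by linarith
    have hn := (norm_nonneg _).trans (hbd t ht'.le)
    rw [norm_div, Complex.norm_real, Real.norm_of_nonneg h3.le]
    calc ‖W t‖ / (Real.exp (c * t) - 1)
        ≤ A * t * Real.exp (b * t) / (Real.exp (c * t) - 1) := by gcongr; exact hbd t ht'.le
      -- For `s = ct > 0` the bound `1/(e^s - 1) ≤ (1 + s)/s · e^{-s}` is equivalent to `1 + s ≤
      -- e^s`. It keeps the full decay `e^{-s}`, so that any `b < c` is allowed.
      _ ≤ A * t * Real.exp (b * t) * ((1 + c * t) / (c * t) * (Real.exp (c * t))⁻¹) := by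
        rw [div_eq_mul_inv]
        refine mul_le_mul_of_nonneg_left ?_ hn
        rw [inv_le_comm₀ h3 (by positivity), mul_inv, inv_inv, inv_div, div_mul_eq_mul_div,
          div_le_iff₀ (by positivity)]
        nlinarith
      _ = _ := by
        simp only [Pi.add_apply, pow_zero, pow_one, one_mul]
        rw [show -((c - b) * t) = b * t + -(c * t) by ring, Real.exp_add, Real.exp_neg]
        field_simp

theorem summable_const_div_add_sq (C a : ℝ) : Summable fun m : ℕ => C / ((m : ℝ) + a) ^ 2 := by
  have h := (Real.summable_one_div_nat_add_rpow a 2).mpr (by norm_num)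
  refine (h.mul_left C).congr fun m => ?_
  rw [Real.rpow_two, sq_abs]; ring

/-- Integration by parts in the Laplace transform of a rescaled derivative. -/
theorem integral_exp_mul_deriv_div {W W' : ℝ → ℂ} (hW : ∀ t, HasDerivAt W (W' t) t)
    (hW' : Continuous W') (h0 : W 0 = 0) (c R : ℝ) {n : ℝ} (hn : 0 < n) :
    ∫ q in (0 : ℝ)..R, ((Real.exp (-(c * q)) : ℝ) : ℂ) * (W' (q / n) / (n : ℂ) ^ 2) =
      (((Real.exp (-(c * R)) : ℝ) : ℂ) * W (R / n) +
        c * ∫ q in (0 : ℝ)..R, ((Real.exp (-(c * q)) : ℝ) : ℂ) * W (q / n)) / n := by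
  have hWc : Continuous W := continuous_iff_continuousAt.mpr fun t => (hW t).continuousAt
  have hnc : (n : ℂ) ≠ 0 := by exact_mod_cast hn.ne'
  have hexp : ∀ q : ℝ, HasDerivAt (fun q : ℝ => ((Real.exp (-(c * q)) : ℝ) : ℂ))
      (-(c : ℂ) * ((Real.exp (-(c * q)) : ℝ) : ℂ)) q := fun q => by
    have h1 : HasDerivAt (fun q : ℝ => -(c * q)) (-c) q := by
      simpa [neg_mul] using (hasDerivAt_id q).const_mul (-c)
    refine h1.exp.ofReal_comp.congr_deriv ?_
    push_cast
    ring
  have hWn : ∀ q : ℝ, HasDerivAt (fun q : ℝ => W (q / n)) (W' (q / n) / n) q := fun q => by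
    refine ((hW (q / n)).scomp q ((hasDerivAt_id q).div_const n)).congr_deriv ?_
    rw [Complex.real_smul]
    push_cast
    ring
  have hd : ∀ q ∈ Set.uIcc 0 R, HasDerivAt
      (fun q : ℝ => ((Real.exp (-(c * q)) : ℝ) : ℂ) * W (q / n) / n)
      (((Real.exp (-(c * q)) : ℝ) : ℂ) * (W' (q / n) / (n : ℂ) ^ 2) -
        c / n * (((Real.exp (-(c * q)) : ℝ) : ℂ) * W (q / n))) q := fun q _ => by
    refine (((hexp q).mul (hWn q)).div_const (n : ℂ)).congr_deriv ?_
    field_simp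
    ring
  have i1 : IntervalIntegrable (fun q : ℝ => ((Real.exp (-(c * q)) : ℝ) : ℂ) *
      (W' (q / n) / (n : ℂ) ^ 2)) volume 0 R :=
    Continuous.intervalIntegrable (by fun_prop) _ _
  have i2 : IntervalIntegrable (fun q : ℝ => c / n * (((Real.exp (-(c * q)) : ℝ) : ℂ) *
      W (q / n))) volume 0 R :=
    Continuous.intervalIntegrable (by fun_prop) _ _
  have := intervalIntegral.integral_eq_sub_of_hasDerivAt hd (i1.sub i2)
  rw [intervalIntegral.integral_sub i1 i2, intervalIntegral.integral_const_mul] at this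
  simp only [zero_div, h0, mul_zero, sub_zero] at this
  linear_combination this

/-- For bounded `q` the points `q/n` remain in one compact interval, so the terms are `O(1/n²)`
uniformly. Continuity of the sum and termwise integration over `[0, R]` follow without any growth
condition. -/
theorem continuous_and_hasSum_integral_exp_mul_tsum {W' : ℝ → ℂ} (hW' : Continuous W') (c : ℝ) {R : ℝ} (hR : 0 ≤ R) :
    Continuous (fun q : ℝ => ∑' m : ℕ, W' (q / (m + 1)) / ((m : ℂ) + 1) ^ 2) ∧
    HasSum (fun m : ℕ => ∫ q in (0 : ℝ)..R, ((Real.exp (-(c * q)) : ℝ) : ℂ) *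
        (W' (q / (m + 1)) / ((m : ℂ) + 1) ^ 2))
      (∫ q in (0 : ℝ)..R, ((Real.exp (-(c * q)) : ℝ) : ℂ) *
        ∑' m : ℕ, W' (q / (m + 1)) / ((m : ℂ) + 1) ^ 2) := by
  have hbound : ∀ ρ : ℝ, ∃ M : ℝ, ∀ q ∈ Set.Icc (-ρ) ρ, ∀ m : ℕ,
      ‖W' (q / (m + 1)) / ((m : ℂ) + 1) ^ 2‖ ≤ M / ((m : ℝ) + 1) ^ 2 := by
    intro ρ
    obtain ⟨M, hM⟩ := (isCompact_Icc (a := -ρ) (b := ρ)).exists_bound_of_continuousOn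
      hW'.continuousOn
    refine ⟨M, fun q hq m => ?_⟩
    have h1 : q / (m + 1) ∈ Set.Icc (-ρ) ρ := by
      rw [Set.mem_Icc, ← abs_le] at hq ⊢
      rw [abs_div, abs_of_pos (by positivity : (0 : ℝ) < m + 1)]
      refine (div_le_self (abs_nonneg _) ?_).trans hq
      simp
    have h2 : ‖((m : ℂ) + 1) ^ 2‖ = ((m : ℝ) + 1) ^ 2 := by
      rw [norm_pow]
      congr 1
      exact_mod_cast Complex.norm_natCast (m + 1)
    rw [norm_div, h2]
    gcongr
    exact hM _ h1
  have hct : ∀ m : ℕ, Continuous fun q : ℝ => W' (q / (m + 1)) / ((m : ℂ) + 1) ^ 2 :=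
    fun m => by fun_prop
  have hcont : Continuous (fun q : ℝ => ∑' m : ℕ, W' (q / (m + 1)) / ((m : ℂ) + 1) ^ 2) := by
    rw [continuous_iff_continuousAt]
    intro q
    obtain ⟨M, hM⟩ := hbound (|q| + 1)
    have : ContinuousOn (fun q : ℝ => ∑' m : ℕ, W' (q / (m + 1)) / ((m : ℂ) + 1) ^ 2)
        (Set.Icc (-(|q| + 1)) (|q| + 1)) :=
      continuousOn_tsum (fun m => (hct m).continuousOn) (summable_const_div_add_sq M 1)
        fun m q hq => hM q hq m
    refine this.continuousAt (Icc_mem_nhds ?_ ?_)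
    · linarith [neg_abs_le q]
    · linarith [le_abs_self q]
  refine ⟨hcont, ?_⟩
  obtain ⟨M, hM⟩ := hbound R
  obtain ⟨E, hE⟩ := (isCompact_Icc (a := (0 : ℝ)) (b := R)).exists_bound_of_continuousOn
    (f := fun q : ℝ => ((Real.exp (-(c * q)) : ℝ) : ℂ)) (by fun_prop)
  have hE0 : 0 ≤ E := (norm_nonneg _).trans (hE 0 ⟨le_rfl, hR⟩)
  have hmem : ∀ q : ℝ, q ∈ Set.uIoc 0 R → q ∈ Set.Icc 0 R := fun q hq => by
    rw [Set.uIoc_of_le hR] at hq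
    exact ⟨hq.1.le, hq.2⟩
  refine intervalIntegral.hasSum_integral_of_dominated_convergence
    (fun m _ => E * (M / ((m : ℝ) + 1) ^ 2)) ?_ ?_ ?_ ?_ ?_
  · exact fun m => Continuous.aestronglyMeasurable (by fun_prop)
  · refine fun m => Eventually.of_forall fun q hq => ?_
    have hq' := hmem q hq
    rw [norm_mul]
    exact mul_le_mul (hE q hq') (hM q ⟨by linarith [hq'.1], hq'.2⟩ m) (norm_nonneg _) hE0
  · exact Eventually.of_forall fun q _ => (summable_const_div_add_sq M 1).mul_left E
  · simp
  · refine Eventually.of_forall fun q hq => ?_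
    have hq' := hmem q hq
    exact (Summable.of_norm_bounded (summable_const_div_add_sq M 1)
      (hM q ⟨by linarith [hq'.1], hq'.2⟩)).hasSum.mul_left _

theorem hasSum_geometric_tail {r : ℝ} (h0 : 0 < r) (h1 : r < 1) :
    HasSum (fun m : ℕ => r ^ (m + 2)) (r * (r⁻¹ - 1)⁻¹) := by
  have h := (hasSum_geometric_of_lt_one h0.le h1).mul_left (r ^ 2)
  have : 1 - r ≠ 0 := by linarith
  have h2 : r⁻¹ - 1 = (1 - r) / r := by field_simp
  have h3 : r * (r⁻¹ - 1)⁻¹ = r ^ 2 * (1 - r)⁻¹ := by rw [h2]; field_simp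
  rw [h3]
  refine h.congr_fun fun m => ?_
  ring

/-- The part `n ≥ 2` of the kernel `1 / (exp(ct) - 1) = ∑ exp(-nct)`. -/
theorem hasSum_integral_exp_mul {W : ℝ → ℂ} (hW : Continuous W) {c A : ℝ} (hc : 0 < c)
    (hbd : ∀ t : ℝ, 0 ≤ t → ‖W t‖ ≤ A * t * Real.exp (c * t)) :
    HasSum (fun m : ℕ => ∫ t in Set.Ioi (0 : ℝ),
        ((Real.exp (-(c * ((m + 2) * t))) : ℝ) : ℂ) * W t)
      (∫ t in Set.Ioi (0 : ℝ), ((Real.exp (-(c * t)) : ℝ) : ℂ) * W t /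
        ((Real.exp (c * t) - 1 : ℝ) : ℂ)) := by
  -- With `n = m + 2`, the growth of `W` uses up one of the `n` factors `e^{-ct}` and the decay
  -- `e^{-(n-1)ct}` remains. For `n = 1` nothing would remain.
  have hdom : ∀ m : ℕ, ∀ t : ℝ, 0 ≤ t → ‖((Real.exp (-(c * ((m + 2) * t))) : ℝ) : ℂ) * W t‖ ≤
      A * (t ^ 1 * Real.exp (-(c * (m + 1) * t))) := by
    intro m t ht
    rw [norm_mul, Complex.norm_real, Real.norm_of_nonneg (Real.exp_pos _).le]
    calc _ ≤ Real.exp (-(c * ((m + 2) * t))) * (A * t * Real.exp (c * t)) := by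
          gcongr; exact hbd t ht
      _ = A * t * (Real.exp (-(c * ((m + 2) * t))) * Real.exp (c * t)) := by ring
      _ = _ := by rw [← Real.exp_add, pow_one, mul_assoc]; ring_nf
  have hint : ∀ m : ℕ, IntegrableOn (fun t : ℝ =>
      ((Real.exp (-(c * ((m + 2) * t))) : ℝ) : ℂ) * W t) (Set.Ioi 0) := by
    intro m
    refine Integrable.mono' ((integrableOn_pow_mul_exp_neg_mul 1 (b := c * (m + 1))
      (by positivity)).const_mul A) (Continuous.aestronglyMeasurable (by fun_prop)) ?_
    exact (ae_restrict_iff' measurableSet_Ioi).mpr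
      (Eventually.of_forall fun t ht => hdom m t (le_of_lt ht))
  have hsum : Summable fun m : ℕ => ∫ t in Set.Ioi (0 : ℝ),
      ‖((Real.exp (-(c * ((m + 2) * t))) : ℝ) : ℂ) * W t‖ := by
    refine Summable.of_nonneg_of_le (fun m => integral_nonneg fun t => norm_nonneg _) (fun m => ?_)
      (summable_const_div_add_sq (A / c ^ 2) 1)
    calc (∫ t in Set.Ioi (0 : ℝ), ‖((Real.exp (-(c * ((m + 2) * t))) : ℝ) : ℂ) * W t‖)
        ≤ ∫ t in Set.Ioi (0 : ℝ), A * (t ^ 1 * Real.exp (-(c * (m + 1) * t))) :=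
          setIntegral_mono_on (hint m).norm ((integrableOn_pow_mul_exp_neg_mul 1
            (b := c * (m + 1)) (by positivity)).const_mul A) measurableSet_Ioi
            fun t ht => hdom m t (le_of_lt (Set.mem_Ioi.mp ht))
      _ = _ := by
        rw [integral_const_mul, integral_pow_mul_exp_neg_mul 1 (by positivity)]
        simp
        field_simp
  have h := hasSum_integral_of_summable_integral_norm hint hsum
  suffices heq : (∫ t in Set.Ioi (0 : ℝ), ((Real.exp (-(c * t)) : ℝ) : ℂ) * W t /
        ((Real.exp (c * t) - 1 : ℝ) : ℂ)) = ∫ t in Set.Ioi (0 : ℝ),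
        ∑' m : ℕ, ((Real.exp (-(c * ((m + 2) * t))) : ℝ) : ℂ) * W t by
    rw [heq]; exact h
  refine setIntegral_congr_fun measurableSet_Ioi fun t ht => ?_
  have ht' : 0 < c * t := mul_pos hc ht
  have hg := hasSum_geometric_tail (Real.exp_pos (-(c * t))) (by simpa using ht')
  have hg2 := ((Complex.hasSum_ofReal.mpr hg).mul_right (W t)).tsum_eq
  have hterm : (fun m : ℕ => ((Real.exp (-(c * t)) ^ (m + 2) : ℝ) : ℂ) * W t) =
      fun m : ℕ => ((Real.exp (-(c * ((m + 2) * t))) : ℝ) : ℂ) * W t := by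
    funext m
    rw [← Real.exp_nat_mul]
    congr 3
    push_cast; ring
  rw [hterm] at hg2
  rw [hg2, ← Real.exp_neg, neg_neg, div_eq_mul_inv]
  push_cast
  ring

/-- For `n ≥ 2` the dilated function `W(q/n)` grows at most like `q e^{cq/2}`, so half of the decay
of `e^{-cq}` survives, uniformly in `n`. -/
theorem norm_exp_mul_comp_div_le {W : ℝ → ℂ} {c A : ℝ} (hc : 0 < c) (hA : 0 ≤ A)
    (hbd : ∀ t : ℝ, 0 ≤ t → ‖W t‖ ≤ A * t * Real.exp (c * t)) {n : ℝ} (hn : 2 ≤ n) {q : ℝ}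
    (hq : 0 ≤ q) : ‖((Real.exp (-(c * q)) : ℝ) : ℂ) * W (q / n)‖ ≤
      A / n * (q ^ 1 * Real.exp (-(c / 2 * q))) := by
  have hn0 : 0 < n := by linarith
  have h1 : c * (q / n) ≤ c / 2 * q := by
    rw [div_mul_eq_mul_div, ← mul_div_assoc]
    exact div_le_div_of_nonneg_left (by positivity) two_pos hn
  rw [norm_mul, Complex.norm_real, Real.norm_of_nonneg (Real.exp_pos _).le]
  calc _ ≤ Real.exp (-(c * q)) * (A * (q / n) * Real.exp (c / 2 * q)) := by
        gcongr
        exact (hbd _ (by positivity)).trans (by gcongr)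
    _ = A / n * q * (Real.exp (-(c * q)) * Real.exp (c / 2 * q)) := by ring
    _ = _ := by rw [← Real.exp_add, pow_one, mul_assoc]; ring_nf

theorem integrableOn_exp_mul_comp_div {W : ℝ → ℂ} (hW : Continuous W) {c A : ℝ} (hc : 0 < c)
    (hA : 0 ≤ A) (hbd : ∀ t : ℝ, 0 ≤ t → ‖W t‖ ≤ A * t * Real.exp (c * t)) {n : ℝ}
    (hn : 2 ≤ n) :
    IntegrableOn (fun q : ℝ => ((Real.exp (-(c * q)) : ℝ) : ℂ) * W (q / n)) (Set.Ioi 0) := by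
  refine Integrable.mono' ((integrableOn_pow_mul_exp_neg_mul 1 (b := c / 2)
    (by positivity)).const_mul (A / n)) (Continuous.aestronglyMeasurable (by fun_prop)) ?_
  exact (ae_restrict_iff' measurableSet_Ioi).mpr (Eventually.of_forall fun t ht =>
    norm_exp_mul_comp_div_le hc hA hbd hn (le_of_lt ht))

theorem integral_exp_mul_comp_div (W : ℝ → ℂ) (c : ℝ) {n : ℝ} (hn : 0 < n) :
    ∫ q in Set.Ioi (0 : ℝ), ((Real.exp (-(c * q)) : ℝ) : ℂ) * W (q / n) =
      n * ∫ t in Set.Ioi (0 : ℝ), ((Real.exp (-(c * (n * t))) : ℝ) : ℂ) * W t := by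
  have h := integral_comp_mul_left_Ioi
    (fun q : ℝ => ((Real.exp (-(c * q)) : ℝ) : ℂ) * W (q / n)) 0 hn
  simp only [mul_div_cancel_left₀ _ hn.ne', mul_zero] at h
  rw [h, Complex.real_smul, Complex.ofReal_inv, ← mul_assoc,
    mul_inv_cancel₀ (by exact_mod_cast hn.ne'), one_mul]

theorem mul_exp_neg_half_le {c q : ℝ} (hc : 0 < c) : q * Real.exp (-(c / 2 * q)) ≤ 2 / c := by
  have h := Real.add_one_le_exp (c / 2 * q)
  rw [Real.exp_neg, ← div_eq_mul_inv, div_le_div_iff₀ (Real.exp_pos _) hc]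
  linarith

/-- The Laplace transform of the derivative of `W`, summed over the dilations by `n` with weights
`1 / n²`, in terms of the Abel–Plana kernel. -/
theorem tendsto_integral_exp_mul_tsum {W W' : ℝ → ℂ} (hW : ∀ t, HasDerivAt W (W' t) t)
    (hW' : Continuous W') (h0 : W 0 = 0) {c : ℝ} (hc : 0 < c)
    (hgrow : ∀ η : ℝ, 0 < η → ∃ R : ℝ, ∀ t, R ≤ t → ‖W t‖ ≤ η * Real.exp (c * t)) {J : ℂ}
    (hJ : Tendsto (fun R : ℝ => ∫ t in (0 : ℝ)..R, W t / ((Real.exp (c * t) - 1 : ℝ) : ℂ)) atTop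
      (𝓝 J)) :
    Tendsto (fun R : ℝ => ∫ q in (0 : ℝ)..R, ((Real.exp (-(c * q)) : ℝ) : ℂ) *
        ∑' m : ℕ, W' (q / (m + 1)) / ((m : ℂ) + 1) ^ 2) atTop (𝓝 (c * J)) := by
  have hWc : Continuous W := continuous_iff_continuousAt.mpr fun t => (hW t).continuousAt
  obtain ⟨A, hA, hbd⟩ := exists_norm_le_mul_exp hW hW' h0 ⟨1, hgrow 1 one_pos⟩
  set e : ℝ → ℂ := fun q => ((Real.exp (-(c * q)) : ℝ) : ℂ) with he
  have hec : Continuous e := by simp only [he]; fun_prop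
  -- `T n R` is the integral over `[0, R]` of the term with index `n` after integration by parts.
  set T : ℝ → ℝ → ℂ := fun n R =>
    (e R * W (R / n) + c * ∫ q in (0 : ℝ)..R, e q * W (q / n)) / n with hT
  have hterm : ∀ (m : ℕ) (R : ℝ), ∫ q in (0 : ℝ)..R, e q * (W' (q / (m + 1)) / ((m : ℂ) + 1) ^ 2)
      = T (m + 1) R := by
    intro m R
    have := integral_exp_mul_deriv_div hW hW' h0 c R (n := m + 1) (by positivity)
    simpa [he, hT] using this
  have hsplit : ∀ R : ℝ, 0 ≤ R → ∫ q in (0 : ℝ)..R, e q *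
      ∑' m : ℕ, W' (q / (m + 1)) / ((m : ℂ) + 1) ^ 2 = T 1 R + ∑' m : ℕ, T (m + 2) R := by
    intro R hR
    have h := (continuous_and_hasSum_integral_exp_mul_tsum hW' c hR).2
    change HasSum (fun m : ℕ => ∫ q in (0 : ℝ)..R, e q * (W' (q / (m + 1)) / ((m : ℂ) + 1) ^ 2))
      (∫ q in (0 : ℝ)..R, e q * ∑' m : ℕ, W' (q / (m + 1)) / ((m : ℂ) + 1) ^ 2) at h
    simp only [hterm] at h
    rw [← h.tsum_eq, h.summable.tsum_eq_zero_add]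
    congr 1
    · simp
    · refine tsum_congr fun m => ?_
      congr 1
      push_cast; ring
  -- the terms with `n ≥ 2`
  have hbound : ∀ m : ℕ, ∀ R : ℝ, 0 ≤ R → ‖e R * W (R / (m + 2))‖ ≤
      A / (m + 2) * (R ^ 1 * Real.exp (-(c / 2 * R))) := fun m R hR =>
    norm_exp_mul_comp_div_le hc hA hbd (by linarith [Nat.cast_nonneg (α := ℝ) m]) hR
  have hint : ∀ m : ℕ, IntegrableOn (fun q : ℝ => e q * W (q / (m + 2))) (Set.Ioi 0) := fun m =>
    integrableOn_exp_mul_comp_div hWc hc hA hbd (by linarith [Nat.cast_nonneg (α := ℝ) m])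
  have htail : Tendsto (fun R : ℝ => ∑' m : ℕ, T (m + 2) R) atTop
      (𝓝 (∑' m : ℕ, c * ∫ t in Set.Ioi (0 : ℝ), e ((m + 2) * t) * W t)) := by
    -- Both the boundary term and the integral are `O(1/n)` uniformly in `R`, and `T` divides them
    -- by `n`; hence a summable bound of order `1/n²`, with `n = m + 2`.
    refine tendsto_tsum_of_dominated_convergence
      (summable_const_div_add_sq (A * (2 / c + c * (1 / (c / 2) ^ 2))) 2) ?_ ?_
    · intro m
      have hz : Tendsto (fun R : ℝ => e R * W (R / (m + 2))) atTop (𝓝 0) := by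
        have h1 := ((Real.tendsto_pow_mul_exp_neg_atTop_nhds_zero 1).comp
          (tendsto_id.const_mul_atTop (by positivity : 0 < c / 2))).const_mul
            (A / (m + 2) * (2 / c))
        rw [mul_zero] at h1
        refine squeeze_zero_norm' ?_ h1
        filter_upwards [eventually_ge_atTop 0] with R hR
        refine (hbound m R hR).trans_eq ?_
        simp only [Function.comp, id, pow_one]
        field_simp
      have hi := intervalIntegral_tendsto_integral_Ioi 0 (hint m) tendsto_id
      have := (hz.add (hi.const_mul (c : ℂ))).div_const ((m : ℂ) + 2)
      have hval : ((0 : ℂ) + c * ∫ q in Set.Ioi (0 : ℝ), e q * W (q / (m + 2))) / ((m : ℂ) + 2) =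
          c * ∫ t in Set.Ioi (0 : ℝ), e ((m + 2) * t) * W t := by
        have h3 := integral_exp_mul_comp_div W c (n := (m : ℝ) + 2) (by positivity)
        have h4 : (m : ℂ) + 2 ≠ 0 := by exact_mod_cast (by positivity : (m : ℝ) + 2 ≠ 0)
        simp only [he]
        rw [h3]
        push_cast
        field_simp
        ring
      rw [hval] at this
      refine this.congr fun R => ?_
      simp [hT]
    · filter_upwards [eventually_ge_atTop 0] with R hR m
      have hn : (0 : ℝ) < m + 2 := by positivity
      have h1 : ‖e R * W (R / (m + 2))‖ ≤ A / (m + 2) * (2 / c) := by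
        refine (hbound m R hR).trans ?_
        rw [pow_one]
        gcongr
        exact mul_exp_neg_half_le hc
      have h2 : ‖∫ q in (0 : ℝ)..R, e q * W (q / (m + 2))‖ ≤ A / (m + 2) * (1 / (c / 2) ^ 2) := by
        have h3 := integral_pow_mul_exp_neg_mul 1 (b := c / 2) (by positivity)
        have h4 := (integrableOn_pow_mul_exp_neg_mul 1 (b := c / 2) (by positivity)).const_mul
          (A / ((m : ℝ) + 2))
        rw [intervalIntegral.integral_of_le hR]
        calc _ ≤ ∫ q in Set.Ioc 0 R, A / (m + 2) * (q ^ 1 * Real.exp (-(c / 2 * q))) := by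
              refine norm_integral_le_of_norm_le (IntegrableOn.mono_set h4 Set.Ioc_subset_Ioi_self) ?_
              exact (ae_restrict_iff' measurableSet_Ioc).mpr
                (Eventually.of_forall fun t ht => hbound m t ht.1.le)
          _ ≤ ∫ q in Set.Ioi 0, A / (m + 2) * (q ^ 1 * Real.exp (-(c / 2 * q))) := by
              refine setIntegral_mono_set h4 ?_ Set.Ioc_subset_Ioi_self.eventuallyLE
              exact (ae_restrict_iff' measurableSet_Ioi).mpr (Eventually.of_forall fun t ht => by
                have : (0 : ℝ) < t := ht
                positivity)
          _ = _ := by rw [integral_const_mul, h3]; simp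
      have h5 : ‖(((m : ℝ) + 2 : ℝ) : ℂ)‖ = (m : ℝ) + 2 := by
        rw [Complex.norm_real, Real.norm_of_nonneg hn.le]
      simp only [hT]
      rw [norm_div, h5, div_le_iff₀ hn]
      calc _ ≤ ‖e R * W (R / (m + 2))‖ + ‖c * ∫ q in (0 : ℝ)..R, e q * W (q / (m + 2))‖ :=
            norm_add_le _ _
        _ ≤ A / (m + 2) * (2 / c) + c * (A / (m + 2) * (1 / (c / 2) ^ 2)) := by
            rw [norm_mul (c : ℂ), Complex.norm_real, Real.norm_of_nonneg hc.le]
            gcongr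
        _ = _ := by field_simp
  -- the term with `n = 1`
  have hQ := hasSum_integral_exp_mul hWc hc hbd
  set Q : ℂ := ∫ t in Set.Ioi (0 : ℝ), ((Real.exp (-(c * t)) : ℝ) : ℂ) * W t /
        ((Real.exp (c * t) - 1 : ℝ) : ℂ) with hQdef
  have hmul := hQ.mul_left (c : ℂ)
  have htail' : Tendsto (fun R : ℝ => ∑' m : ℕ, T (m + 2) R) atTop (𝓝 (c * Q)) := by
    rw [← hmul.tsum_eq]; exact htail
  have hbW : ∀ t : ℝ, 0 ≤ t → ‖e t * W t‖ ≤ A * t * Real.exp (0 * t) := by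
    intro t ht
    rw [norm_mul, Complex.norm_real, Real.norm_of_nonneg (Real.exp_pos _).le]
    calc _ ≤ Real.exp (-(c * t)) * (A * t * Real.exp (c * t)) := by gcongr; exact hbd t ht
      _ = A * t * (Real.exp (-(c * t)) * Real.exp (c * t)) := by ring
      _ = _ := by rw [← Real.exp_add]; simp
  have hQint := integrableOn_div_exp_sub_one (W := fun t => e t * W t) (by fun_prop) hc hc hbW
  have hQlim := intervalIntegral_tendsto_integral_Ioi 0 hQint tendsto_id
  -- For `n = 1` the integral may converge only conditionally. The splitting `e^{-ct} = 1/(e^{ct} -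
  -- 1) - e^{-ct}/(e^{ct} - 1)` expresses it through the given limit `J` and the absolutely
  -- convergent `Q`, which then cancels against the terms `n ≥ 2`.
  have hone : Tendsto (T 1) atTop (𝓝 (c * (J - Q))) := by
    have hz : Tendsto (fun R : ℝ => e R * W R) atTop (𝓝 0) := by
      rw [Metric.tendsto_atTop]
      intro η hη
      obtain ⟨R, hR⟩ := hgrow (η / 2) (by positivity)
      refine ⟨R, fun t ht => ?_⟩
      rw [dist_zero_right, norm_mul, Complex.norm_real, Real.norm_of_nonneg (Real.exp_pos _).le]
      calc _ ≤ Real.exp (-(c * t)) * (η / 2 * Real.exp (c * t)) := by gcongr; exact hR t ht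
        _ = η / 2 * (Real.exp (-(c * t)) * Real.exp (c * t)) := by ring
        _ < η := by rw [← Real.exp_add]; simp; linarith
    have h1 := hz.add ((hJ.sub hQlim).const_mul (c : ℂ))
    rw [zero_add] at h1
    refine h1.congr' ?_
    filter_upwards [eventually_ge_atTop 0] with R hR
    simp only [hT, id, div_one, Complex.ofReal_one]
    congr 2
    have i1 := intervalIntegrable_div_exp_sub_one hWc (hW 0).differentiableAt h0 hc 0 R
    have i2 : IntervalIntegrable (fun t : ℝ => e t * W t / ((Real.exp (c * t) - 1 : ℝ) : ℂ))
        volume 0 R :=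
      (intervalIntegrable_iff_integrableOn_Ioc_of_le hR).mpr
        (hQint.mono_set Set.Ioc_subset_Ioi_self)
    rw [← intervalIntegral.integral_sub i1 i2]
    refine intervalIntegral.integral_congr_ae (Eventually.of_forall fun t ht => ?_)
    rw [Set.uIoc_of_le hR] at ht
    have hpos : 0 < Real.exp (c * t) - 1 := by
      have := Real.add_one_lt_exp (x := c * t) (mul_pos hc ht.1).ne'
      have := mul_pos hc ht.1
      linarith
    have hne : ((Real.exp (c * t) - 1 : ℝ) : ℂ) ≠ 0 := by exact_mod_cast hpos.ne'
    have hmul1 : e t * ((Real.exp (c * t) : ℝ) : ℂ) = 1 := by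
      simp only [he]
      rw [← Complex.ofReal_mul, ← Real.exp_add]; simp
    rw [← sub_div, div_eq_iff hne]
    push_cast at hmul1 ⊢
    linear_combination (-W t) * hmul1
  have hfin := hone.add htail'
  rw [← mul_add, sub_add_cancel] at hfin
  refine hfin.congr' ?_
  filter_upwards [eventually_ge_atTop 0] with R hR
  exact (hsplit R hR).symm

/-! ### The function `G` on vertical strips -/

/-- The closed vertical strip `p ≤ Re z ≤ q`. -/
def verticalStrip (p q : ℝ) : Set ℂ := {z : ℂ | p ≤ z.re ∧ z.re ≤ q}

/-- `L(z) = o(exp(2π |Im z| / T))` in the strip `p ≤ Re z ≤ q`, uniformly in `Re z`. -/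
def StripGrowth (L : ℂ → ℂ) (p q T : ℝ) : Prop :=
  ∀ η : ℝ, 0 < η → ∃ R : ℝ, ∀ z ∈ verticalStrip p q, R ≤ |z.im| →
    ‖L z‖ ≤ η * Real.exp (2 * Real.pi * |z.im| / T)

theorem StripGrowth.mono {L : ℂ → ℂ} {p q T p' q' T' : ℝ} (h : StripGrowth L p q T)
    (hp : p ≤ p') (hq : q' ≤ q) (hT' : 0 < T') (hT : T' ≤ T) : StripGrowth L p' q' T' := by
  intro η hη
  obtain ⟨R, hR⟩ := h η hη
  refine ⟨R, fun z hz hz' => (hR z ⟨hp.trans hz.1, hz.2.trans hq⟩ hz').trans ?_⟩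
  gcongr

/-- The map `u ↦ xu` carries the unit strip onto the strip between `0` and `x`, and `|Im u| = |Im
z|/|x|`. The growth condition thus becomes the one that suits steps of length up to `|x|`. -/
theorem Admissible.verticalStrip_subset {L : ℂ → ℂ} {U : Set ℂ} {x : ℝ} (h : Admissible L U x)
    (hx : x ≠ 0) : verticalStrip (min 0 x) (max 0 x) ⊆ U ∧
      StripGrowth L (min 0 x) (max 0 x) |x| := by
  have hxc : (x : ℂ) ≠ 0 := by exact_mod_cast hx
  have hmem : ∀ z ∈ verticalStrip (min 0 x) (max 0 x), z / x ∈ unitStrip := by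
    rintro z ⟨h1, h2⟩
    change 0 ≤ (z / x).re ∧ (z / x).re ≤ 1
    rw [Complex.div_ofReal_re]
    rcases lt_or_gt_of_ne hx with hx | hx
    · rw [min_eq_right hx.le] at h1
      rw [max_eq_left hx.le] at h2
      exact ⟨div_nonneg_of_nonpos h2 hx.le, (div_le_one_of_neg hx).mpr h1⟩
    · rw [min_eq_left hx.le] at h1
      rw [max_eq_right hx.le] at h2
      exact ⟨div_nonneg h1 hx.le, (div_le_one hx).mpr h2⟩
  refine ⟨fun z hz => ?_, fun η hη => ?_⟩
  · have := h.1 _ (hmem z hz)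
    rwa [div_mul_cancel₀ _ hxc] at this
  · obtain ⟨R, hR⟩ := h.2.2.2 η hη
    refine ⟨R * |x|, fun z hz hz' => ?_⟩
    have him : |(z / x).im| = |z.im| / |x| := by rw [Complex.div_ofReal_im, abs_div]
    have := hR _ (hmem z hz) (by rw [him, le_div_iff₀ (abs_pos.mpr hx)]; exact hz')
    simp only [div_mul_cancel₀ _ hxc, him] at this
    rwa [mul_div_assoc]

theorem Admissible.segment_subset {L : ℂ → ℂ} {U : Set ℂ} {x : ℝ} (h : Admissible L U x) :
    segment ℝ (0 : ℂ) (x : ℂ) ⊆ U := by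
  rintro z ⟨p, q, hp, hq, hpq, rfl⟩
  have := h.1 (q : ℂ) ⟨by simpa using hq, by simpa using by linarith⟩
  simpa using this

theorem dlog_eq_deriv {a L : ℂ → ℂ} {U : Set ℂ} (hU : IsOpen U)
    (hL : AnalyticOnNhd ℂ L U) (hexp : ∀ z ∈ U, Complex.exp (L z) = a z) {z : ℂ} (hz : z ∈ U) :
    dlog a z = deriv L z := by
  have hev : a =ᶠ[𝓝 z] fun w => Complex.exp (L w) :=
    Filter.eventuallyEq_of_mem (hU.mem_nhds hz) fun w hw => (hexp w hw).symm
  rw [dlog, hev.deriv_eq, ← hexp z hz, (hL z hz).differentiableAt.hasDerivAt.cexp.deriv,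
    mul_div_cancel_left₀ _ (Complex.exp_ne_zero _)]

theorem ofReal_div_two_pi_I (t : ℝ) :
    (t : ℂ) / (2 * Real.pi * Complex.I) = ((-(t / (2 * Real.pi)) : ℝ) : ℂ) * Complex.I := by
  have : (Real.pi : ℂ) ≠ 0 := by exact_mod_cast Real.pi_ne_zero
  push_cast
  field_simp
  rw [Complex.I_sq]
  ring

theorem add_div_two_pi_I_mem {p q : ℝ} {x : ℝ} (hp : p ≤ x) (hq : x ≤ q) (t : ℝ) :
    (x : ℂ) + t / (2 * Real.pi * Complex.I) ∈ verticalStrip p q ∧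
      (x : ℂ) - t / (2 * Real.pi * Complex.I) ∈ verticalStrip p q := by
  rw [ofReal_div_two_pi_I]
  generalize -(t / (2 * Real.pi)) = y
  simp [verticalStrip, hp, hq]

/-- The derivative of `verticalDiff`. -/
noncomputable def verticalDiffDeriv (L : ℂ → ℂ) (z : ℂ) (t : ℝ) : ℂ :=
  (deriv L (z + t / (2 * Real.pi * Complex.I)) + deriv L (z - t / (2 * Real.pi * Complex.I))) /
    (2 * Real.pi * Complex.I)

theorem hasDerivAt_verticalDiff {L : ℂ → ℂ} {U : Set ℂ} (hL : AnalyticOnNhd ℂ L U)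
    {p q x : ℝ} (hS : verticalStrip p q ⊆ U) (hp : p ≤ x) (hq : x ≤ q) (t : ℝ) :
    HasDerivAt (verticalDiff L x) (verticalDiffDeriv L x t) t := by
  obtain ⟨m1, m2⟩ := add_div_two_pi_I_mem hp hq t
  have hid : HasDerivAt (fun t : ℂ => t / (2 * Real.pi * Complex.I))
      (1 / (2 * Real.pi * Complex.I)) (t : ℂ) := (hasDerivAt_id _).div_const _
  have h1 := ((hL _ (hS m1)).differentiableAt.hasDerivAt.comp (t : ℂ)
    (hid.const_add (x : ℂ))).comp_ofReal
  have h2 := ((hL _ (hS m2)).differentiableAt.hasDerivAt.comp (t : ℂ)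
    (hid.const_sub (x : ℂ))).comp_ofReal
  refine (h1.sub h2).congr_deriv ?_
  rw [verticalDiffDeriv]
  ring

theorem continuous_verticalDiffDeriv {L : ℂ → ℂ} {U : Set ℂ} (hL : AnalyticOnNhd ℂ L U)
    {p q x : ℝ} (hS : verticalStrip p q ⊆ U) (hp : p ≤ x) (hq : x ≤ q) :
    Continuous (verticalDiffDeriv L x) := by
  rw [continuous_iff_continuousAt]
  intro t
  obtain ⟨m1, m2⟩ := add_div_two_pi_I_mem hp hq t
  refine ContinuousAt.div_const (ContinuousAt.add ?_ ?_) _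
  · exact ContinuousAt.comp (g := deriv L)
      (f := fun t : ℝ => (x : ℂ) + t / (2 * Real.pi * Complex.I))
      (hL _ (hS m1)).deriv.continuousAt (by fun_prop)
  · exact ContinuousAt.comp (g := deriv L)
      (f := fun t : ℝ => (x : ℂ) - t / (2 * Real.pi * Complex.I))
      (hL _ (hS m2)).deriv.continuousAt (by fun_prop)

/-- The second difference of `L` across the vertical lines through `0` and `x`. -/
noncomputable def planaNumerator (L : ℂ → ℂ) (x t : ℝ) : ℂ :=
  verticalDiff L x t - verticalDiff L (0 : ℝ) t

theorem planaNumerator_zero_right (L : ℂ → ℂ) (x : ℝ) : planaNumerator L x 0 = 0 := by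
  simp [planaNumerator, verticalDiff]

/-- The arguments `q/(2πin)` are the points `(t/n)/(2πi)` with `t = q`, so each term of the series
is `2πi` times the derivative of `planaNumerator` at `t/n`, divided by `n²`; and `2πi/(4π²) =
i/(2π)`. -/
theorem borelG_eq {a L : ℂ → ℂ} {U : Set ℂ} (hU : IsOpen U) (hL : AnalyticOnNhd ℂ L U)
    (hexp : ∀ z ∈ U, Complex.exp (L z) = a z) {p q x : ℝ} (hS : verticalStrip p q ⊆ U)
    (hp : p ≤ x) (hq : x ≤ q) (hp0 : p ≤ 0) (hq0 : 0 ≤ q) (t : ℝ) :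
    borelG a t x = Complex.I / (2 * Real.pi) * ∑' m : ℕ,
      (verticalDiffDeriv L x (t / (m + 1)) - verticalDiffDeriv L (0 : ℝ) (t / (m + 1))) /
        ((m : ℂ) + 1) ^ 2 := by
  have hpi : (Real.pi : ℂ) ≠ 0 := by exact_mod_cast Real.pi_ne_zero
  rw [borelG, ← tsum_mul_left, ← tsum_mul_left]
  refine tsum_congr fun m => ?_
  have hb : borelPoint t m = ((t / (m + 1) : ℝ) : ℂ) / (2 * Real.pi * Complex.I) := by
    rw [borelPoint]
    push_cast
    rw [div_div, mul_comm ((m : ℂ) + 1)]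
  obtain ⟨m1, m2⟩ := add_div_two_pi_I_mem hp hq (t / (m + 1))
  obtain ⟨m3, m4⟩ := add_div_two_pi_I_mem hp0 hq0 (t / (m + 1))
  have hm : (m : ℂ) + 1 ≠ 0 := by exact_mod_cast (by positivity : (m : ℝ) + 1 ≠ 0)
  rw [borelTerm, hb, verticalDiffDeriv, verticalDiffDeriv,
    ← dlog_eq_deriv hU hL hexp (hS m1), ← dlog_eq_deriv hU hL hexp (hS m2),
    ← dlog_eq_deriv hU hL hexp (hS m3), ← dlog_eq_deriv hU hL hexp (hS m4)]
  simp only [Complex.ofReal_zero, zero_add, zero_sub]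
  field_simp
  ring

theorem norm_planaNumerator_le {L : ℂ → ℂ} {p q T x : ℝ} (hg : StripGrowth L p q T)
    (hp : p ≤ x) (hq : x ≤ q) (hp0 : p ≤ 0) (hq0 : 0 ≤ q) :
    ∀ η : ℝ, 0 < η → ∃ R : ℝ, ∀ t, R ≤ t → ‖planaNumerator L x t‖ ≤ η * Real.exp (T⁻¹ * t) := by
  intro η hη
  obtain ⟨R, hR⟩ := hg (η / 4) (by positivity)
  refine ⟨max (2 * Real.pi * R) 0, fun t ht => ?_⟩
  have ht0 : 0 ≤ t := (le_max_right _ _).trans ht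
  have htR : R ≤ t / (2 * Real.pi) := by
    rw [le_div_iff₀ (by positivity), mul_comm]
    exact (le_max_left _ _).trans ht
  have key : ∀ y : ℝ, p ≤ y → y ≤ q → ‖verticalDiff L y t‖ ≤ η / 2 * Real.exp (T⁻¹ * t) := by
    intro y h1 h2
    obtain ⟨m1, m2⟩ := add_div_two_pi_I_mem h1 h2 t
    have hpos : |-(t / (2 * Real.pi))| = t / (2 * Real.pi) := by
      rw [abs_neg, abs_of_nonneg (by positivity)]
    have him : ∀ v : ℝ, |((y : ℂ) + (v : ℂ) * Complex.I).im| = |v| ∧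
        |((y : ℂ) - (v : ℂ) * Complex.I).im| = |v| := fun v => by simp
    have e1 : |((y : ℂ) + t / (2 * Real.pi * Complex.I)).im| = t / (2 * Real.pi) := by
      rw [ofReal_div_two_pi_I, (him _).1, hpos]
    have e2 : |((y : ℂ) - t / (2 * Real.pi * Complex.I)).im| = t / (2 * Real.pi) := by
      rw [ofReal_div_two_pi_I, (him _).2, hpos]
    have b1 := hR _ m1 (by rw [e1]; exact htR)
    have b2 := hR _ m2 (by rw [e2]; exact htR)
    have e3 : 2 * Real.pi * (t / (2 * Real.pi)) / T = T⁻¹ * t := by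
      rw [mul_div_cancel₀ _ (by positivity : 2 * Real.pi ≠ 0)]; ring
    rw [e1, e3] at b1
    rw [e2, e3] at b2
    refine (norm_sub_le _ _).trans ?_
    linarith
  have h1 := key x hp hq
  have h2 := key 0 hp0 hq0
  refine (norm_sub_le _ _).trans ?_
  linarith

/-! ### Convergence of the Laplace integral and the difference equation -/

/-- The convergence of the Abel–Plana integral with numerator `planaNumerator L x`. -/
def HasPlanaLimit (L : ℂ → ℂ) (x ε : ℝ) (J : ℂ) : Prop :=
  Tendsto (fun R : ℝ => ∫ t in (0 : ℝ)..R,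
    planaNumerator L x t / ((Real.exp (ε⁻¹ * t) - 1 : ℝ) : ℂ)) atTop (𝓝 J)

theorem hasPlanaLimit_zero (L : ℂ → ℂ) (ε : ℝ) : HasPlanaLimit L 0 ε 0 := by
  simp [HasPlanaLimit, planaNumerator]

/-- This is `tendsto_integral_exp_mul_tsum` with `c = 1/ε`, applied to `planaNumerator`. A
conditional limit `J` is enough, so the growth bound is only required with `T = ε`, which covers the
borderline case. -/
theorem laplaceG_eq_of_hasPlanaLimit {a L : ℂ → ℂ} {U : Set ℂ} (hU : IsOpen U)
    (hL : AnalyticOnNhd ℂ L U) (hexp : ∀ z ∈ U, Complex.exp (L z) = a z) {p q x : ℝ}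
    (hS : verticalStrip p q ⊆ U) (hp : p ≤ x) (hq : x ≤ q) (hp0 : p ≤ 0) (hq0 : 0 ≤ q)
    {ε : ℝ} (hε : 0 < ε) (hg : StripGrowth L p q ε) {J : ℂ} (hJ : HasPlanaLimit L x ε J) :
    LaplaceConverges a x ε ∧ laplaceG a x ε = Complex.I / (2 * Real.pi * ε) * J := by
  have hW : ∀ t, HasDerivAt (planaNumerator L x)
      (verticalDiffDeriv L x t - verticalDiffDeriv L (0 : ℝ) t) t := fun t =>
    (hasDerivAt_verticalDiff hL hS hp hq t).sub (hasDerivAt_verticalDiff hL hS hp0 hq0 t)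
  have hW' : Continuous fun t => verticalDiffDeriv L x t - verticalDiffDeriv L (0 : ℝ) t :=
    (continuous_verticalDiffDeriv hL hS hp hq).sub (continuous_verticalDiffDeriv hL hS hp0 hq0)
  have hfun : laplaceIntegrand a x ε = fun t : ℝ => Complex.I / (2 * Real.pi) *
      (((Real.exp (-(ε⁻¹ * t)) : ℝ) : ℂ) * ∑' m : ℕ, (verticalDiffDeriv L x (t / (m + 1)) -
        verticalDiffDeriv L (0 : ℝ) (t / (m + 1))) / ((m : ℂ) + 1) ^ 2) := by
    funext t
    rw [laplaceIntegrand, borelG_eq hU hL hexp hS hp hq hp0 hq0]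
    have : Complex.exp (-((t : ℂ) / (ε : ℂ))) = ((Real.exp (-(ε⁻¹ * t)) : ℝ) : ℂ) := by
      push_cast
      congr 2
      ring
    rw [this]
    ring
  have hlim := (tendsto_integral_exp_mul_tsum hW hW' (planaNumerator_zero_right L x)
    (inv_pos.mpr hε) (norm_planaNumerator_le hg hp hq hp0 hq0) hJ).const_mul
      (Complex.I / (2 * Real.pi))
  have hlim' : Tendsto (fun R : ℝ => ∫ q in (0 : ℝ)..R, laplaceIntegrand a x ε q) atTop
      (𝓝 (Complex.I / (2 * Real.pi * ε) * J)) := by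
    have hval : Complex.I / (2 * Real.pi) * (((ε⁻¹ : ℝ) : ℂ) * J) =
        Complex.I / (2 * Real.pi * ε) * J := by
      push_cast
      rw [← mul_assoc, div_mul_eq_div_div _ _ (ε : ℂ), div_eq_mul_inv _ (ε : ℂ)]
    rw [← hval]
    refine hlim.congr fun R => ?_
    rw [hfun, intervalIntegral.integral_const_mul]
  refine ⟨⟨fun R _ => ?_, _, hlim'⟩, hlim'.limUnder_eq⟩
  rw [hfun]
  have hc := (continuous_and_hasSum_integral_exp_mul_tsum hW' ε⁻¹ le_rfl).1
  exact Continuous.intervalIntegrable (by fun_prop) _ _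

/-- A strict gap `ε < T` makes the kernel decay faster than the numerator can grow, so the integral
converges absolutely. -/
theorem hasPlanaLimit_of_lt {L : ℂ → ℂ} {U : Set ℂ}
    (hL : AnalyticOnNhd ℂ L U) {p q x : ℝ}
    (hS : verticalStrip p q ⊆ U) (hp : p ≤ x) (hq : x ≤ q) (hp0 : p ≤ 0) (hq0 : 0 ≤ q)
    {ε T : ℝ} (hε : 0 < ε) (hT : ε < T) (hg : StripGrowth L p q T) :
    HasPlanaLimit L x ε (∫ t in Set.Ioi (0 : ℝ),
      planaNumerator L x t / ((Real.exp (ε⁻¹ * t) - 1 : ℝ) : ℂ)) := by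
  have hW : ∀ t, HasDerivAt (planaNumerator L x)
      (verticalDiffDeriv L x t - verticalDiffDeriv L (0 : ℝ) t) t := fun t =>
    (hasDerivAt_verticalDiff hL hS hp hq t).sub (hasDerivAt_verticalDiff hL hS hp0 hq0 t)
  have hW' : Continuous fun t => verticalDiffDeriv L x t - verticalDiffDeriv L (0 : ℝ) t :=
    (continuous_verticalDiffDeriv hL hS hp hq).sub (continuous_verticalDiffDeriv hL hS hp0 hq0)
  obtain ⟨A, -, hA⟩ := exists_norm_le_mul_exp hW hW' (planaNumerator_zero_right L x)
    ⟨1, norm_planaNumerator_le hg hp hq hp0 hq0 1 one_pos⟩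
  have hWc : Continuous (planaNumerator L x) :=
    continuous_iff_continuousAt.mpr fun t => (hW t).continuousAt
  exact intervalIntegral_tendsto_integral_Ioi 0
    (integrableOn_div_exp_sub_one hWc (inv_pos.mpr hε) (inv_strictAnti₀ hε hT) hA) tendsto_id

/-- The value of the Abel–Plana integral over the strip `c ≤ Re z ≤ c + ε`. -/
noncomputable def planaValue (L : ℂ → ℂ) (c ε : ℝ) : ℂ :=
  -(2 * Real.pi * ε * Complex.I) * ((L c + L ((c + ε : ℝ) : ℂ)) / 2 -
    1 / ε * ∫ s in c..(c + ε), L s)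

theorem tendsto_integral_planaNumerator_sub {L : ℂ → ℂ} {U : Set ℂ}
    (hL : AnalyticOnNhd ℂ L U) {p q x : ℝ} (hS : verticalStrip p q ⊆ U) {ε : ℝ} (hε : 0 < ε)
    (hp : p ≤ x) (hq : x + ε ≤ q) (hg : StripGrowth L p q ε) :
    Tendsto (fun R : ℝ => ∫ t in (0 : ℝ)..R, (planaNumerator L (x + ε) t - planaNumerator L x t) /
        ((Real.exp (ε⁻¹ * t) - 1 : ℝ) : ℂ)) atTop (𝓝 (planaValue L x ε)) := by
  have h := tendsto_integral_verticalDiff (L := L) (c := x) hε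
    (fun z hz => hL z (hS ⟨hp.trans hz.1, hz.2.trans hq⟩))
    (fun η hη => by
      obtain ⟨R, hR⟩ := hg η hη
      exact ⟨R, fun z h1 h2 h3 => hR z ⟨hp.trans h1, h2.trans hq⟩ h3⟩)
  refine h.congr fun R => ?_
  refine intervalIntegral.integral_congr fun t _ => ?_
  simp only [planaNumerator, sub_sub_sub_cancel_right]

theorem intervalIntegrable_planaNumerator {L : ℂ → ℂ} {U : Set ℂ}
    (hL : AnalyticOnNhd ℂ L U) {p q x : ℝ}
    (hS : verticalStrip p q ⊆ U) (hp : p ≤ x) (hq : x ≤ q) (hp0 : p ≤ 0) (hq0 : 0 ≤ q)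
    {ε : ℝ} (hε : 0 < ε) (R : ℝ) : IntervalIntegrable (fun t : ℝ =>
      planaNumerator L x t / ((Real.exp (ε⁻¹ * t) - 1 : ℝ) : ℂ)) volume 0 R := by
  have hW : ∀ t, HasDerivAt (planaNumerator L x)
      (verticalDiffDeriv L x t - verticalDiffDeriv L (0 : ℝ) t) t := fun t =>
    (hasDerivAt_verticalDiff hL hS hp hq t).sub (hasDerivAt_verticalDiff hL hS hp0 hq0 t)
  exact intervalIntegrable_div_exp_sub_one
    (continuous_iff_continuousAt.mpr fun t => (hW t).continuousAt) (hW 0).differentiableAt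
    (planaNumerator_zero_right L x) (inv_pos.mpr hε) 0 R

/-- In the difference of the two numerators the line through `0` drops out, and Abel–Plana on the
strip between `x` and `x + ε` evaluates the rest. Convergence therefore passes across one step in
either direction, even without absolute convergence. -/
theorem hasPlanaLimit_add_iff {L : ℂ → ℂ} {U : Set ℂ}
    (hL : AnalyticOnNhd ℂ L U) {p q x : ℝ} (hS : verticalStrip p q ⊆ U) {ε : ℝ} (hε : 0 < ε)
    (hp : p ≤ x) (hq : x + ε ≤ q) (hp0 : p ≤ 0) (hq0 : 0 ≤ q) (hg : StripGrowth L p q ε) (J : ℂ) :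
    HasPlanaLimit L (x + ε) ε (J + planaValue L x ε) ↔ HasPlanaLimit L x ε J := by
  have h := tendsto_integral_planaNumerator_sub hL hS hε hp hq hg
  have i1 := intervalIntegrable_planaNumerator hL hS hp (by linarith : x ≤ q) hp0 hq0 hε
  have i2 := intervalIntegrable_planaNumerator hL hS (by linarith : p ≤ x + ε) hq hp0 hq0 hε
  have hsub : ∀ R : ℝ, ∫ t in (0 : ℝ)..R, (planaNumerator L (x + ε) t - planaNumerator L x t) /
        ((Real.exp (ε⁻¹ * t) - 1 : ℝ) : ℂ) =
      (∫ t in (0 : ℝ)..R, planaNumerator L (x + ε) t / ((Real.exp (ε⁻¹ * t) - 1 : ℝ) : ℂ)) -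
      ∫ t in (0 : ℝ)..R, planaNumerator L x t / ((Real.exp (ε⁻¹ * t) - 1 : ℝ) : ℂ) := fun R => by
    rw [← intervalIntegral.integral_sub (i2 R) (i1 R)]
    simp only [sub_div]
  simp only [hsub] at h
  constructor
  · intro hJ
    have := Tendsto.sub hJ h
    simpa [HasPlanaLimit] using this
  · intro hJ
    have := Tendsto.add hJ h
    simpa [HasPlanaLimit] using this

theorem exactSolution_add {a L : ℂ → ℂ} {U : Set ℂ} (hU : IsOpen U)
    (hL : AnalyticOnNhd ℂ L U) (hexp : ∀ z ∈ U, Complex.exp (L z) = a z) {p q x : ℝ}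
    (hS : verticalStrip p q ⊆ U) {ε : ℝ} (hε : 0 < ε) (hp : p ≤ x) (hq : x + ε ≤ q)
    (hp0 : p ≤ 0) (hq0 : 0 ≤ q) (hg : StripGrowth L p q ε) {J : ℂ} (hJ : HasPlanaLimit L x ε J) :
    LaplaceConverges a x ε ∧ LaplaceConverges a (x + ε) ε ∧
      exactSolution a L (x + ε) ε = a (x : ℂ) * exactSolution a L x ε := by
  have hJ' := (hasPlanaLimit_add_iff hL hS hε hp hq hp0 hq0 hg J).mpr hJ
  obtain ⟨c1, e1⟩ := laplaceG_eq_of_hasPlanaLimit hU hL hexp hS hp (by linarith : x ≤ q) hp0 hq0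
    hε hg hJ
  obtain ⟨c2, e2⟩ := laplaceG_eq_of_hasPlanaLimit hU hL hexp hS (by linarith : p ≤ x + ε) hq
    hp0 hq0 hε hg hJ'
  refine ⟨c1, c2, ?_⟩
  have hxS : (x : ℂ) ∈ U := hS ⟨by simpa using hp, by simpa using by linarith⟩
  have hεc : (ε : ℂ) ≠ 0 := by exact_mod_cast hε.ne'
  have hpi : (Real.pi : ℂ) ≠ 0 := by exact_mod_cast Real.pi_ne_zero
  have hint : ∀ u v : ℝ, u ∈ Set.Icc p q → v ∈ Set.Icc p q →
      IntervalIntegrable (fun t : ℝ => L t) volume u v := by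
    intro u v hu hv
    refine ContinuousOn.intervalIntegrable fun t ht => ?_
    have ht' := Set.uIcc_subset_Icc hu hv ht
    exact (ContinuousAt.comp (g := L) (f := fun t : ℝ => (t : ℂ))
      (hL _ (hS ⟨by simpa using ht'.1, by simpa using ht'.2⟩)).continuousAt
      (by fun_prop)).continuousWithinAt
  have hadd := intervalIntegral.integral_add_adjacent_intervals
    (hint 0 x ⟨hp0, hq0⟩ ⟨hp, by linarith⟩) (hint x (x + ε) ⟨hp, by linarith⟩ ⟨by linarith, hq⟩)
  -- Multiplied by `i/(2πε)`, `planaValue L x ε` is `(L(x) + L(x+ε))/2 - ε⁻¹∫L` over the step. The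
  -- integral cancels, and with `(L(x) - L(x+ε))/2` from the square roots only `L(x)` remains.
  rw [exactSolution, exactSolution, ← hexp _ hxS, e1, e2, ← hadd, ← Complex.exp_add,
    ← Complex.exp_add, ← Complex.exp_add]
  congr 1
  rw [planaValue]
  push_cast
  field_simp
  linear_combination (-(ε : ℂ) * (L x + L (x + ε)) + 2 * ∫ s in x..(x + ε), L s) * Real.pi * Complex.I_sq

/-- The sign condition places the step inside the strip belonging to the endpoint farther from `0`,
which contains both lines. The endpoint nearer to `0` has an Abel–Plana limit: either that strip is
strictly wider than `ε`, or this endpoint is `0` and its numerator vanishes. -/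
theorem exactSolution_functional_equation {a L : ℂ → ℂ} {U : Set ℂ} (hU : IsOpen U)
    (hL : AnalyticOnNhd ℂ L U) (hexp : ∀ z ∈ U, Complex.exp (L z) = a z) {ε : ℝ} (hε : 0 < ε)
    {x : ℝ} (hx : Admissible L U x) (hx' : Admissible L U (x + ε)) (h : 0 ≤ x ∨ x + ε ≤ 0) :
    LaplaceConverges a x ε ∧ LaplaceConverges a (x + ε) ε ∧
      exactSolution a L (x + ε) ε = a (x : ℂ) * exactSolution a L x ε := by
  rcases h with h | h
  · obtain ⟨hS, hg⟩ := hx'.verticalStrip_subset (by linarith : x + ε ≠ 0)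
    rw [min_eq_left (by linarith), max_eq_right (by linarith)] at hS hg
    rw [abs_of_pos (by linarith)] at hg
    have hgε := hg.mono le_rfl le_rfl hε (by linarith)
    rcases h.eq_or_lt with rfl | h0
    · exact exactSolution_add hU hL hexp hS hε le_rfl le_rfl le_rfl (by linarith) hgε
        (hasPlanaLimit_zero L ε)
    · exact exactSolution_add hU hL hexp hS hε h le_rfl le_rfl (by linarith) hgε
        (hasPlanaLimit_of_lt hL hS h (by linarith) le_rfl (by linarith) hε (by linarith) hg)
  · obtain ⟨hS, hg⟩ := hx.verticalStrip_subset (by linarith : x ≠ 0)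
    rw [min_eq_right (by linarith), max_eq_left (by linarith)] at hS hg
    rw [abs_of_neg (by linarith)] at hg
    have hgε := hg.mono le_rfl le_rfl hε (by linarith)
    have : ∃ J, HasPlanaLimit L (x + ε) ε J := by
      rcases h.eq_or_lt with h0 | h0
      · rw [h0]; exact ⟨0, hasPlanaLimit_zero L ε⟩
      · exact ⟨_, hasPlanaLimit_of_lt hL hS (by linarith) h (by linarith) le_rfl hε
          (by linarith) hg⟩
    obtain ⟨J, hJ⟩ := this
    have hJ' : HasPlanaLimit L x ε (J - planaValue L x ε) := by
      rw [← hasPlanaLimit_add_iff hL hS hε le_rfl h (by linarith) le_rfl hgε, sub_add_cancel]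
      exact hJ
    exact exactSolution_add hU hL hexp hS hε le_rfl h (by linarith) le_rfl hgε hJ'

theorem borelG_zero (a : ℂ → ℂ) (q : ℂ) : borelG a q 0 = 0 := by
  simp [borelG, borelTerm]

theorem laplaceIntegrand_zero (a : ℂ → ℂ) (ε : ℝ) : laplaceIntegrand a 0 ε = fun _ => 0 := by
  funext q
  simp [laplaceIntegrand, borelG_zero]

theorem laplaceConverges_zero (a : ℂ → ℂ) (ε : ℝ) : LaplaceConverges a 0 ε :=
  ⟨fun R _ => by rw [laplaceIntegrand_zero]; simp, 0, by simp [laplaceIntegrand_zero]⟩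

theorem laplaceG_zero (a : ℂ → ℂ) (ε : ℝ) : laplaceG a 0 ε = 0 := by
  simp only [laplaceG, laplaceIntegrand_zero, intervalIntegral.integral_zero]
  exact tendsto_const_nhds.limUnder_eq

theorem Admissible.laplaceConverges {a L : ℂ → ℂ} {U : Set ℂ} (hU : IsOpen U)
    (hL : AnalyticOnNhd ℂ L U) (hexp : ∀ z ∈ U, Complex.exp (L z) = a z) {x : ℝ}
    (hx : Admissible L U x) {ε : ℝ} (hε : 0 < ε) (hεx : x ≠ 0 → ε ≤ |x|) :
    LaplaceConverges a x ε := by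
  rcases eq_or_ne x 0 with rfl | hx0
  · exact laplaceConverges_zero a ε
  obtain ⟨hS, hg⟩ := hx.verticalStrip_subset hx0
  have hεx := hεx hx0
  have hgε := hg.mono le_rfl le_rfl hε hεx
  have p1 := min_le_right 0 x
  have p2 := min_le_left 0 x
  have p3 := le_max_right 0 x
  have p4 := le_max_left 0 x
  suffices ∃ J, HasPlanaLimit L x ε J by
    obtain ⟨J, hJ⟩ := this
    exact (laplaceG_eq_of_hasPlanaLimit hU hL hexp hS p1 p3 p2 p4 hε hgε hJ).1
  rcases hεx.lt_or_eq with h | h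
  · exact ⟨_, hasPlanaLimit_of_lt hL hS p1 p3 p2 p4 hε h hg⟩
  -- If `ε = |x|`, a single step joins `x` and `0`, and the limit is carried over from the trivial
  -- one at `0`.
  · rcases lt_or_gt_of_ne hx0 with hneg | hpos
    · rw [abs_of_neg hneg] at h
      refine ⟨0 - planaValue L x ε, ?_⟩
      rw [← hasPlanaLimit_add_iff hL hS hε p1 (by linarith) p2 p4 hgε, sub_add_cancel, h,
        add_neg_cancel]
      exact hasPlanaLimit_zero L _
    · rw [abs_of_pos hpos] at h
      subst h
      have := (hasPlanaLimit_add_iff hL hS hε p2 (by linarith) p2 p4 hgε 0).mpr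
        (hasPlanaLimit_zero L ε)
      rw [zero_add] at this
      exact ⟨_, this⟩

/-! ### Absolute convergence of the series and the contour integral -/

/-- As `q/(2πin) → 0`, the bracket converges by continuity of `a'/a` at `0` and `x`, hence is
bounded, and `1/n²` gives summability. No bound on `q` is needed: only finitely many of the points
can lie outside `U`. -/
theorem summable_borelTerm {a L : ℂ → ℂ} {U : Set ℂ} (hU : IsOpen U)
    (hL : AnalyticOnNhd ℂ L U) (hexp : ∀ z ∈ U, Complex.exp (L z) = a z) {x : ℂ}
    (h0 : (0 : ℂ) ∈ U) (hx : x ∈ U) (q : ℂ) : Summable (borelTerm a q x) := by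
  have hd : ∀ z ∈ U, ContinuousAt (dlog a) z := fun z hz => by
    have hev : dlog a =ᶠ[𝓝 z] deriv L := Filter.eventuallyEq_of_mem (hU.mem_nhds hz)
      fun w hw => dlog_eq_deriv hU hL hexp hw
    exact ((hL z hz).deriv.continuousAt).congr hev.symm
  have hb : Tendsto (borelPoint q) atTop (𝓝 0) := by
    have h1 := (tendsto_one_div_add_atTop_nhds_zero_nat (𝕜 := ℂ)).const_mul
      (q / (2 * Real.pi * Complex.I))
    rw [mul_zero] at h1
    refine h1.congr fun m => ?_
    rw [borelPoint, div_mul_div_comm, mul_one]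
  have hxb : Tendsto (fun m => x + borelPoint q m) atTop (𝓝 x) := by
    simpa using hb.const_add x
  have hxb' : Tendsto (fun m => x - borelPoint q m) atTop (𝓝 x) := by
    simpa using hb.const_sub x
  have hb' : Tendsto (fun m => -borelPoint q m) atTop (𝓝 0) := by
    simpa using hb.neg
  have hlim := ((((hd x hx).tendsto.comp hxb).add ((hd x hx).tendsto.comp hxb')).sub
    ((hd 0 h0).tendsto.comp hb)).sub ((hd 0 h0).tendsto.comp hb')
  obtain ⟨M, hM⟩ := hlim.norm.bddAbove_range
  refine Summable.of_norm_bounded (summable_const_div_add_sq M 1) fun m => ?_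
  have h2 : ‖(m : ℂ) + 1‖ = (m : ℝ) + 1 := by exact_mod_cast Complex.norm_natCast (m + 1)
  rw [borelTerm, norm_mul, norm_div, norm_pow, h2, norm_one, div_mul_eq_mul_div, one_mul]
  gcongr
  exact hM ⟨m, rfl⟩

theorem integral_mul_cexp_neg_mul_Ioi {w : ℂ} (hw : 0 < w.re) :
    ∫ u in Set.Ioi (0 : ℝ), (u : ℂ) * Complex.exp (-(w * u)) = 1 / w ^ 2 := by
  have hw0 : w ≠ 0 := by rintro rfl; simp at hw
  have hnorm : ∀ u : ℝ, ‖Complex.exp (-(w * u))‖ = Real.exp (-(w.re * u)) := fun u => by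
    rw [Complex.norm_exp]; simp
  have hexp : ∀ u : ℝ, HasDerivAt (fun u : ℝ => Complex.exp (-(w * u)))
      (-w * Complex.exp (-(w * u))) u := fun u => by
    have h1 : HasDerivAt (fun z : ℂ => -(w * z)) (-w) (u : ℂ) := by
      simpa [neg_mul] using (hasDerivAt_id (u : ℂ)).const_mul (-w)
    exact h1.cexp.comp_ofReal.congr_deriv (by ring)
  have hd : ∀ u ∈ Set.Ici (0 : ℝ), HasDerivAt
      (fun u : ℝ => -((u : ℂ) / w + 1 / w ^ 2) * Complex.exp (-(w * u)))
      ((u : ℂ) * Complex.exp (-(w * u))) u := fun u _ => by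
    have h1 : HasDerivAt (fun u : ℝ => -((u : ℂ) / w + 1 / w ^ 2)) (-(1 / w)) u :=
      (((hasDerivAt_id (u : ℂ)).comp_ofReal.div_const w).add_const (1 / w ^ 2)).neg
    refine (h1.mul (hexp u)).congr_deriv ?_
    field_simp
    ring
  have hint : IntegrableOn (fun u : ℝ => (u : ℂ) * Complex.exp (-(w * u))) (Set.Ioi 0) := by
    refine Integrable.mono' (integrableOn_pow_mul_exp_neg_mul 1 hw)
      (Continuous.aestronglyMeasurable (by fun_prop)) ?_
    refine (ae_restrict_iff' measurableSet_Ioi).mpr (Eventually.of_forall fun u hu => ?_)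
    have hu' : (0 : ℝ) < u := hu
    rw [norm_mul, hnorm, Complex.norm_real, Real.norm_of_nonneg hu'.le, pow_one]
  have hlim : Tendsto (fun u : ℝ => -((u : ℂ) / w + 1 / w ^ 2) * Complex.exp (-(w * u))) atTop
      (𝓝 0) := by
    have h1 := ((Real.tendsto_pow_mul_exp_neg_atTop_nhds_zero 1).comp
      (tendsto_id.const_mul_atTop hw)).const_mul (1 / (w.re * ‖w‖))
    have h2 := ((Real.tendsto_pow_mul_exp_neg_atTop_nhds_zero 0).comp
      (tendsto_id.const_mul_atTop hw)).const_mul (1 / ‖w‖ ^ 2)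
    have h3 := h1.add h2
    simp only [mul_zero, add_zero] at h3
    refine squeeze_zero_norm' ?_ h3
    filter_upwards [eventually_ge_atTop 0] with u hu
    rw [norm_mul, hnorm, norm_neg]
    simp only [Function.comp, id, pow_one, pow_zero, one_mul]
    have h4 : ‖(u : ℂ) / w + 1 / w ^ 2‖ ≤ u / ‖w‖ + 1 / ‖w‖ ^ 2 := by
      refine (norm_add_le _ _).trans_eq ?_
      rw [norm_div, norm_div, norm_pow, norm_one, Complex.norm_real, Real.norm_of_nonneg hu]
    refine (mul_le_mul_of_nonneg_right h4 (Real.exp_pos _).le).trans_eq ?_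
    have := norm_pos_iff.mpr hw0
    field_simp
  have := integral_Ioi_of_hasDerivAt_of_tendsto' hd hint hlim
  rw [this]
  simp

/-- Since `s² (n - bn/s)² = n² (s - b)²`, this is Cauchy's formula for the derivative. -/
theorem circleIntegral_div_sub_sq {f : ℂ → ℂ} {V : Set ℂ} (hV : IsOpen V)
    (hf : DifferentiableOn ℂ f V) {r : ℝ} (hr : Metric.closedBall (0 : ℂ) r ⊆ V) {b : ℂ}
    (hb : ‖b‖ < r) {n : ℂ} (hn : n ≠ 0) :
    (∮ s in C(0, r), f s / s ^ 2 * (1 / (n - b * n / s) ^ 2)) =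
      2 * Real.pi * Complex.I * deriv f b / n ^ 2 := by
  have hpi : (2 * Real.pi * Complex.I : ℂ) ≠ 0 := by simp [Real.pi_ne_zero]
  have hr0 : 0 < r := (norm_nonneg b).trans_lt hb
  have h := Complex.two_pi_I_inv_smul_circleIntegral_sub_sq_inv_smul_of_differentiable hV hr hf
    (w₀ := b) (by simpa using hb)
  rw [← h, smul_eq_mul, mul_inv_cancel_left₀ hpi, div_eq_mul_inv, mul_comm _ (n ^ 2)⁻¹,
    ← circleIntegral.integral_const_mul]
  refine circleIntegral.integral_congr hr0.le fun s hs => ?_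
  have hs0 : s ≠ 0 := by
    rintro rfl
    simp at hs
    exact hr0.ne hs
  have hsb : s - b ≠ 0 := by
    intro h0
    have : s = b := sub_eq_zero.mp h0
    subst this
    simp at hs
    exact hb.ne hs
  have e1 : n - b * n / s = n * (s - b) / s := by field_simp
  rw [e1, smul_eq_mul]
  field_simp

/-- The part of the contour integral that does not contain the factor `u / (exp u - 1)`. -/
noncomputable def contourKernel (f : ℂ → ℂ) (r : ℝ) (k : ℂ) (u : ℝ) : ℂ :=
  ∮ s in C(0, r), f s / s ^ 2 * Complex.exp (k * u / s)

theorem contourKernel_eq_intervalIntegral (f : ℂ → ℂ) (r : ℝ) (k : ℂ) (u : ℝ) :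
    contourKernel f r k u = ∫ θ in (0 : ℝ)..2 * Real.pi,
      (deriv (circleMap 0 r) θ * (f (circleMap 0 r θ) / circleMap 0 r θ ^ 2)) *
        Complex.exp (k * u / circleMap 0 r θ) := by
  rw [contourKernel, circleIntegral]
  simp only [smul_eq_mul, mul_assoc]

theorem continuous_contourKernel_integrand {f : ℂ → ℂ} {V : Set ℂ}
    (hf : ContinuousOn f V) {r : ℝ} (hr : 0 < r) (hrV : Metric.closedBall (0 : ℂ) r ⊆ V) :
    Continuous fun θ : ℝ =>
      deriv (circleMap 0 r) θ * (f (circleMap 0 r θ) / circleMap 0 r θ ^ 2) := by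
  have h1 : Continuous fun θ : ℝ => f (circleMap 0 r θ) :=
    hf.comp_continuous (continuous_circleMap 0 r) fun θ =>
      hrV (circleMap_mem_closedBall 0 hr.le θ)
  have h2 : Continuous (circleMap 0 r) := continuous_circleMap 0 r
  simp only [deriv_circleMap]
  refine (h2.mul continuous_const).mul (h1.div₀ (h2.pow 2) fun θ => ?_)
  simpa using hr.ne'

theorem continuous_contourKernel {f : ℂ → ℂ} {V : Set ℂ}
    (hf : ContinuousOn f V) {r : ℝ} (hr : 0 < r) (hrV : Metric.closedBall (0 : ℂ) r ⊆ V) (k : ℂ) :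
    Continuous (contourKernel f r k) := by
  have h1 := continuous_contourKernel_integrand hf hr hrV
  have h3 : Continuous (circleMap 0 r) := continuous_circleMap 0 r
  have h4 : ∀ θ, circleMap 0 r θ ≠ 0 := fun θ => by simpa using hr.ne'
  have : contourKernel f r k = fun u : ℝ => ∫ θ in (0 : ℝ)..2 * Real.pi,
      (deriv (circleMap 0 r) θ * (f (circleMap 0 r θ) / circleMap 0 r θ ^ 2)) *
        Complex.exp (k * u / circleMap 0 r θ) :=
    funext fun u => contourKernel_eq_intervalIntegral f r k u
  rw [this]
  refine intervalIntegral.continuous_parametric_intervalIntegral_of_continuous' ?_ _ _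
  refine (h1.comp continuous_snd).mul (Complex.continuous_exp.comp ?_)
  exact (continuous_const.mul (Complex.continuous_ofReal.comp continuous_fst)).div₀
    (h3.comp continuous_snd) fun p => h4 p.2

theorem exists_norm_contourKernel_le {f : ℂ → ℂ} {V : Set ℂ}
    (hf : ContinuousOn f V) {r : ℝ} (hr : 0 < r) (hrV : Metric.closedBall (0 : ℂ) r ⊆ V) (k : ℂ) :
    ∃ M : ℝ, 0 ≤ M ∧ (∀ θ : ℝ, θ ∈ Set.Icc 0 (2 * Real.pi) →
        ‖deriv (circleMap 0 r) θ * (f (circleMap 0 r θ) / circleMap 0 r θ ^ 2)‖ ≤ M) ∧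
      (∀ θ : ℝ, ∀ u : ℝ, 0 ≤ u →
        ‖Complex.exp (k * u / circleMap 0 r θ)‖ ≤ Real.exp (‖k‖ / r * u)) ∧
      ∀ u : ℝ, 0 ≤ u → ‖contourKernel f r k u‖ ≤ M * (2 * Real.pi) * Real.exp (‖k‖ / r * u) := by
  obtain ⟨M, hM⟩ := (isCompact_Icc (a := (0 : ℝ)) (b := 2 * Real.pi)).exists_bound_of_continuousOn
    (continuous_contourKernel_integrand hf hr hrV).continuousOn
  have hM0 : 0 ≤ M := (norm_nonneg _).trans (hM 0 ⟨le_rfl, by positivity⟩)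
  have hE : ∀ θ : ℝ, ∀ u : ℝ, 0 ≤ u →
      ‖Complex.exp (k * u / circleMap 0 r θ)‖ ≤ Real.exp (‖k‖ / r * u) := by
    intro θ u hu
    rw [Complex.norm_exp]
    refine Real.exp_le_exp.mpr ((Complex.re_le_norm _).trans_eq ?_)
    rw [norm_div, norm_mul, Complex.norm_real, Real.norm_of_nonneg hu, norm_circleMap_zero,
      abs_of_pos hr]
    ring
  refine ⟨M, hM0, hM, hE, fun u hu => ?_⟩
  rw [contourKernel_eq_intervalIntegral]
  have := intervalIntegral.norm_integral_le_of_norm_le_const (a := 0) (b := 2 * Real.pi)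
    (C := M * Real.exp (‖k‖ / r * u)) (f := fun θ =>
      (deriv (circleMap 0 r) θ * (f (circleMap 0 r θ) / circleMap 0 r θ ^ 2)) *
        Complex.exp (k * u / circleMap 0 r θ)) (fun θ hθ => by
    rw [Set.uIoc_of_le (by positivity)] at hθ
    rw [norm_mul]
    exact mul_le_mul (hM θ ⟨hθ.1.le, hθ.2⟩) (hE θ u hu) (norm_nonneg _) hM0)
  refine this.trans_eq ?_
  rw [sub_zero, abs_of_pos (by positivity)]
  ring

/-- On the circle `|e^{ku/s}| ≤ e^{(|k|/r)u}` with `|k|/r < 1`, so Fubini applies. The integral over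
`u` is `1/(n - k/s)²` with `n = m + 1`, and the contour integral is then Cauchy's formula at `k/n`.
-/
theorem integral_mul_exp_contourKernel {f : ℂ → ℂ} {V : Set ℂ} (hV : IsOpen V)
    (hf : DifferentiableOn ℂ f V) {r : ℝ} (hr : 0 < r) (hrV : Metric.closedBall (0 : ℂ) r ⊆ V)
    {k : ℂ} (hk : ‖k‖ < r) (m : ℕ) :
    ∫ u in Set.Ioi (0 : ℝ), (u * Real.exp (-((m + 1) * u)) : ℝ) * contourKernel f r k u =
      2 * Real.pi * Complex.I * deriv f (k / (m + 1)) / ((m : ℂ) + 1) ^ 2 := by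
  obtain ⟨M, hM0, hM, hE, -⟩ := exists_norm_contourKernel_le hf.continuousOn hr hrV k
  have hρ : ‖k‖ / r < 1 := (div_lt_one hr).mpr hk
  set φ : ℝ → ℂ := fun θ =>
    deriv (circleMap 0 r) θ * (f (circleMap 0 r θ) / circleMap 0 r θ ^ 2) with hφ
  have hφc : Continuous φ := continuous_contourKernel_integrand hf.continuousOn hr hrV
  have hcm : Continuous (circleMap 0 r) := continuous_circleMap 0 r
  have hc0 : ∀ θ, circleMap 0 r θ ≠ 0 := fun θ => by simpa using hr.ne'
  set F : ℝ → ℝ → ℂ := fun θ u => φ θ *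
    ((u * Real.exp (-((m + 1) * u)) : ℝ) * Complex.exp (k * u / circleMap 0 r θ)) with hF
  have hm : (0 : ℝ) ≤ m := Nat.cast_nonneg m
  have hbase : IntegrableOn (fun u : ℝ => M * (u ^ 1 * Real.exp (-((m + 1 - ‖k‖ / r) * u))))
      (Set.Ioi 0) := (integrableOn_pow_mul_exp_neg_mul 1 (by linarith)).const_mul M
  have hfub : Integrable (Function.uncurry F)
      ((volume.restrict (Set.uIoc 0 (2 * Real.pi))).prod (volume.restrict (Set.Ioi 0))) := by
    have hfin : IsFiniteMeasure (volume.restrict (Set.uIoc (0 : ℝ) (2 * Real.pi))) := by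
      rw [Set.uIoc_of_le (by positivity)]; infer_instance
    refine Integrable.mono' (Integrable.comp_snd hbase _) ?_ ?_
    · refine Continuous.aestronglyMeasurable ?_
      refine (hφc.comp continuous_fst).mul (Continuous.mul (by fun_prop) ?_)
      exact Complex.continuous_exp.comp ((continuous_const.mul
        (Complex.continuous_ofReal.comp continuous_snd)).div₀ (hcm.comp continuous_fst)
          fun p => hc0 p.1)
    · rw [Measure.prod_restrict]
      refine (ae_restrict_iff' (measurableSet_uIoc.prod measurableSet_Ioi)).mpr
        (Eventually.of_forall ?_)
      rintro ⟨θ, u⟩ ⟨hθ, hu⟩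
      simp only at hθ hu
      rw [Set.uIoc_of_le (by positivity)] at hθ
      have hu0 : (0 : ℝ) < u := hu
      change ‖φ θ * (((u * Real.exp (-((m + 1) * u)) : ℝ) : ℂ) *
        Complex.exp (k * u / circleMap 0 r θ))‖ ≤ _
      rw [norm_mul (φ θ), norm_mul ((_ : ℝ) : ℂ), Complex.norm_real, Real.norm_of_nonneg (by positivity)]
      calc _ ≤ M * (u * Real.exp (-((m + 1) * u)) * Real.exp (‖k‖ / r * u)) := by
            gcongr
            · exact hM θ ⟨hθ.1.le, hθ.2⟩
            · exact hE θ u hu0.le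
        _ = _ := by
            rw [mul_assoc u, ← Real.exp_add, pow_one]
            ring_nf
  have hswap := intervalIntegral_integral_swap hfub
  have hleft : ∀ u : ℝ, ∫ θ in (0 : ℝ)..2 * Real.pi, F θ u =
      (u * Real.exp (-((m + 1) * u)) : ℝ) * contourKernel f r k u := by
    intro u
    rw [contourKernel_eq_intervalIntegral, ← intervalIntegral.integral_const_mul]
    refine intervalIntegral.integral_congr fun θ _ => ?_
    simp only [hF, hφ]
    ring
  have hright : ∀ θ : ℝ, ∫ u in Set.Ioi (0 : ℝ), F θ u =
      φ θ * (1 / (((m : ℂ) + 1) - k / circleMap 0 r θ) ^ 2) := by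
    intro θ
    have hre : 0 < (((m : ℂ) + 1) - k / circleMap 0 r θ).re := by
      have h1 : (k / circleMap 0 r θ).re ≤ ‖k‖ / r := by
        refine (Complex.re_le_norm _).trans_eq ?_
        rw [norm_div, norm_circleMap_zero, abs_of_pos hr]
      simp only [Complex.sub_re, Complex.add_re, Complex.natCast_re, Complex.one_re]
      linarith
    rw [← integral_mul_cexp_neg_mul_Ioi hre, ← integral_const_mul]
    refine setIntegral_congr_fun measurableSet_Ioi fun u _ => ?_
    simp only [hF]
    congr 1
    push_cast
    rw [mul_assoc, ← Complex.exp_add]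
    congr 2
    ring
  simp only [hleft, hright] at hswap
  rw [← hswap]
  have hm1 : (m : ℂ) + 1 ≠ 0 := by exact_mod_cast (by positivity : (m : ℝ) + 1 ≠ 0)
  have hb : ‖k / ((m : ℂ) + 1)‖ < r := by
    have h2 : ‖(m : ℂ) + 1‖ = (m : ℝ) + 1 := by exact_mod_cast Complex.norm_natCast (m + 1)
    rw [norm_div, h2]
    exact (div_le_self (norm_nonneg _) (by linarith)).trans_lt hk
  rw [← circleIntegral_div_sub_sq hV hf hrV hb hm1, circleIntegral]
  refine intervalIntegral.integral_congr fun θ _ => ?_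
  simp only [hφ, smul_eq_mul, div_mul_cancel₀ _ hm1, mul_assoc]

theorem hasSum_mul_exp_neg {u : ℝ} (hu : 0 < u) :
    HasSum (fun m : ℕ => u * Real.exp (-((m + 1) * u))) (u / (Real.exp (1 * u) - 1)) := by
  have h1 : Real.exp (-u) < 1 := by simpa using hu
  have h := (hasSum_geometric_of_lt_one (Real.exp_pos (-u)).le h1).mul_left (u * Real.exp (-u))
  have h2 : u * Real.exp (-u) * (1 - Real.exp (-u))⁻¹ = u / (Real.exp (1 * u) - 1) := by
    rw [one_mul, Real.exp_neg]
    have h3 : Real.exp u - 1 ≠ 0 := by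
      have := Real.add_one_lt_exp hu.ne'
      linarith
    have h4 : 1 - (Real.exp u)⁻¹ = (Real.exp u - 1) / Real.exp u := by field_simp
    rw [h4]
    field_simp
  rw [h2] at h
  refine h.congr_fun fun m => ?_
  rw [← Real.exp_nat_mul, mul_assoc, ← Real.exp_add]
  congr 2
  ring

/-- Expand `u/(e^u - 1) = ∑ u e^{-nu}` and integrate termwise; the integrals of the norms are
`O(1/(n - |k|/r)²)`. -/
theorem hasSum_contour {f : ℂ → ℂ} {V : Set ℂ} (hV : IsOpen V)
    (hf : DifferentiableOn ℂ f V) {r : ℝ} (hr : 0 < r) (hrV : Metric.closedBall (0 : ℂ) r ⊆ V)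
    {k : ℂ} (hk : ‖k‖ < r) :
    IntegrableOn (fun u : ℝ => (u : ℂ) / (Complex.exp u - 1) * contourKernel f r k u)
      (Set.Ioi 0) ∧
    HasSum (fun m : ℕ => 2 * Real.pi * Complex.I * deriv f (k / (m + 1)) / ((m : ℂ) + 1) ^ 2)
      (∫ u in Set.Ioi (0 : ℝ), (u : ℂ) / (Complex.exp u - 1) * contourKernel f r k u) := by
  obtain ⟨M, hM0, -, -, hΦ⟩ := exists_norm_contourKernel_le hf.continuousOn hr hrV k
  have hΦc := continuous_contourKernel hf.continuousOn hr hrV k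
  have hρ : ‖k‖ / r < 1 := (div_lt_one hr).mpr hk
  have hfun : ∀ u : ℝ, (u : ℂ) / (Complex.exp u - 1) * contourKernel f r k u =
      (u * contourKernel f r k u) / ((Real.exp (1 * u) - 1 : ℝ) : ℂ) := by
    intro u
    push_cast
    rw [one_mul]
    ring
  constructor
  · simp only [hfun]
    refine integrableOn_div_exp_sub_one (b := ‖k‖ / r) (A := M * (2 * Real.pi)) (by fun_prop)
      one_pos hρ fun u hu => ?_
    rw [norm_mul, Complex.norm_real, Real.norm_of_nonneg hu]
    refine (mul_le_mul_of_nonneg_left (hΦ u hu) hu).trans_eq ?_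
    ring
  · have hm : ∀ m : ℕ, (0 : ℝ) ≤ m := fun m => Nat.cast_nonneg m
    have hb : ∀ m : ℕ, ∀ u : ℝ, 0 ≤ u →
        ‖(u * Real.exp (-((m + 1) * u)) : ℝ) * contourKernel f r k u‖ ≤
        M * (2 * Real.pi) * (u ^ 1 * Real.exp (-((m + 1 - ‖k‖ / r) * u))) := by
      intro m u hu
      rw [norm_mul, Complex.norm_real, Real.norm_of_nonneg (by positivity)]
      refine (mul_le_mul_of_nonneg_left (hΦ u hu) (by positivity)).trans_eq ?_
      rw [show -(((m : ℝ) + 1 - ‖k‖ / r) * u) = -((m + 1) * u) + ‖k‖ / r * u by ring, Real.exp_add]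
      ring
    have hbi : ∀ m : ℕ, IntegrableOn (fun u : ℝ =>
        M * (2 * Real.pi) * (u ^ 1 * Real.exp (-((m + 1 - ‖k‖ / r) * u)))) (Set.Ioi 0) := fun m =>
      (integrableOn_pow_mul_exp_neg_mul 1 (by linarith [hm m])).const_mul _
    have hint : ∀ m : ℕ, IntegrableOn (fun u : ℝ =>
        (u * Real.exp (-((m + 1) * u)) : ℝ) * contourKernel f r k u) (Set.Ioi 0) := fun m => by
      refine Integrable.mono' (hbi m) (Continuous.aestronglyMeasurable (by fun_prop)) ?_
      exact (ae_restrict_iff' measurableSet_Ioi).mpr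
        (Eventually.of_forall fun u hu => hb m u (le_of_lt hu))
    have hsum : Summable fun m : ℕ => ∫ u in Set.Ioi (0 : ℝ),
        ‖(u * Real.exp (-((m + 1) * u)) : ℝ) * contourKernel f r k u‖ := by
      refine Summable.of_nonneg_of_le (fun m => integral_nonneg fun t => norm_nonneg _)
        (fun m => ?_) (summable_const_div_add_sq (M * (2 * Real.pi)) (1 - ‖k‖ / r))
      calc _ ≤ ∫ u in Set.Ioi (0 : ℝ),
            M * (2 * Real.pi) * (u ^ 1 * Real.exp (-((m + 1 - ‖k‖ / r) * u))) :=
            setIntegral_mono_on (hint m).norm (hbi m) measurableSet_Ioi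
              fun u hu => hb m u (le_of_lt (Set.mem_Ioi.mp hu))
        _ = _ := by
          rw [integral_const_mul, integral_pow_mul_exp_neg_mul 1 (by linarith [hm m])]
          rw [add_sub_assoc]
          simp
          ring
    have h := hasSum_integral_of_summable_integral_norm hint hsum
    simp only [integral_mul_exp_contourKernel hV hf hr hrV hk] at h
    have heq : (∫ u in Set.Ioi (0 : ℝ), (u : ℂ) / (Complex.exp u - 1) * contourKernel f r k u) =
        ∫ u in Set.Ioi (0 : ℝ), ∑' m : ℕ,
          (u * Real.exp (-((m + 1) * u)) : ℝ) * contourKernel f r k u := by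
      refine setIntegral_congr_fun measurableSet_Ioi fun u hu => ?_
      have h1 := ((Complex.hasSum_ofReal.mpr (hasSum_mul_exp_neg hu)).mul_right
        (contourKernel f r k u)).tsum_eq
      rw [h1, hfun]
      push_cast
      ring
    rw [heq]
    exact h

/-- The two exponentials correspond to `k = ±q/(2πi)`, with `f(s) = L(s) - L(x + s)`. The factor
`2πi/(2πi)³ = -1/(4π²)` accounts for the order of the difference in `f`. -/
theorem borelG_eq_contour {a L : ℂ → ℂ} {U : Set ℂ} (hU : IsOpen U)
    (hL : AnalyticOnNhd ℂ L U) (hexp : ∀ z ∈ U, Complex.exp (L z) = a z) {x : ℂ} {r : ℝ}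
    (hr : 0 < r) (hr0 : Metric.closedBall (0 : ℂ) r ⊆ U) (hrx : Metric.closedBall x r ⊆ U)
    {q : ℂ} (hq : ‖q‖ < 2 * Real.pi * r) :
    IntegrableOn (contourInner L r q x) (Set.Ioi 0) volume ∧
      borelG a q x = 1 / (2 * (Real.pi : ℂ) * Complex.I) ^ 3 *
        ∫ u in Set.Ioi (0 : ℝ), contourInner L r q x u := by
  set V : Set ℂ := U ∩ (fun s => x + s) ⁻¹' U with hVdef
  have hV : IsOpen V := hU.inter (hU.preimage (by fun_prop))
  have hrV : Metric.closedBall (0 : ℂ) r ⊆ V := fun s hs => by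
    refine ⟨hr0 hs, hrx ?_⟩
    simpa using hs
  set f : ℂ → ℂ := fun s => L s - L (x + s) with hf
  have hfd : ∀ s ∈ V, HasDerivAt f (deriv L s - deriv L (x + s)) s := fun s hs =>
    (hL s hs.1).differentiableAt.hasDerivAt.sub
      ((hL (x + s) hs.2).differentiableAt.hasDerivAt.comp_const_add x s)
  have hfV : DifferentiableOn ℂ f V := fun s hs =>
    (hfd s hs).differentiableAt.differentiableWithinAt
  have hpi : (2 * Real.pi * Complex.I : ℂ) ≠ 0 := by simp [Real.pi_ne_zero]
  set k : ℂ := q / (2 * Real.pi * Complex.I) with hkdef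
  have hk : ‖k‖ < r := by
    have : ‖(2 * Real.pi * Complex.I : ℂ)‖ = 2 * Real.pi := by
      simp [abs_of_pos Real.pi_pos]
    rw [hkdef, norm_div, this, div_lt_iff₀ (by positivity)]
    linarith
  have hk' : ‖-k‖ < r := by rwa [norm_neg]
  obtain ⟨i1, s1⟩ := hasSum_contour hV hfV hr hrV hk
  obtain ⟨i2, s2⟩ := hasSum_contour hV hfV hr hrV hk'
  have hci : ∀ k' : ℂ, ∀ u : ℝ, CircleIntegrable
      (fun s => f s / s ^ 2 * Complex.exp (k' * u / s)) 0 r := by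
    intro k' u
    refine ContinuousOn.circleIntegrable hr.le fun s hs => ?_
    have hs0 : s ≠ 0 := by
      rintro rfl
      simp at hs
      exact hr.ne hs
    have hsV : s ∈ V := hrV (Metric.sphere_subset_closedBall hs)
    have := (hfd s hsV).continuousAt
    refine ContinuousAt.continuousWithinAt ?_
    have hs2 : s ^ 2 ≠ 0 := pow_ne_zero 2 hs0
    refine (this.div₀ (by fun_prop) hs2).mul ?_
    exact (continuousAt_const.div₀ continuousAt_id hs0).cexp
  have hfun : contourInner L r q x = fun u : ℝ =>
      (u : ℂ) / (Complex.exp u - 1) * contourKernel f r k u +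
      (u : ℂ) / (Complex.exp u - 1) * contourKernel f r (-k) u := by
    funext u
    rw [← mul_add, contourKernel, contourKernel,
      ← circleIntegral.integral_add (hci k u) (hci (-k) u), contourInner,
      circleIntegral.integral_const_mul]
    congr 1
    refine circleIntegral.integral_congr hr.le fun s _ => ?_
    simp only [hf, hkdef]
    rw [← mul_add]
    congr 3
    · rw [div_mul_eq_mul_div, div_div]
    · rw [neg_mul, div_mul_eq_mul_div, neg_div, div_div]
  have hbound : ∀ m : ℕ, ‖borelPoint q m‖ < r := fun m => by
    have h2 : ‖(m : ℂ) + 1‖ = (m : ℝ) + 1 := by exact_mod_cast Complex.norm_natCast (m + 1)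
    rw [borelPoint, ← div_div, norm_div, h2]
    exact (div_le_self (norm_nonneg _) (by linarith [Nat.cast_nonneg (α := ℝ) m])).trans_lt hk
  refine ⟨by rw [hfun]; exact i1.add i2, ?_⟩
  rw [hfun, integral_add i1 i2, ← (s1.add s2).tsum_eq, borelG, ← tsum_mul_left, ← tsum_mul_left]
  refine tsum_congr fun m => ?_
  have hp1 : k / ((m : ℂ) + 1) = borelPoint q m := by rw [borelPoint, hkdef, div_div]
  have hp2 : -k / ((m : ℂ) + 1) = -borelPoint q m := by rw [neg_div, hp1]
  have m1 : borelPoint q m ∈ V := hrV (by simpa using (hbound m).le)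
  have m2 : -borelPoint q m ∈ V := hrV (by simpa using (hbound m).le)
  have m3 : x - borelPoint q m ∈ U := by
    have := m2.2
    simpa [sub_eq_add_neg] using this
  rw [hp1, hp2, (hfd _ m1).deriv, (hfd _ m2).deriv, borelTerm,
    dlog_eq_deriv hU hL hexp m1.1, dlog_eq_deriv hU hL hexp m2.1,
    dlog_eq_deriv hU hL hexp m1.2, dlog_eq_deriv hU hL hexp m3, ← sub_eq_add_neg]
  have hm1 : (m : ℂ) + 1 ≠ 0 := by exact_mod_cast (by positivity : (m : ℝ) + 1 ≠ 0)
  have hpi' : (Real.pi : ℂ) ≠ 0 := by exact_mod_cast Real.pi_ne_zero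
  field_simp
  rw [Complex.I_sq]
  ring

/-! ### Watson's lemma and the asymptotic expansion -/

theorem AnalyticAt.isBigO_sub_taylor {f : ℂ → ℂ} {z : ℂ} (hf : AnalyticAt ℂ f z) (n : ℕ) :
    (fun y : ℂ => f (z + y) - ∑ k ∈ Finset.range n,
      iteratedDeriv k f z / (k.factorial : ℂ) * y ^ k) =O[𝓝 0] fun y : ℂ => ‖y‖ ^ n := by
  have h := hf.hasFPowerSeriesAt.isBigO_sub_partialSum_pow n
  refine h.congr_left fun y => ?_
  rw [FormalMultilinearSeries.partialSum]
  simp [mul_comm]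

/-- The Taylor coefficients of `verticalDiff L z`. -/
noncomputable def verticalDiffCoeff (L : ℂ → ℂ) (z : ℂ) (j : ℕ) : ℂ :=
  (1 + (-1) ^ j) * iteratedDeriv (j + 1) L z / ((j + 1).factorial : ℂ) /
    (2 * Real.pi * Complex.I) ^ (j + 1)

/-- The Taylor polynomials at the two points are subtracted: the constant terms cancel and the
factor `1 + (-1)^j` retains the odd powers of `t`. -/
theorem isBigO_verticalDiff_sub {L : ℂ → ℂ} {z : ℂ} (hL : AnalyticAt ℂ L z) (n : ℕ) :
    (fun t : ℝ => verticalDiff L z t - ∑ j ∈ Finset.range n, verticalDiffCoeff L z j *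
      (t : ℂ) ^ (j + 1)) =O[𝓝 0] fun t : ℝ => |t| ^ (n + 1) := by
  have h := hL.isBigO_sub_taylor (n + 1)
  have ht : Tendsto (fun t : ℝ => (t : ℂ) / (2 * Real.pi * Complex.I)) (𝓝 0) (𝓝 0) := by
    have : Continuous fun t : ℝ => (t : ℂ) / (2 * Real.pi * Complex.I) := by fun_prop
    simpa using this.tendsto 0
  have ht' : Tendsto (fun t : ℝ => -((t : ℂ) / (2 * Real.pi * Complex.I))) (𝓝 0) (𝓝 0) := by
    simpa using ht.neg
  have hO : (fun t : ℝ => ‖(t : ℂ) / (2 * Real.pi * Complex.I)‖ ^ (n + 1)) =O[𝓝 0]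
      fun t : ℝ => |t| ^ (n + 1) := by
    refine Asymptotics.IsBigO.pow ?_ (n + 1)
    refine Asymptotics.IsBigO.of_bound ‖(2 * Real.pi * Complex.I : ℂ)‖⁻¹
      (Eventually.of_forall fun t => ?_)
    rw [norm_norm, norm_div, Complex.norm_real, Real.norm_eq_abs, Real.norm_eq_abs, abs_abs,
      div_eq_inv_mul]
  have h1 := (h.comp_tendsto ht).trans hO
  have h2 := (h.comp_tendsto ht').trans (by simpa [Function.comp_def] using hO)
  refine (h1.sub h2).congr_left fun t => ?_
  simp only [Function.comp, verticalDiff]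
  rw [Finset.sum_range_succ', Finset.sum_range_succ', ← sub_eq_add_neg]
  have hsum : ∑ j ∈ Finset.range n, verticalDiffCoeff L z j * (t : ℂ) ^ (j + 1) =
      (∑ k ∈ Finset.range n, iteratedDeriv (k + 1) L z / ((k + 1).factorial : ℂ) *
        ((t : ℂ) / (2 * Real.pi * Complex.I)) ^ (k + 1)) -
      ∑ k ∈ Finset.range n, iteratedDeriv (k + 1) L z / ((k + 1).factorial : ℂ) *
        (-((t : ℂ) / (2 * Real.pi * Complex.I))) ^ (k + 1) := by
    rw [← Finset.sum_sub_distrib]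
    refine Finset.sum_congr rfl fun k _ => ?_
    rw [neg_pow, div_pow, verticalDiffCoeff]
    ring
  rw [hsum]
  simp only [pow_zero]
  ring

/-- Expanding the kernel in powers of `e^{-ct}` produces Gamma integrals, whose sum is a multiple of
`ζ(j + 2)`. The power `t^{j+1}` cancels the pole of the kernel. -/
theorem integral_pow_div_exp_sub_one (j : ℕ) {c : ℝ} (hc : 0 < c) :
    IntegrableOn (fun t : ℝ => (t : ℂ) ^ (j + 1) / ((Real.exp (c * t) - 1 : ℝ) : ℂ)) (Set.Ioi 0) ∧
    HasSum (fun m : ℕ => ((j + 1).factorial : ℂ) / ((c : ℂ) * (m + 1)) ^ (j + 2))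
      (∫ t in Set.Ioi (0 : ℝ), (t : ℂ) ^ (j + 1) / ((Real.exp (c * t) - 1 : ℝ) : ℂ)) := by
  have hint : ∀ m : ℕ, IntegrableOn (fun t : ℝ =>
      ((t ^ (j + 1) * Real.exp (-(c * (m + 1) * t)) : ℝ) : ℂ)) (Set.Ioi 0) := fun m =>
    (integrableOn_pow_mul_exp_neg_mul (j + 1) (b := c * (m + 1)) (by positivity)).ofReal
  have hval : ∀ m : ℕ, ∫ t in Set.Ioi (0 : ℝ),
      t ^ (j + 1) * Real.exp (-(c * (m + 1) * t)) =
        ((j + 1).factorial : ℝ) / (c * (m + 1)) ^ (j + 2) := fun m =>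
    integral_pow_mul_exp_neg_mul (j + 1) (b := c * (m + 1)) (by positivity)
  have hsum : Summable fun m : ℕ => ∫ t in Set.Ioi (0 : ℝ),
      ‖((t ^ (j + 1) * Real.exp (-(c * (m + 1) * t)) : ℝ) : ℂ)‖ := by
    have h1 : Summable fun m : ℕ => ((j + 1).factorial : ℝ) / (c * ((m : ℝ) + 1)) ^ (j + 2) := by
      refine Summable.of_nonneg_of_le (fun m => by positivity) (fun m => ?_)
        (summable_const_div_add_sq ((j + 1).factorial / c ^ (j + 2)) 1)
      rw [mul_pow, ← div_div]
      refine div_le_div_of_nonneg_left (by positivity) (by positivity) ?_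
      exact pow_le_pow_right₀ (by linarith [Nat.cast_nonneg (α := ℝ) m]) (by omega)
    refine h1.congr fun m => ?_
    rw [← hval]
    refine setIntegral_congr_fun measurableSet_Ioi fun t ht => ?_
    have ht' : (0 : ℝ) < t := ht
    rw [Complex.norm_real, Real.norm_of_nonneg (by positivity)]
  have hS := hasSum_integral_of_summable_integral_norm hint hsum
  have hval' : ∀ m : ℕ, ∫ t in Set.Ioi (0 : ℝ),
      ((t ^ (j + 1) * Real.exp (-(c * (m + 1) * t)) : ℝ) : ℂ) =
        ((j + 1).factorial : ℂ) / ((c : ℂ) * (m + 1)) ^ (j + 2) := fun m => by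
    rw [integral_complex_ofReal, hval]
    push_cast
    rfl
  simp only [hval'] at hS
  have heq : (∫ t in Set.Ioi (0 : ℝ), (t : ℂ) ^ (j + 1) / ((Real.exp (c * t) - 1 : ℝ) : ℂ)) =
      ∫ t in Set.Ioi (0 : ℝ), ∑' m : ℕ,
        ((t ^ (j + 1) * Real.exp (-(c * (m + 1) * t)) : ℝ) : ℂ) := by
    refine setIntegral_congr_fun measurableSet_Ioi fun t ht => ?_
    have ht' : (0 : ℝ) < t := ht
    have h1 := (hasSum_mul_exp_neg (mul_pos hc ht')).mul_left (c⁻¹ * t ^ j)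
    have h2 : (fun m : ℕ => c⁻¹ * t ^ j * (c * t * Real.exp (-((m + 1) * (c * t))))) =
        fun m : ℕ => t ^ (j + 1) * Real.exp (-(c * (m + 1) * t)) := by
      funext m
      rw [show -(((m : ℝ) + 1) * (c * t)) = -(c * (m + 1) * t) by ring]
      field_simp
      rw [pow_succ]
    rw [h2] at h1
    rw [(Complex.hasSum_ofReal.mpr h1).tsum_eq, one_mul, ← Complex.ofReal_pow,
      ← Complex.ofReal_div]
    congr 1
    field_simp
    rw [pow_succ']
  refine ⟨?_, by rw [heq]; exact hS⟩
  have h1 := (integrableOn_pow_mul_exp_neg_mul j (b := c / 2) (by positivity)).const_mul c⁻¹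
  refine Integrable.mono' h1 ?_ ?_
  · exact (Measurable.div (by fun_prop) (by fun_prop)).aestronglyMeasurable
  · refine (ae_restrict_iff' measurableSet_Ioi).mpr (Eventually.of_forall fun t ht => ?_)
    have ht' : (0 : ℝ) < t := ht
    refine (norm_div_exp_sub_one_le (A := t ^ j) hc ht' ?_).trans_eq (by ring)
    rw [norm_pow, Complex.norm_real, Real.norm_of_nonneg ht'.le, pow_succ]

/-- The local Taylor estimate holds for `t ≤ δ`; for `t ≥ δ` every `t^k` with `k ≤ n` is at most
`t^n/δ^n`, so the growth bound absorbs the polynomial. The last factor `t` is kept apart for the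
pole of the kernel. -/
theorem exists_norm_sub_taylor_le {W : ℝ → ℂ} {v : ℕ → ℂ} {n : ℕ} {A b : ℝ} (hA : 0 ≤ A)
    (hb : 0 ≤ b) (hbd : ∀ t : ℝ, 0 ≤ t → ‖W t‖ ≤ A * t * Real.exp (b * t))
    (hO : (fun t : ℝ => W t - ∑ j ∈ Finset.range n, v j * (t : ℂ) ^ (j + 1)) =O[𝓝 0]
      fun t : ℝ => |t| ^ (n + 1)) :
    ∃ C : ℝ, ∀ t : ℝ, 0 < t → ‖W t - ∑ j ∈ Finset.range n, v j * (t : ℂ) ^ (j + 1)‖ ≤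
      C * t ^ n * Real.exp (b * t) * t := by
  obtain ⟨C₀, hC₀⟩ := hO.bound
  obtain ⟨δ', hδ', hball⟩ := Metric.eventually_nhds_iff.mp hC₀
  set δ := min (δ' / 2) 1 with hδdef
  have hδ : 0 < δ := by positivity
  have hδ1 : δ ≤ 1 := min_le_right _ _
  set C₁ := (A + ∑ j ∈ Finset.range n, ‖v j‖) / δ ^ n with hC₁
  have hS : 0 ≤ ∑ j ∈ Finset.range n, ‖v j‖ := Finset.sum_nonneg fun _ _ => norm_nonneg _
  refine ⟨max |C₀| C₁, fun t ht => ?_⟩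
  have hexp : 1 ≤ Real.exp (b * t) := Real.one_le_exp (by positivity)
  rcases le_total t δ with h | h
  · have h1 := hball (y := t) (by
      rw [Real.dist_0_eq_abs, abs_of_pos ht]
      exact h.trans_lt ((min_le_left _ _).trans_lt (by linarith)))
    rw [norm_pow, Real.norm_eq_abs, abs_abs, abs_of_pos ht] at h1
    calc _ ≤ C₀ * t ^ (n + 1) := h1
      _ ≤ max |C₀| C₁ * t ^ (n + 1) := by
        gcongr; exact (le_abs_self _).trans (le_max_left _ _)
      _ = max |C₀| C₁ * t ^ n * 1 * t := by ring
      _ ≤ _ := by gcongr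
  · have hpow : ∀ k ≤ n, t ^ k ≤ t ^ n / δ ^ n := fun k hk => by
      have hd : t ^ n / δ ^ n = t ^ k * (t ^ (n - k) / δ ^ n) := by
        rw [← mul_div_assoc, ← pow_add, Nat.add_sub_cancel' hk]
      rw [hd]
      refine le_mul_of_one_le_right (by positivity) ((one_le_div (by positivity)).mpr ?_)
      calc δ ^ n ≤ δ ^ (n - k) := pow_le_pow_of_le_one hδ.le hδ1 (Nat.sub_le _ _)
        _ ≤ t ^ (n - k) := by gcongr
    have h0 : 1 ≤ t ^ n / δ ^ n := by simpa using hpow 0 (Nat.zero_le n)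
    have h1 : ‖W t‖ ≤ A * (t ^ n / δ ^ n) * Real.exp (b * t) * t := by
      calc ‖W t‖ ≤ A * t * Real.exp (b * t) := hbd t ht.le
        _ = A * 1 * Real.exp (b * t) * t := by ring
        _ ≤ _ := by gcongr
    have h2 : ‖∑ j ∈ Finset.range n, v j * (t : ℂ) ^ (j + 1)‖ ≤
        (∑ j ∈ Finset.range n, ‖v j‖) * (t ^ n / δ ^ n) * Real.exp (b * t) * t := by
      refine (norm_sum_le _ _).trans ?_
      rw [Finset.sum_mul, Finset.sum_mul, Finset.sum_mul]
      refine Finset.sum_le_sum fun j hj => ?_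
      rw [norm_mul, norm_pow, Complex.norm_real, Real.norm_of_nonneg ht.le]
      calc ‖v j‖ * t ^ (j + 1) = ‖v j‖ * t ^ j * 1 * t := by ring
        _ ≤ _ := by
          gcongr
          exact hpow j (Finset.mem_range.mp hj).le
    calc _ ≤ _ := norm_sub_le _ _
      _ ≤ _ := add_le_add h1 h2
      _ = C₁ * t ^ n * Real.exp (b * t) * t := by rw [hC₁]; ring
      _ ≤ _ := by gcongr; exact le_max_right _ _

/-- A form of Watson's lemma for the kernel `1 / (exp(t/ε) - 1)`. -/
theorem isBigO_integral_div_exp_sub {W : ℝ → ℂ} (hW : Continuous W) {v : ℕ → ℂ} {n : ℕ} {A b : ℝ}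
    (hA : 0 ≤ A) (hb : 0 < b) (hbd : ∀ t : ℝ, 0 ≤ t → ‖W t‖ ≤ A * t * Real.exp (b * t))
    (hO : (fun t : ℝ => W t - ∑ j ∈ Finset.range n, v j * (t : ℂ) ^ (j + 1)) =O[𝓝 0]
      fun t : ℝ => |t| ^ (n + 1)) :
    (fun ε : ℝ => (∫ t in Set.Ioi (0 : ℝ), W t / ((Real.exp (ε⁻¹ * t) - 1 : ℝ) : ℂ)) -
      ∑ j ∈ Finset.range n, v j *
        ∫ t in Set.Ioi (0 : ℝ), (t : ℂ) ^ (j + 1) / ((Real.exp (ε⁻¹ * t) - 1 : ℝ) : ℂ))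
      =O[𝓝[>] 0] fun ε : ℝ => ε ^ (n + 2) := by
  obtain ⟨C, hC⟩ := exists_norm_sub_taylor_le hA hb.le hbd hO
  refine Asymptotics.IsBigO.of_bound (C * (n.factorial * 4 ^ (n + 1))) ?_
  -- For `ε < 1/(4b)` the growth `e^{bt}` takes at most half of the decay `e^{-t/(2ε)}` of the
  -- kernel. The remaining `e^{-t/(4ε)}` integrates against `t^n` to `n! (4ε)^{n+1}`.
  have hsmall : Set.Ioo 0 (1 / (4 * b)) ∈ 𝓝[>] (0 : ℝ) := Ioo_mem_nhdsGT (by positivity)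
  filter_upwards [hsmall] with ε hε
  have hε0 : 0 < ε := hε.1
  set c := ε⁻¹ with hc
  have hc0 : 0 < c := inv_pos.mpr hε0
  have hcb : 4 * b ≤ c := by
    rw [hc, le_inv_comm₀ (by positivity) hε0]
    simpa using hε.2.le
  have iW := integrableOn_div_exp_sub_one hW hc0 (by linarith : b < c) hbd
  have iP : ∀ j, Integrable (fun t : ℝ => v j *
      ((t : ℂ) ^ (j + 1) / ((Real.exp (c * t) - 1 : ℝ) : ℂ))) (volume.restrict (Set.Ioi 0)) :=
    fun j => (integral_pow_div_exp_sub_one j hc0).1.const_mul _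
  have hsub : (∫ t in Set.Ioi (0 : ℝ), W t / ((Real.exp (c * t) - 1 : ℝ) : ℂ)) -
      ∑ j ∈ Finset.range n, v j *
        ∫ t in Set.Ioi (0 : ℝ), (t : ℂ) ^ (j + 1) / ((Real.exp (c * t) - 1 : ℝ) : ℂ) =
      ∫ t in Set.Ioi (0 : ℝ), (W t - ∑ j ∈ Finset.range n, v j * (t : ℂ) ^ (j + 1)) /
        ((Real.exp (c * t) - 1 : ℝ) : ℂ) := by
    simp only [← integral_const_mul]
    rw [← integral_finsetSum _ fun j _ => iP j, ← integral_sub iW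
      (integrable_finsetSum _ fun j _ => iP j)]
    refine integral_congr_ae (Eventually.of_forall fun t => ?_)
    simp only [sub_div, Finset.sum_div, mul_div_assoc]
  rw [hsub]
  have hdom := (integrableOn_pow_mul_exp_neg_mul n (b := c / 4) (by positivity)).const_mul
    (C * c⁻¹)
  refine (norm_integral_le_of_norm_le hdom ((ae_restrict_iff' measurableSet_Ioi).mpr
    (Eventually.of_forall fun t ht => ?_))).trans ?_
  · have ht' : (0 : ℝ) < t := ht
    have hCt := hC t ht'
    have hCn : 0 ≤ C := by
      have := (norm_nonneg _).trans hCt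
      by_contra hneg
      have : C * t ^ n * Real.exp (b * t) * t < 0 := by
        rw [mul_assoc, mul_assoc]
        exact mul_neg_of_neg_of_pos (not_le.mp hneg) (by positivity)
      linarith
    refine (norm_div_exp_sub_one_le hc0 ht' hCt).trans ?_
    have h1 : Real.exp (b * t) * Real.exp (-(c / 2 * t)) ≤ Real.exp (-(c / 4 * t)) := by
      rw [← Real.exp_add]
      refine Real.exp_le_exp.mpr ?_
      nlinarith
    calc C * t ^ n * Real.exp (b * t) * c⁻¹ * Real.exp (-(c / 2 * t))
        = C * c⁻¹ * t ^ n * (Real.exp (b * t) * Real.exp (-(c / 2 * t))) := by ring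
      _ ≤ C * c⁻¹ * t ^ n * Real.exp (-(c / 4 * t)) := by gcongr
      _ = _ := by ring
  · rw [integral_const_mul, integral_pow_mul_exp_neg_mul n (by positivity), norm_pow,
      Real.norm_of_nonneg hε0.le]
    refine le_of_eq ?_
    have hdiv : (c / 4) ^ (n + 1) = (4 ^ (n + 1) * ε ^ (n + 1))⁻¹ := by
      rw [hc, div_pow, inv_pow, mul_inv, div_eq_mul_inv, mul_comm]
    rw [hdiv, div_inv_eq_mul, hc, inv_inv]
    ring

/-- For even `j` this is Euler's evaluation of `ζ(j + 2)`; for odd `j` the factor `1 + (-1)^j` and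
the Bernoulli number both vanish. -/
theorem tsum_zeta_eq_bernoulli (j : ℕ) :
    Complex.I / (2 * Real.pi) * ((1 + (-1) ^ j) / (2 * Real.pi * Complex.I) ^ (j + 1)) *
      ∑' m : ℕ, 1 / ((m : ℂ) + 1) ^ (j + 2) =
      ((bernoulli (j + 2) : ℚ) : ℂ) / ((j + 2).factorial : ℂ) := by
  rcases j.even_or_odd with hj | hj
  · obtain ⟨p, rfl⟩ := hj
    have h := hasSum_zeta_nat (k := p + 1) (by omega)
    rw [← hasSum_nat_add_iff' 1] at h
    have h2 := (Complex.hasSum_ofReal.mpr h).tsum_eq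
    have hcongr : (fun m : ℕ => ((1 / ((m + 1 : ℕ) : ℝ) ^ (2 * (p + 1)) : ℝ) : ℂ)) =
        fun m : ℕ => 1 / ((m : ℂ) + 1) ^ (p + p + 2) := by
      funext m
      push_cast
      rw [show 2 * (p + 1) = p + p + 2 by ring]
    rw [hcongr] at h2
    rw [h2]
    have hpi : (Real.pi : ℂ) ≠ 0 := by exact_mod_cast Real.pi_ne_zero
    have e1 : 2 * (p + 1) = p + p + 2 := by ring
    have e2 : p + p + 2 - 1 = p + p + 1 := by omega
    rw [e1, e2]
    have e3 : Complex.I ^ (p + p + 1) = (-1) ^ p * Complex.I := by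
      rw [pow_succ, ← two_mul, pow_mul, Complex.I_sq]
    have e4 : ((-1 : ℂ)) ^ (p + p) = 1 := by rw [← two_mul, pow_mul]; simp
    have hf : (((p + p + 2).factorial : ℕ) : ℂ) ≠ 0 := by
      exact_mod_cast Nat.factorial_ne_zero _
    simp only [Finset.range_one, Finset.sum_singleton]
    rw [mul_pow, mul_pow, e3, e4]
    push_cast
    simp only [ne_eq, Nat.add_eq_zero_iff, OfNat.ofNat_ne_zero, and_false, not_false_eq_true,
      zero_pow, div_zero, sub_zero]
    field_simp
    ring
  · have h1 : ((-1 : ℂ)) ^ j = -1 := hj.neg_one_pow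
    have h2 : bernoulli (j + 2) = 0 := by
      refine bernoulli_eq_zero_of_odd ?_ (by omega)
      obtain ⟨p, rfl⟩ := hj
      exact ⟨p + 1, by ring⟩
    rw [h1, h2]
    simp

/-- Watson's lemma and the Bernoulli recursion meet here: the moment of a Taylor term of
`verticalDiff`, scaled by `i/(2πε)`, is the WKB term `B_k/k! · L^{(k-1)} ε^{k-1}` with `k = j + 2`
and `d = L^{(k-1)}`. -/
theorem planaCoeff_mul_integral (d : ℂ) (j : ℕ) {ε : ℝ} (hε : 0 < ε) :
    Complex.I / (2 * Real.pi * ε) * ((1 + (-1) ^ j) * d / ((j + 1).factorial : ℂ) /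
      (2 * Real.pi * Complex.I) ^ (j + 1) *
      ∫ t in Set.Ioi (0 : ℝ), (t : ℂ) ^ (j + 1) / ((Real.exp (ε⁻¹ * t) - 1 : ℝ) : ℂ)) =
      ((bernoulli (j + 2) : ℚ) : ℂ) / ((j + 2).factorial : ℂ) * d * (ε : ℂ) ^ (j + 1) := by
  have h := (integral_pow_div_exp_sub_one j (inv_pos.mpr hε)).2.tsum_eq
  have hεc : (ε : ℂ) ≠ 0 := by exact_mod_cast hε.ne'
  have hf : (((j + 1).factorial : ℕ) : ℂ) ≠ 0 := by exact_mod_cast Nat.factorial_ne_zero _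
  have hterm : (fun m : ℕ => ((j + 1).factorial : ℂ) / (((ε⁻¹ : ℝ) : ℂ) * (m + 1)) ^ (j + 2)) =
      fun m : ℕ => ((j + 1).factorial : ℂ) * (ε : ℂ) ^ (j + 2) *
        (1 / ((m : ℂ) + 1) ^ (j + 2)) := by
    funext m
    push_cast
    rw [mul_pow, inv_pow]
    field_simp
  rw [hterm, tsum_mul_left] at h
  rw [← h, ← tsum_zeta_eq_bernoulli]
  have hpi : (2 * Real.pi * Complex.I : ℂ) ^ (j + 1) ≠ 0 :=
    pow_ne_zero _ (by simp [Real.pi_ne_zero])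
  have hpi' : (Real.pi : ℂ) ≠ 0 := by exact_mod_cast Real.pi_ne_zero
  generalize (2 * Real.pi * Complex.I : ℂ) ^ (j + 1) = w at hpi
  field_simp
  ring

theorem isBigO_laplaceG_sub {a L : ℂ → ℂ} {U : Set ℂ} (hU : IsOpen U)
    (hL : AnalyticOnNhd ℂ L U) (hexp : ∀ z ∈ U, Complex.exp (L z) = a z) {x : ℝ}
    (hx : Admissible L U x) (n : ℕ) :
    (fun ε : ℝ => laplaceG a x ε - ∑ j ∈ Finset.range n,
      ((bernoulli (j + 2) : ℚ) : ℂ) / ((j + 2).factorial : ℂ) *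
        (iteratedDeriv (j + 1) L x - iteratedDeriv (j + 1) L 0) * (ε : ℂ) ^ (j + 1))
      =O[𝓝[>] 0] fun ε : ℝ => 1 / ε * ε ^ (n + 2) := by
  rcases eq_or_ne x 0 with rfl | hx0
  · simp only [laplaceG_zero, Complex.ofReal_zero, sub_self, mul_zero, zero_mul,
      Finset.sum_const_zero]
    exact Asymptotics.isBigO_zero _ _
  obtain ⟨hS, hg⟩ := hx.verticalStrip_subset hx0
  have hxpos : 0 < |x| := abs_pos.mpr hx0
  have p1 := min_le_right 0 x
  have p2 := min_le_left 0 x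
  have p3 := le_max_right 0 x
  have p4 := le_max_left 0 x
  have hW : ∀ t, HasDerivAt (planaNumerator L x)
      (verticalDiffDeriv L x t - verticalDiffDeriv L (0 : ℝ) t) t := fun t =>
    (hasDerivAt_verticalDiff hL hS p1 p3 t).sub (hasDerivAt_verticalDiff hL hS p2 p4 t)
  have hW' : Continuous fun t => verticalDiffDeriv L x t - verticalDiffDeriv L (0 : ℝ) t :=
    (continuous_verticalDiffDeriv hL hS p1 p3).sub (continuous_verticalDiffDeriv hL hS p2 p4)
  obtain ⟨A, hA0, hA⟩ := exists_norm_le_mul_exp hW hW' (planaNumerator_zero_right L x)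
    ⟨1, norm_planaNumerator_le hg p1 p3 p2 p4 1 one_pos⟩
  have hWc : Continuous (planaNumerator L x) :=
    continuous_iff_continuousAt.mpr fun t => (hW t).continuousAt
  have hLx : AnalyticAt ℂ L x := hL _ (hx.segment_subset (right_mem_segment ℝ _ _))
  have hL0 : AnalyticAt ℂ L (0 : ℝ) := by
    simpa using hL _ (hx.segment_subset (left_mem_segment ℝ _ _))
  have hO := (isBigO_verticalDiff_sub hLx n).sub (isBigO_verticalDiff_sub hL0 n)
  have hO' : (fun t : ℝ => planaNumerator L x t - ∑ j ∈ Finset.range n,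
      (verticalDiffCoeff L x j - verticalDiffCoeff L (0 : ℝ) j) * (t : ℂ) ^ (j + 1)) =O[𝓝 0]
      fun t : ℝ => |t| ^ (n + 1) := by
    refine hO.congr_left fun t => ?_
    simp only [sub_mul, Finset.sum_sub_distrib, planaNumerator]
    ring
  have hmain := isBigO_integral_div_exp_sub hWc hA0 (inv_pos.mpr hxpos) hA hO'
  have hmul := (Asymptotics.isBigO_refl (fun ε : ℝ => 1 / ε) (𝓝[>] 0)).mul hmain.norm_left
  refine Asymptotics.IsBigO.trans ?_ hmul
  refine Asymptotics.IsBigO.of_bound (1 / (2 * Real.pi)) ?_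
  filter_upwards [Ioo_mem_nhdsGT hxpos] with ε hε
  have hε0 : 0 < ε := hε.1
  have hrep := (laplaceG_eq_of_hasPlanaLimit hU hL hexp hS p1 p3 p2 p4 hε0
    (hg.mono le_rfl le_rfl hε0 hε.2.le)
    (hasPlanaLimit_of_lt hL hS p1 p3 p2 p4 hε0 hε.2 hg)).2
  have hsum : ∑ j ∈ Finset.range n, ((bernoulli (j + 2) : ℚ) : ℂ) / ((j + 2).factorial : ℂ) *
        (iteratedDeriv (j + 1) L x - iteratedDeriv (j + 1) L 0) * (ε : ℂ) ^ (j + 1) =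
      Complex.I / (2 * Real.pi * ε) * ∑ j ∈ Finset.range n,
        (verticalDiffCoeff L x j - verticalDiffCoeff L (0 : ℝ) j) *
        ∫ t in Set.Ioi (0 : ℝ), (t : ℂ) ^ (j + 1) / ((Real.exp (ε⁻¹ * t) - 1 : ℝ) : ℂ) := by
    rw [Finset.mul_sum]
    refine Finset.sum_congr rfl fun j _ => ?_
    rw [← planaCoeff_mul_integral _ j hε0, verticalDiffCoeff, verticalDiffCoeff,
      Complex.ofReal_zero]
    ring
  rw [hrep, hsum, ← mul_sub, norm_mul]
  have hn : ‖Complex.I / (2 * Real.pi * ε)‖ = 1 / (2 * Real.pi) * (1 / ε) := by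
    rw [norm_div, norm_mul, norm_mul, Complex.norm_I, Complex.norm_real, Complex.norm_real,
      Real.norm_of_nonneg Real.pi_pos.le, Real.norm_of_nonneg hε0.le]
    norm_num
    ring
  rw [hn, norm_mul, norm_norm, Real.norm_of_nonneg (by positivity : 0 ≤ 1 / ε), mul_assoc]

/-- The coefficients `F_0` and `F_1` are the explicit terms of `exactExponent`; all later ones come
from the Laplace integral. The bound is written `1/ε · ε^K` so that `K = 0` needs no negative
exponent. -/
theorem isBigO_exactExponent_sub {a L : ℂ → ℂ} {U : Set ℂ} (hU : IsOpen U)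
    (hL : AnalyticOnNhd ℂ L U) (hexp : ∀ z ∈ U, Complex.exp (L z) = a z) {x : ℝ}
    (hx : Admissible L U x) {F : ℕ → ℂ → ℂ} (hF : IsWKBExponent a L x F) (K : ℕ) :
    (fun ε : ℝ => exactExponent a L x ε -
        1 / (ε : ℂ) * ∑ k ∈ Finset.range K, F k (x : ℂ) * (ε : ℂ) ^ k)
      =O[𝓝[>] (0 : ℝ)] (fun ε : ℝ => 1 / ε * ε ^ K) := by
  have hseg := hx.segment_subset
  -- The estimate passes from `K + 1` down to `K`, because the omitted term has the size of the
  -- permitted error. Starting from `K + 2` therefore suffices.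
  have hstep : ∀ K : ℕ, (fun ε : ℝ => exactExponent a L x ε -
        1 / (ε : ℂ) * ∑ k ∈ Finset.range (K + 1), F k (x : ℂ) * (ε : ℂ) ^ k)
      =O[𝓝[>] (0 : ℝ)] (fun ε : ℝ => 1 / ε * ε ^ (K + 1)) →
      (fun ε : ℝ => exactExponent a L x ε -
        1 / (ε : ℂ) * ∑ k ∈ Finset.range K, F k (x : ℂ) * (ε : ℂ) ^ k)
      =O[𝓝[>] (0 : ℝ)] (fun ε : ℝ => 1 / ε * ε ^ K) := by
    intro K h
    have h1 : (fun ε : ℝ => 1 / ε * ε ^ (K + 1)) =O[𝓝[>] (0 : ℝ)] fun ε : ℝ => 1 / ε * ε ^ K := by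
      refine (Asymptotics.isBigO_refl _ _).mul (Asymptotics.IsBigO.of_bound 1 ?_)
      filter_upwards [Ioo_mem_nhdsGT (one_pos (α := ℝ))] with ε hε
      rw [norm_pow, norm_pow, one_mul, Real.norm_of_nonneg hε.1.le]
      exact pow_le_pow_of_le_one hε.1.le hε.2.le (Nat.le_succ K)
    have h2 : (fun ε : ℝ => 1 / (ε : ℂ) * (F K (x : ℂ) * (ε : ℂ) ^ K)) =O[𝓝[>] (0 : ℝ)]
        fun ε : ℝ => 1 / ε * ε ^ K := by
      refine Asymptotics.IsBigO.of_bound ‖F K (x : ℂ)‖ (Eventually.of_forall fun ε => le_of_eq ?_)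
      simp only [norm_mul, norm_div, norm_pow, norm_one, Complex.norm_real]
      ring
    refine ((h.trans h1).add h2).congr_left fun ε => ?_
    rw [Finset.sum_range_succ]
    ring
  have hbase : ∀ n : ℕ, (fun ε : ℝ => exactExponent a L x ε -
        1 / (ε : ℂ) * ∑ k ∈ Finset.range (n + 2), F k (x : ℂ) * (ε : ℂ) ^ k)
      =O[𝓝[>] (0 : ℝ)] (fun ε : ℝ => 1 / ε * ε ^ (n + 2)) := by
    intro n
    refine (isBigO_laplaceG_sub hU hL hexp hx n).congr' ?_ (Eventually.of_forall fun _ => rfl)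
    filter_upwards [self_mem_nhdsWithin] with ε hε
    have hε0 : (ε : ℂ) ≠ 0 := by exact_mod_cast (ne_of_gt hε : ε ≠ 0)
    have h0 := hF.apply_zero hL hexp hseg
    have h1 := hF.apply_succ hL hexp hseg
    have hb1 := h1 0
    simp only [zero_add, bernoulli_one, Nat.factorial_one, iteratedDeriv_zero] at hb1
    rw [Finset.sum_range_succ', Finset.sum_range_succ', zero_add, h0, hb1, mul_add, mul_add,
      Finset.mul_sum, exactExponent]
    have hs : ∑ k ∈ Finset.range n, 1 / (ε : ℂ) * (F (k + 1 + 1) (x : ℂ) * (ε : ℂ) ^ (k + 1 + 1)) =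
        ∑ j ∈ Finset.range n, ((bernoulli (j + 2) : ℚ) : ℂ) / ((j + 2).factorial : ℂ) *
        (iteratedDeriv (j + 1) L x - iteratedDeriv (j + 1) L 0) * (ε : ℂ) ^ (j + 1) := by
      refine Finset.sum_congr rfl fun j _ => ?_
      rw [h1 (j + 1), pow_succ _ (j + 1)]
      field_simp
    rw [hs]
    push_cast
    field_simp
    ring
  exact hstep K (hstep (K + 1) (hbase K))

/-! ### The main theorem -/

theorem mainTheorem4 (a L : ℂ → ℂ) (U : Set ℂ) (hU : IsOpen U)
    (hL : AnalyticOnNhd ℂ L U) (hexp : ∀ z ∈ U, Complex.exp (L z) = a z) :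
    (∀ x : ℝ, Admissible L U x →
      (∃ F : ℕ → ℂ → ℂ, IsWKBExponent a L x F) ∧
      (∀ q : ℝ, 0 ≤ q → Summable (borelTerm a (q : ℂ) (x : ℂ))) ∧
      (∀ ε : ℝ, 0 < ε → (x ≠ 0 → ε ≤ |x|) → LaplaceConverges a x ε) ∧
      (∀ F : ℕ → ℂ → ℂ, IsWKBExponent a L x F → ∀ K : ℕ,
        (fun ε : ℝ => exactExponent a L x ε -
            1 / (ε : ℂ) * ∑ k ∈ Finset.range K, F k (x : ℂ) * (ε : ℂ) ^ k)
          =O[𝓝[>] (0 : ℝ)] (fun ε : ℝ => 1 / ε * ε ^ K)) ∧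
      (∀ r : ℝ, 0 < r → Metric.closedBall (0 : ℂ) r ⊆ U → Metric.closedBall (x : ℂ) r ⊆ U →
        ∀ q : ℂ, ‖q‖ < 2 * Real.pi * r →
          Summable (borelTerm a q (x : ℂ)) ∧
          IntegrableOn (contourInner L r q (x : ℂ)) (Set.Ioi 0) volume ∧
          borelG a q (x : ℂ) = 1 / (2 * (Real.pi : ℂ) * Complex.I) ^ 3 *
            ∫ u in Set.Ioi (0 : ℝ), contourInner L r q (x : ℂ) u)) ∧
    (∀ ε : ℝ, 0 < ε → ∀ x : ℝ, Admissible L U x → Admissible L U (x + ε) →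
      (0 ≤ x ∨ x + ε ≤ 0) →
        LaplaceConverges a x ε ∧ LaplaceConverges a (x + ε) ε ∧
        exactSolution a L (x + ε) ε = a (x : ℂ) * exactSolution a L x ε) := by

  refine ⟨fun x hx => ?_, fun ε hε x hx hx' h =>
    exactSolution_functional_equation hU hL hexp hε hx hx' h⟩
  have hseg := hx.segment_subset
  have h0 : (0 : ℂ) ∈ U := hseg (left_mem_segment ℝ _ _)
  have hxU : (x : ℂ) ∈ U := hseg (right_mem_segment ℝ _ _)
  refine ⟨exists_isWKBExponent hU hL hexp hseg,
    fun q _ => summable_borelTerm hU hL hexp h0 hxU q,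
    fun ε hε hεx => hx.laplaceConverges hU hL hexp hε hεx,
    fun F hF K => isBigO_exactExponent_sub hU hL hexp hx hF K,
    fun r hr hr0 hrx q hq => ⟨summable_borelTerm hU hL hexp h0 hxU q,
      borelG_eq_contour hU hL hexp hr hr0 hrx hq⟩⟩
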